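/- **Setting.** Let $\xi_0\in[2,\omega]$ and let $p_1<p_2<\cdots$, together with $p_{\xi_0}$, be exponents in $[1,\infty]$ indexed by $1\le k\le\xi_0$: if $\xi_0<\omega$ then $p_1<\dots<p_{\xi_0}$; if $\xi_0=\omega$ then $(p_k)_{k<\omega}$ is strictly increasing with limit $p_\omega$. Let $p'$ denote the conjugate exponent of $p$ ($1'=\infty$, $\infty'=1$), and fix $0<\theta\le 1/4$. Here $\mathbb N=\{1,2,\dots\}$, scalars are real, and $f_1<\dots<f_d$ means that the $f_q\in c_{00}(\mathbb N)$ are nonzero with successive supports. The sequence $f_1<\dots<f_d$ is *admissible* if $d\le\min\operatorname{supp}f_1$; if each $f_q$ is assigned a size $s(f_q)\in\mathbb N$, it is *very fast growing* if $(\max\operatorname{supp}f_{q-1})^2<\min\operatorname{supp}f_q$ and $s(f_q)>\max\operatorname{supp}f_{q-1}$ for all $q>1$. Let $W\subset c_{00}(\mathbb N)$ be the smallest set, with orders and sizes attached to some of its elements (possibly several to one element), such that: * $\pm e_j^*\in W$ for all $j\in\mathbb N$ (no order or size); * if $d\ge1$, $f_1<\dots<f_d$ are in $W$ and $\|(c_q)_{q=1}^d\|_{\ell_{p_{\xi_0}'}}\le1$,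 then $\theta\sum_{q=1}^dc_qf_q\in W$, and it has order $0$; if moreover $c_q=n^{-1/p_{\xi_0}'}$ for all $q$, where $n\ge d$, it has size $n$; * if $1\le k<\xi_0$, $d\ge 1$, $(f_q)_{q=1}^d$ is an admissible and very fast growing sequence in $W$, each $f_q$ of order strictly smaller than $k$ (with a size), and $\|(c_q)_{q=1}^d\|_{\ell_{p_k'}}\le1$, then $\theta\sum_{q=1}^dc_qf_q\in W$, of order $k$ and size $\min_q s(f_q)$. Let $X$ be the completion of $c_{00}(\mathbb N)$ under the norm $\|x\|=\sup\{|f(x)|:f\in W\}$. A *block sequence* of a sequence $(z_i)_i$ is a sequence of finite linear combinations $y_j=\sum_i a_{j,i}z_i$ with nonzero coefficient vectors $(a_{j,i})_i$ having successive supports; a block sequence in $X$ is one of the unit vector basis. A basic sequence $(x_j)_j$ *generates an $\ell_p$ spreading model* if there is a basic sequence $(e_i)_i$ in some Banach space, equivalent to the unit vector basis of $\ell_p$ (of $c_0$ if $p=\infty$), such that $\|\sum_{i=1}^na_ie_i\|=\lim_{t_1\to\infty}\cdots\lim_{t_n\to\infty}\|\sum_{i=1}^na_ix_{t_i}\|$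 for all $n$ and all scalars $a_1,\dots,a_n$. **Proposition.** Let $(x_j)_j$ be a normalized block sequence in $X$. 1. If $(x_j)_j$ generates an $\ell_{p_{\xi_0}}$ spreading model, then there is a normalized block sequence $(y_j)_j$ of $(x_j)_j$ that generates an $\ell_{p_1}$ spreading model. 2. If $1\le k<\xi_0$ and $(x_j)_j$ generates an $\ell_{p_k}$ spreading model, then there is a normalized block sequence $(y_j)_j$ of $(x_j)_j$ that generates an $\ell_{p_{k+1}}$ spreading model. -/

import Mathlib

open Filter Topology
open scoped ENNReal

noncomputable section

/-! ### Basic sequences, blocks, equivalence, spreading models -/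

/-- `(e i)` is a (Schauder) basic sequence: a Schauder basis of its closed linear span. -/
def IsBasicSequence {E : Type*} [NormedAddCommGroup E] [NormedSpace ℝ E] (e : ℕ → E) : Prop :=
  ∃ b : SchauderBasis ℝ (Submodule.span ℝ (Set.range e)).topologicalClosure,
    ∀ n, (b n : E) = e n

/-- `(y j)` is a block sequence of the family `(x i)`: each `y j` is a finite linear combination
`∑ i, a j i • x i` with nonzero coefficient vector `a j`, and the supports of
`a 0, a 1, a 2, …` are successive. -/
def IsBlockSequence {ι E : Type*} [LinearOrder ι] [AddCommGroup E] [Module ℝ E]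
    (y : ℕ → E) (x : ι → E) : Prop :=
  ∃ a : ℕ → ι →₀ ℝ,
    (∀ j, a j ≠ 0) ∧
    (∀ j, ∀ s ∈ (a j).support, ∀ t ∈ (a (j + 1)).support, s < t) ∧
    ∀ j, y j = Finsupp.linearCombination ℝ x (a j)

/-- Two sequences are equivalent: the norms of linear combinations with the same finitely many
coefficients are comparable up to a uniform constant. -/
def SeqEquivalent {E U : Type*} [AddCommGroup E] [Module ℝ E] [Norm E]
    [AddCommGroup U] [Module ℝ U] [Norm U] (e : ℕ → E) (u : ℕ → U) : Prop :=
  ∃ C : ℝ, 1 ≤ C ∧ ∀ a : ℕ →₀ ℝ,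
    C⁻¹ * ‖Finsupp.linearCombination ℝ u a‖ ≤ ‖Finsupp.linearCombination ℝ e a‖ ∧
    ‖Finsupp.linearCombination ℝ e a‖ ≤ C * ‖Finsupp.linearCombination ℝ u a‖

/-- `lim_{t₁ → ∞} ⋯ lim_{tₙ → ∞} F (t₁, …, tₙ)` exists and equals `L`. (At each step the inner
limit is required to exist for all sufficiently large values of the outer variable.) -/
def IteratedLimit : (n : ℕ) → ((Fin n → ℕ) → ℝ) → ℝ → Prop
  | 0, F, L => F Fin.elim0 = L
  | n + 1, F, L => ∃ g : ℕ → ℝ,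
      (∀ᶠ t in atTop, IteratedLimit n (fun s => F (Fin.cons t s)) (g t)) ∧
      Tendsto g atTop (𝓝 L)

/-- The basic sequence `e` is a spreading model of the basic sequence `x`. -/
def IsSpreadingModel {E X : Type*} [NormedAddCommGroup E] [NormedSpace ℝ E]
    [NormedAddCommGroup X] [NormedSpace ℝ X] (e : ℕ → E) (x : ℕ → X) : Prop :=
  IsBasicSequence e ∧ IsBasicSequence x ∧
    ∀ (n : ℕ) (a : Fin n → ℝ),
      IteratedLimit n (fun t => ‖∑ i, a i • x (t i)‖) ‖∑ i, a i • e i‖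

/-- The unit vectors of `ℓ_p` (for `p = ∞` they span a copy of `c₀`). -/
def lpUnitVector (p : ℝ≥0∞) (i : ℕ) : lp (fun _ : ℕ => ℝ) p := lp.single p i (1 : ℝ)

/-- The sequence `x` generates an `ℓ_p` spreading model: some basic sequence in a Banach space is
a spreading model of `x` and is equivalent to the unit vector basis of `ℓ_p`
(of `c₀` if `p = ∞`). -/
def GeneratesLpSpreadingModel {X : Type*} [NormedAddCommGroup X] [NormedSpace ℝ X]
    (p : ℝ≥0∞) (x : ℕ → X) : Prop :=
  ∃ (E : Type) (_ : NormedAddCommGroup E) (_ : NormedSpace ℝ E) (_ : CompleteSpace E)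
    (e : ℕ → E), IsSpreadingModel e x ∧ SeqEquivalent e (lpUnitVector p)

/-! ### The parameters and the norming set -/

/-- The parameters of the construction: `ξ ∈ [2, ω]` (with `⊤` for `ω`), exponents
`p k ∈ [1, ∞]` for `1 ≤ k ≤ ξ`, strictly increasing in `k` and, if `ξ = ω`, with `p ω` the limit
of the `p k`, and `0 < θ ≤ 1/4`. -/
structure SpaceParams where
  ξ : ℕ∞
  two_le_ξ : 2 ≤ ξ
  p : ℕ∞ → ℝ≥0∞
  one_le_p : 1 ≤ p 1
  p_strictMono : StrictMonoOn p (Set.Icc 1 ξ)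
  p_tendsto : ξ = ⊤ → Tendsto (fun k : ℕ => p k) atTop (𝓝 (p ⊤))
  θ : ℝ
  θ_pos : 0 < θ
  θ_le : θ ≤ 1 / 4

/-- `‖(c_q)_q‖_{ℓ_r} ≤ 1`. -/
def InLpUnitBall (r : ℝ≥0∞) {d : ℕ} (c : Fin d → ℝ) : Prop :=
  if r = ⊤ then ∀ q, |c q| ≤ 1 else ∑ q, |c q| ^ r.toReal ≤ 1

/-- `f₁ < ⋯ < f_d`: nonzero finitely supported functionals with successive supports. -/
def Successive {d : ℕ} (f : Fin d → ℕ+ →₀ ℝ) : Prop :=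
  (∀ q, f q ≠ 0) ∧ ∀ q r, q < r → ∀ i ∈ (f q).support, ∀ j ∈ (f r).support, i < j

/-- Admissible: successive and `d ≤ min supp f₁`. -/
def Admissible {d : ℕ} (f : Fin d → ℕ+ →₀ ℝ) : Prop :=
  Successive f ∧ ∀ q : Fin d, (q : ℕ) = 0 → ∀ i ∈ (f q).support, d ≤ (i : ℕ)

/-- Very fast growing with respect to the sizes `s`:
`(max supp f_{q-1})² < min supp f_q` and `s_q > max supp f_{q-1}` for `q > 1`. -/
def VeryFastGrowing {d : ℕ} (f : Fin d → ℕ+ →₀ ℝ) (s : Fin d → ℕ) : Prop :=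
  ∀ q r : Fin d, (q : ℕ) + 1 = r → ∀ i ∈ (f q).support,
    (∀ j ∈ (f r).support, i ^ 2 < j) ∧ (i : ℕ) < s r

namespace SpaceParams

variable (P : SpaceParams)

/-- The conjugate exponent of `p k` (`1' = ∞`, `∞' = 1`). -/
def conj (k : ℕ∞) : ℝ≥0∞ := ENNReal.conjExponent (P.p k)

/-- `P.Norming l f`: the functional `f ∈ c₀₀` belongs to the norming set. The label `l` is
`some (k, s)` if `f` arises as a functional of order `k` with size `s`, and `none` if `f` arises
as `± e_j*` or as a functional of order `0` without a size. A functional may have several labels.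
This is the least family closed under the listed operations, that is, the union of the stages
`W_0 ⊆ W_1 ⊆ ⋯`. -/
inductive Norming : Option (ℕ × ℕ) → (ℕ+ →₀ ℝ) → Prop
  | unit (j : ℕ+) (ε : ℝ) (hε : ε = 1 ∨ ε = -1) : Norming none (Finsupp.single j ε)
  | orderZero {d : ℕ} (hd : 0 < d) (f : Fin d → ℕ+ →₀ ℝ) (l : Fin d → Option (ℕ × ℕ))
      (hf : ∀ q, Norming (l q) (f q)) (hsucc : Successive f)
      (c : Fin d → ℝ) (hc : InLpUnitBall (P.conj P.ξ) c) :
      Norming none (P.θ • ∑ q, c q • f q)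
  | orderZeroSized {d n : ℕ} (hd : 0 < d) (hdn : d ≤ n) (f : Fin d → ℕ+ →₀ ℝ)
      (l : Fin d → Option (ℕ × ℕ))
      (hf : ∀ q, Norming (l q) (f q)) (hsucc : Successive f) :
      Norming (some (0, n))
        (P.θ • ∑ q, ((1 / (n : ℝ)) ^ (1 / (P.conj P.ξ).toReal)) • f q)
  | orderPos {d : ℕ} (hd : 0 < d) (k : ℕ) (hk : 1 ≤ k) (hkξ : (k : ℕ∞) < P.ξ)
      (f : Fin d → ℕ+ →₀ ℝ) (o s : Fin d → ℕ)
      (hf : ∀ q, Norming (some (o q, s q)) (f q)) (ho : ∀ q, o q < k)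
      (hadm : Admissible f) (hvfg : VeryFastGrowing f s)
      (c : Fin d → ℝ) (hc : InLpUnitBall (P.conj k) c)
      (m : ℕ) (hm : IsLeast (Set.range s) m) :
      Norming (some (k, m)) (P.θ • ∑ q, c q • f q)

/-- The norming set `W ⊆ c₀₀`. -/
def normingSet : Set (ℕ+ →₀ ℝ) := {f | ∃ l, P.Norming l f}

/-- The action `f(x) = ∑ j, f_j x_j` of a functional on a vector. -/
def pairing (f x : ℕ+ →₀ ℝ) : ℝ := f.sum fun j r => r * x j

/-! ### The norm -/

theorem one_le_conj (k : ℕ∞) : 1 ≤ P.conj k := by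
  unfold conj ENNReal.conjExponent
  exact le_self_add

theorem abs_le_one_of_inLpUnitBall {r : ℝ≥0∞} (hr : 1 ≤ r) {d : ℕ} {c : Fin d → ℝ}
    (hc : InLpUnitBall r c) (q : Fin d) : |c q| ≤ 1 := by
  unfold InLpUnitBall at hc
  split_ifs at hc with h
  · exact hc q
  · have hpos : 0 < r.toReal := ENNReal.toReal_pos (by positivity) h
    have h1 : |c q| ^ r.toReal ≤ 1 :=
      (Finset.single_le_sum (f := fun q => |c q| ^ r.toReal) (fun i _ => by positivity)
        (Finset.mem_univ q)).trans hc
    by_contra hlt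
    push Not at hlt
    exact absurd h1 (not_le.mpr (Real.one_lt_rpow hlt hpos))

theorem abs_combination_le {d : ℕ} {f : Fin d → ℕ+ →₀ ℝ} (hs : Successive f)
    (hf : ∀ q i, |f q i| ≤ 1) {c : Fin d → ℝ} (hc : ∀ q, |c q| ≤ 1) (i : ℕ+) :
    |(P.θ • ∑ q, c q • f q) i| ≤ 1 := by
  have hθ : |P.θ| ≤ 1 := by rw [abs_of_pos P.θ_pos]; linarith [P.θ_le]
  have hsum : |∑ q, c q * f q i| ≤ 1 := by
    by_cases h : ∃ q, f q i ≠ 0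
    · obtain ⟨q, hq⟩ := h
      rw [Finset.sum_eq_single q]
      · rw [abs_mul]; exact mul_le_one₀ (hc q) (abs_nonneg _) (hf q i)
      · intro r _ hr
        by_contra hne
        have hri : i ∈ (f r).support := Finsupp.mem_support_iff.mpr (right_ne_zero_of_mul hne)
        have hqi : i ∈ (f q).support := Finsupp.mem_support_iff.mpr hq
        rcases lt_or_gt_of_ne hr with h | h
        · exact lt_irrefl _ (hs.2 r q h i hri i hqi)
        · exact lt_irrefl _ (hs.2 q r h i hqi i hri)
      · simp
    · push Not at h
      simp [h]
  have : (P.θ • ∑ q, c q • f q) i = P.θ * ∑ q, c q * f q i := by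
    simp
  rw [this, abs_mul]
  exact mul_le_one₀ hθ (abs_nonneg _) hsum

theorem abs_apply_le_one {l : Option (ℕ × ℕ)} {f : ℕ+ →₀ ℝ} (h : P.Norming l f) :
    ∀ i, |f i| ≤ 1 := by
  induction h with
  | unit j ε hε =>
    intro i
    rw [Finsupp.single_apply]
    split_ifs
    · rcases hε with rfl | rfl <;> simp
    · simp
  | orderZero hd f l hf hs c hc ih =>
    exact P.abs_combination_le hs ih (abs_le_one_of_inLpUnitBall (P.one_le_conj _) hc)
  | orderZeroSized hd hdn f l hf hs ih =>
    refine P.abs_combination_le hs ih fun q => ?_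
    rw [abs_of_nonneg (by positivity)]
    refine Real.rpow_le_one (by positivity) ?_ (by positivity)
    rw [div_le_one (by exact_mod_cast hd.trans_le hdn)]
    exact_mod_cast hd.trans_le hdn
  | orderPos hd k hk hkξ f o s hf ho hadm hvfg c hc m hm ih =>
    exact P.abs_combination_le hadm.1 ih (abs_le_one_of_inLpUnitBall (P.one_le_conj _) hc)

theorem pairing_eq_sum (f x : ℕ+ →₀ ℝ) : pairing f x = ∑ j ∈ x.support, f j * x j := by
  unfold pairing
  rw [Finsupp.sum, Finset.sum_subset (Finset.subset_union_left (s₂ := x.support)),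
    ← Finset.sum_subset (Finset.subset_union_right (s₁ := f.support))]
  · intro j _ hj
    simp [Finsupp.notMem_support_iff.mp hj]
  · intro j _ hj
    simp [Finsupp.notMem_support_iff.mp hj]

theorem pairing_add (f x y : ℕ+ →₀ ℝ) : pairing f (x + y) = pairing f x + pairing f y := by
  simp [pairing, Finsupp.sum, mul_add, Finset.sum_add_distrib]

theorem pairing_smul (f : ℕ+ →₀ ℝ) (a : ℝ) (x : ℕ+ →₀ ℝ) :
    pairing f (a • x) = a * pairing f x := by
  simp [pairing, Finsupp.sum, Finset.mul_sum, mul_left_comm]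

/-- `‖x‖ = sup {|f(x)| : f ∈ W}` for `x ∈ c₀₀`. -/
def c00Norm (x : ℕ+ →₀ ℝ) : ℝ := sSup ((fun f => |pairing f x|) '' P.normingSet)

theorem bddAbove_pairing (x : ℕ+ →₀ ℝ) :
    BddAbove ((fun f => |pairing f x|) '' P.normingSet) := by
  refine ⟨∑ j ∈ x.support, |x j|, ?_⟩
  rintro _ ⟨f, ⟨l, hf⟩, rfl⟩
  simp only [pairing_eq_sum]
  refine (Finset.abs_sum_le_sum_abs _ _).trans (Finset.sum_le_sum fun j _ => ?_)
  rw [abs_mul]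
  exact mul_le_of_le_one_left (abs_nonneg _) (P.abs_apply_le_one hf j)

theorem single_mem_normingSet (j : ℕ+) : Finsupp.single j (1 : ℝ) ∈ P.normingSet :=
  ⟨none, .unit j 1 (Or.inl rfl)⟩

theorem abs_pairing_le {f : ℕ+ →₀ ℝ} (hf : f ∈ P.normingSet) (x : ℕ+ →₀ ℝ) :
    |pairing f x| ≤ P.c00Norm x :=
  le_csSup (P.bddAbove_pairing x) ⟨f, hf, rfl⟩

theorem c00Norm_le {x : ℕ+ →₀ ℝ} {r : ℝ} (h : ∀ f ∈ P.normingSet, |pairing f x| ≤ r) :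
    P.c00Norm x ≤ r := by
  refine csSup_le (Set.Nonempty.image _ ⟨_, P.single_mem_normingSet 1⟩) ?_
  rintro _ ⟨f, hf, rfl⟩
  exact h f hf

theorem c00Norm_nonneg (x : ℕ+ →₀ ℝ) : 0 ≤ P.c00Norm x :=
  (abs_nonneg _).trans (P.abs_pairing_le (P.single_mem_normingSet 1) x)

theorem c00Norm_smul_le (a : ℝ) (x : ℕ+ →₀ ℝ) : P.c00Norm (a • x) ≤ |a| * P.c00Norm x :=
  P.c00Norm_le fun f hf => by
    rw [pairing_smul, abs_mul]
    exact mul_le_mul_of_nonneg_left (P.abs_pairing_le hf x) (abs_nonneg _)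

/-- The norm induced by the norming set, as a group norm on `c₀₀`. -/
def c00GroupNorm : AddGroupNorm (ℕ+ →₀ ℝ) where
  toFun := P.c00Norm
  map_zero' := le_antisymm (P.c00Norm_le fun f _ => by simp [pairing, Finsupp.sum])
    (P.c00Norm_nonneg _)
  add_le' x y := P.c00Norm_le fun f hf => by
    rw [pairing_add]
    exact (abs_add_le _ _).trans (add_le_add (P.abs_pairing_le hf _) (P.abs_pairing_le hf _))
  neg' x := by
    have key : ∀ y : ℕ+ →₀ ℝ, P.c00Norm (-y) ≤ P.c00Norm y := fun y => by
      simpa using P.c00Norm_smul_le (-1) y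
    refine le_antisymm (key x) ?_
    simpa using key (-x)
  eq_zero_of_map_eq_zero' x hx := by
    ext j
    have h := (P.abs_pairing_le (P.single_mem_normingSet j) x).trans_eq hx
    simpa [pairing] using h

/-- `c₀₀(ℕ)` equipped with the norm induced by the norming set. -/
def C00 (_ : SpaceParams) : Type := ℕ+ →₀ ℝ

instance : AddCommGroup P.C00 := inferInstanceAs (AddCommGroup (ℕ+ →₀ ℝ))

instance : Module ℝ P.C00 := inferInstanceAs (Module ℝ (ℕ+ →₀ ℝ))

instance : NormedAddCommGroup P.C00 :=
  AddGroupNorm.toNormedAddCommGroup (show AddGroupNorm P.C00 from P.c00GroupNorm)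

theorem norm_c00_def (x : P.C00) : ‖x‖ = P.c00Norm x := rfl

instance : NormedSpace ℝ P.C00 where
  norm_smul_le a x := P.c00Norm_smul_le a x

/-- The Banach space `X`: the completion of `c₀₀(ℕ)` under the norm induced by `W`. -/
abbrev Space : Type := UniformSpace.Completion P.C00

/-- The unit vector basis of `X`. -/
def basis (j : ℕ+) : P.Space :=
  UniformSpace.Completion.coe' (show P.C00 from Finsupp.single j (1 : ℝ))

end SpaceParams

end

/-! The exponent of a spreading model is governed by how functionals of large size act on the
sequence. `Vanishing k` says that functionals of order below `k` whose sizes tend to infinity tend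
to zero along the sequence. The central fact, `exists_subseq_generates`, is that a normalized block
sequence with `Vanishing K`, and without `Vanishing (K + 1)` when `K + 1 < ξ`, has a subsequence
generating an `ℓ_{p_{K+1}}` spreading model.

Upper estimate (`c00Norm_sum_le`). After thinning, tuples far out are `Sparse`, and induction over
the norming set gives the constant 2. Let `f = θ ∑ c_q f_q`. If `f` has order `0` or order above
`K`, then `‖c‖ ≤ 1` in the conjugate of `ℓ_{p_{K+1}}`. Grouping the blocks by the first `f_q` they
meet reproduces the inductive bound with the factor `θ ≤ 1/4`; every `f_q` is a non-first functional
for at most one block, so what is left costs a single further norm of the coefficients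
(`abs_pairing_combination_le`). If `f` has positive order at most `K`, sparseness makes all but the
first active `f_q` negligible beyond the first block met (`exists_abs_pairing_orderPos_le`).

Lower estimate. Failure of `Vanishing (K + 1)` supplies functionals of order at most `K`, uniformly
large on the blocks, supported on them and very fast growing. Their admissible combinations have
order `K + 1` and carry `ℓ_{p'_{K+1}}` coefficients, so duality applies. For `K + 1 = ξ`, unsized
functionals of order `0` do the same for any block sequence.

For the first claim, sums over growing finite sets `F` are normalized. Their norms are of the order
of `|F|^{1/p_ξ}`, which an order `0` functional of size `|F|` attains up to a constant, so
`Vanishing 1` fails. For the second claim, an `ℓ_{p_{K+1}}` spreading model forces `Vanishing K` and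
the failure of `Vanishing (K + 1)`, since otherwise the lower `ℓ_{p_K}` or the upper `ℓ_{p_{K+2}}`
estimate would hold on a subsequence. Normalized sums over long sparse sets are then almost normed
by functionals of order `K + 1` with large size. Those of order at most `K` become negligible,
because a sized order `0` functional produces only the growth of `ℓ_{p_ξ}`
(`Norming.abs_pairing_sum_le_of_size`). Hence the index rises by exactly one. -/

open scoped NNReal

noncomputable section

/-! ### Finite `ℓ_p` norms, Hölder's inequality and duality -/

/-- The `ℓ_p` norm of the restriction of `a` to the finite set `S`. -/
def lpNormOn {ι : Type*} (p : ℝ≥0∞) (S : Finset ι) (a : ι → ℝ) : ℝ :=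
  if p = ⊤ then ((S.sup fun i => ‖a i‖₊ : ℝ≥0) : ℝ)
  else (∑ i ∈ S, |a i| ^ p.toReal) ^ (1 / p.toReal)

section lpNormOn

variable {ι κ : Type*} {p q : ℝ≥0∞} {S T : Finset ι} {a b : ι → ℝ}

theorem one_le_toReal_of_one_le (hp : 1 ≤ p) (h : p ≠ ⊤) : 1 ≤ p.toReal := by
  have := ENNReal.toReal_mono h hp
  simpa using this

theorem lpNormOn_nonneg : 0 ≤ lpNormOn p S a := by
  unfold lpNormOn
  split_ifs
  · exact NNReal.coe_nonneg _
  · positivity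

theorem lpNormOn_top_le_iff {M : ℝ} (hM : 0 ≤ M) :
    lpNormOn ⊤ S a ≤ M ↔ ∀ i ∈ S, |a i| ≤ M := by
  lift M to ℝ≥0 using hM
  simp only [lpNormOn, if_true, NNReal.coe_le_coe, Finset.sup_le_iff]
  refine forall₂_congr fun i _ => ?_
  rw [← NNReal.coe_le_coe, coe_nnnorm, Real.norm_eq_abs]

theorem lpNormOn_le_iff_of_ne_top (hp : 1 ≤ p) (h : p ≠ ⊤) {M : ℝ} (hM : 0 ≤ M) :
    lpNormOn p S a ≤ M ↔ ∑ i ∈ S, |a i| ^ p.toReal ≤ M ^ p.toReal := by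
  have hpos : 0 < p.toReal := zero_lt_one.trans_le (one_le_toReal_of_one_le hp h)
  rw [lpNormOn, if_neg h, one_div, Real.rpow_inv_le_iff_of_pos (by positivity) hM hpos]

theorem lpNormOn_rpow (hp : 1 ≤ p) (h : p ≠ ⊤) :
    lpNormOn p S a ^ p.toReal = ∑ i ∈ S, |a i| ^ p.toReal := by
  have hpos : 0 < p.toReal := zero_lt_one.trans_le (one_le_toReal_of_one_le hp h)
  rw [lpNormOn, if_neg h, one_div, Real.rpow_inv_rpow (by positivity) hpos.ne']

theorem abs_le_lpNormOn (hp : 1 ≤ p) {i : ι} (hi : i ∈ S) : |a i| ≤ lpNormOn p S a := by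
  by_cases h : p = ⊤
  · subst h
    exact (lpNormOn_top_le_iff lpNormOn_nonneg).1 le_rfl i hi
  · have hpos : 0 < p.toReal := zero_lt_one.trans_le (one_le_toReal_of_one_le hp h)
    rw [← Real.rpow_le_rpow_iff (abs_nonneg _) lpNormOn_nonneg hpos, lpNormOn_rpow hp h]
    exact Finset.single_le_sum (f := fun i => |a i| ^ p.toReal) (fun i _ => by positivity) hi

theorem lpNormOn_mono (hp : 1 ≤ p) (hST : S ⊆ T) (h : ∀ i ∈ S, |a i| ≤ |b i|) :
    lpNormOn p S a ≤ lpNormOn p T b := by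
  by_cases hT : p = ⊤
  · subst hT
    exact (lpNormOn_top_le_iff lpNormOn_nonneg).2 fun i hi =>
      (h i hi).trans (abs_le_lpNormOn hp (hST hi))
  · rw [lpNormOn_le_iff_of_ne_top hp hT lpNormOn_nonneg, lpNormOn_rpow hp hT]
    exact (Finset.sum_le_sum fun i hi => Real.rpow_le_rpow (abs_nonneg _) (h i hi)
      (by positivity)).trans (Finset.sum_le_sum_of_subset_of_nonneg hST fun i _ _ => by positivity)

theorem lpNormOn_congr (h : ∀ i ∈ S, |a i| = |b i|) : lpNormOn p S a = lpNormOn p S b := by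
  unfold lpNormOn
  congr 1
  · congr 1
    refine Finset.sup_congr rfl fun i hi => ?_
    ext
    simpa using h i hi
  · rw [Finset.sum_congr rfl fun i hi => by rw [h i hi]]

theorem lpNormOn_const_mul (hp : 1 ≤ p) (c : ℝ) :
    lpNormOn p S (fun i => c * a i) = |c| * lpNormOn p S a := by
  unfold lpNormOn
  split_ifs with h
  · have : (fun i => ‖c * a i‖₊) = fun i => ‖c‖₊ * ‖a i‖₊ := by ext; simp
    rw [this, ← NNReal.mul_finset_sup]
    simp
  · have hpos : 0 < p.toReal := zero_lt_one.trans_le (one_le_toReal_of_one_le hp h)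
    simp_rw [abs_mul, Real.mul_rpow (abs_nonneg _) (abs_nonneg _)]
    rw [← Finset.mul_sum, Real.mul_rpow (by positivity) (by positivity), one_div,
      Real.rpow_rpow_inv (abs_nonneg _) hpos.ne']

theorem lpNormOn_antitone (hp : 1 ≤ p) (hpq : p ≤ q) : lpNormOn q S a ≤ lpNormOn p S a := by
  by_cases hq : q = ⊤
  · subst hq
    exact (lpNormOn_top_le_iff lpNormOn_nonneg).2 fun i hi => abs_le_lpNormOn hp hi
  have hpt : p ≠ ⊤ := (hpq.trans_lt (lt_top_iff_ne_top.2 hq)).ne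
  rw [lpNormOn_le_iff_of_ne_top (hp.trans hpq) hq lpNormOn_nonneg]
  set M := lpNormOn p S a with hM
  have h1 := one_le_toReal_of_one_le hp hpt
  have h2 : p.toReal ≤ q.toReal := ENNReal.toReal_mono hq hpq
  have hM0 : 0 ≤ M := lpNormOn_nonneg
  have key : ∀ t : ℝ, 0 ≤ t → t ^ q.toReal = t ^ p.toReal * t ^ (q.toReal - p.toReal) := by
    intro t ht
    rw [← Real.rpow_add_of_nonneg ht (by linarith) (by linarith)]
    congr 1
    ring
  calc ∑ i ∈ S, |a i| ^ q.toReal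
      ≤ ∑ i ∈ S, |a i| ^ p.toReal * M ^ (q.toReal - p.toReal) := by
        refine Finset.sum_le_sum fun i hi => ?_
        rw [key _ (abs_nonneg _)]
        have h3 : 0 ≤ q.toReal - p.toReal := by linarith
        gcongr
        exact abs_le_lpNormOn hp hi
    _ = M ^ q.toReal := by rw [← Finset.sum_mul, ← lpNormOn_rpow hp hpt, key M hM0]

/-- Disjointness turns the iterated sum of powers into one sum over the union. The basic estimate
uses this once for disjoint sets of blocks and once for disjoint sets of functionals. -/
theorem lpNormOn_blocks_le (hp : 1 ≤ p) {K : Finset κ} {I : κ → Finset ι}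
    (hI : ∀ j ∈ K, I j ⊆ S) (hd : (K : Set κ).PairwiseDisjoint I) :
    lpNormOn p K (fun j => lpNormOn p (I j) a) ≤ lpNormOn p S a := by
  by_cases h : p = ⊤
  · subst h
    refine (lpNormOn_top_le_iff lpNormOn_nonneg).2 fun j hj => ?_
    rw [abs_of_nonneg lpNormOn_nonneg]
    exact lpNormOn_mono hp (hI j hj) fun _ _ => le_rfl
  · classical
    rw [lpNormOn_le_iff_of_ne_top hp h lpNormOn_nonneg, lpNormOn_rpow hp h]
    simp_rw [abs_of_nonneg lpNormOn_nonneg, lpNormOn_rpow hp h]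
    rw [← Finset.sum_biUnion hd]
    exact Finset.sum_le_sum_of_subset_of_nonneg (Finset.biUnion_subset.2 hI)
      fun i _ _ => by positivity

theorem sum_abs_mul_le_of_top_one :
    ∑ i ∈ S, |a i| * |b i| ≤ lpNormOn ⊤ S a * lpNormOn 1 S b := by
  have h1 : lpNormOn 1 S b = ∑ i ∈ S, |b i| := by simp [lpNormOn]
  rw [h1, Finset.mul_sum]
  gcongr with i hi
  exact abs_le_lpNormOn le_top hi

theorem sum_abs_mul_le (h : p.HolderConjugate q) :
    ∑ i ∈ S, |a i| * |b i| ≤ lpNormOn p S a * lpNormOn q S b := by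
  by_cases hp : p = ⊤
  · subst hp
    obtain rfl : q = 1 := by
      have := h.symm
      rw [ENNReal.HolderConjugate.conj_eq (p := ⊤) (q := q)]
      simp
    exact sum_abs_mul_le_of_top_one
  by_cases hq : q = ⊤
  · subst hq
    obtain rfl : p = 1 := by
      have := h.symm
      rw [ENNReal.HolderConjugate.conj_eq (p := ⊤) (q := p)]
      simp
    simp_rw [mul_comm |a _|]
    rw [mul_comm (lpNormOn _ _ _)]
    exact sum_abs_mul_le_of_top_one
  have := Real.inner_le_Lp_mul_Lq S (fun i => |a i|) (fun i => |b i|)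
    (ENNReal.HolderConjugate.toReal_of_ne_top hp hq)
  simpa [lpNormOn, hp, hq] using this

theorem inLpUnitBall_iff {r : ℝ≥0∞} (hr : 1 ≤ r) {d : ℕ} {c : Fin d → ℝ} :
    InLpUnitBall r c ↔ lpNormOn r Finset.univ c ≤ 1 := by
  unfold InLpUnitBall
  split_ifs with h
  · subst h
    simp [lpNormOn_top_le_iff]
  · rw [lpNormOn_le_iff_of_ne_top hr h zero_le_one, Real.one_rpow]

/-- The case `p = ⊤` is covered because `⊤.toReal = 0` and `1 / 0 = 0`. Throughout, `1 / p.toReal`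
thus stands for `1/p` with `1/∞ = 0`. -/
theorem lpNormOn_one (hS : S.Nonempty) :
    lpNormOn p S (fun _ => 1) = (S.card : ℝ) ^ (1 / p.toReal) := by
  unfold lpNormOn
  split_ifs with h
  · subst h
    rw [Finset.sup_const hS]
    simp
  · simp

theorem lpNormOn_le_card_rpow (hp : 1 ≤ p) {M : ℝ} (hM : 0 ≤ M) (h : ∀ i ∈ S, |a i| ≤ M) :
    lpNormOn p S a ≤ M * (S.card : ℝ) ^ (1 / p.toReal) := by
  rcases S.eq_empty_or_nonempty with rfl | hS
  · have : lpNormOn p (∅ : Finset ι) a ≤ 0 := by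
      by_cases hT : p = ⊤
      · subst hT
        simp [lpNormOn]
      · rw [lpNormOn_le_iff_of_ne_top hp hT le_rfl]
        simp
        positivity
    exact this.trans (by positivity)
  · rw [← lpNormOn_one hS, ← abs_of_nonneg hM, ← lpNormOn_const_mul hp]
    exact lpNormOn_mono hp subset_rfl fun i hi => by
      simpa [abs_of_nonneg hM] using h i hi

theorem exists_dual_lpNormOn (h : p.HolderConjugate q) (S : Finset ι) (a : ι → ℝ) :
    ∃ c : ι → ℝ, lpNormOn q S c ≤ 1 ∧ ∑ i ∈ S, c i * a i = lpNormOn p S a := by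
  have hq1 : 1 ≤ q := ENNReal.HolderConjugate.one_le q p
  have hp1 : 1 ≤ p := ENNReal.HolderConjugate.one_le p q
  -- Signs can be absorbed into `c` without increasing its norm.
  suffices H : ∃ c : ι → ℝ, lpNormOn q S c ≤ 1 ∧ ∑ i ∈ S, c i * |a i| = lpNormOn p S a by
    obtain ⟨c, hc, hca⟩ := H
    refine ⟨fun i => c i * SignType.sign (a i), ?_, ?_⟩
    · refine (lpNormOn_mono hq1 subset_rfl fun i _ => ?_).trans hc
      rw [abs_mul]
      refine mul_le_of_le_one_right (abs_nonneg _) ?_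
      rcases lt_trichotomy (a i) 0 with h | h | h <;> simp [h]
    · rw [← hca]
      refine Finset.sum_congr rfl fun i _ => ?_
      rw [mul_assoc, sign_mul_self]
  by_cases hp : p = ⊤
  · subst hp
    obtain rfl : q = 1 := by
      have := h.symm
      rw [ENNReal.HolderConjugate.conj_eq (p := ⊤) (q := q)]
      simp
    rcases S.eq_empty_or_nonempty with rfl | hS
    · exact ⟨0, by simp [lpNormOn], by simp [lpNormOn]⟩
    classical
    obtain ⟨i, hi, hmax⟩ := Finset.exists_max_image S (fun i => |a i|) hS
    refine ⟨Pi.single i 1, ?_, ?_⟩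
    · simp [lpNormOn, Pi.single_apply, apply_ite abs, hi]
    · refine le_antisymm ?_ ?_
      · simpa [Pi.single_apply, hi] using abs_le_lpNormOn hp1 hi
      · refine (lpNormOn_top_le_iff ?_).2 ?_
        · simp [Pi.single_apply, hi]
        · simpa [Pi.single_apply, hi] using hmax
  by_cases hq : q = ⊤
  · subst hq
    obtain rfl : p = 1 := by
      have := h.symm
      rw [ENNReal.HolderConjugate.conj_eq (p := ⊤) (q := p)]
      simp
    exact ⟨fun _ => 1, by simp [lpNormOn_top_le_iff], by simp [lpNormOn]⟩
  have hR : p.toReal.HolderConjugate q.toReal :=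
    ENNReal.HolderConjugate.toReal_of_ne_top hp hq
  -- For finite exponents the supremum in Hölder duality is attained.
  obtain ⟨⟨g, hg, hg'⟩, -⟩ := NNReal.isGreatest_Lp S (fun i => ‖a i‖₊) hR
  refine ⟨fun i => g i, ?_, ?_⟩
  · rw [lpNormOn_le_iff_of_ne_top hq1 hq zero_le_one, Real.one_rpow]
    have : ((∑ i ∈ S, g i ^ q.toReal : ℝ≥0) : ℝ) ≤ 1 := by exact_mod_cast hg
    simpa using this
  · have := congrArg (fun t : ℝ≥0 => (t : ℝ)) hg'
    simp only [lpNormOn, if_neg hp]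
    push_cast at this
    simp only [Real.norm_eq_abs] at this
    rw [← this]
    exact Finset.sum_congr rfl fun i _ => mul_comm _ _

theorem norm_linearCombination_lpUnitVector (hp : 1 ≤ p) (a : ℕ →₀ ℝ) {S : Finset ℕ}
    (hS : a.support ⊆ S) :
    ‖Finsupp.linearCombination ℝ (lpUnitVector p) a‖ = lpNormOn p S a := by
  have : Fact (1 ≤ p) := ⟨hp⟩
  have hcoe : ∀ i, (Finsupp.linearCombination ℝ (lpUnitVector p) a : lp (fun _ : ℕ => ℝ) p) i
      = a i := by
    intro i
    rw [Finsupp.linearCombination_apply, Finsupp.sum]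
    simp only [lpUnitVector]
    rw [lp.coeFn_sum]
    simp [Finset.sum_apply, Pi.single_apply, eq_comm]
  by_cases h : p = ⊤
  · subst h
    refine le_antisymm ?_ ?_
    · refine lp.norm_le_of_forall_le lpNormOn_nonneg fun i => ?_
      rw [hcoe, Real.norm_eq_abs]
      by_cases hi : i ∈ a.support
      · exact abs_le_lpNormOn hp (hS hi)
      · rw [Finsupp.notMem_support_iff.1 hi, abs_zero]
        exact lpNormOn_nonneg
    · refine (lpNormOn_top_le_iff (norm_nonneg _)).2 fun i _ => ?_
      rw [← hcoe, ← Real.norm_eq_abs]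
      exact lp.norm_apply_le_norm (by simp) _ i
  · have hpos : 0 < p.toReal := zero_lt_one.trans_le (one_le_toReal_of_one_le hp h)
    rw [lp.norm_eq_tsum_rpow hpos, lpNormOn, if_neg h, tsum_eq_sum (s := S)]
    · simp_rw [hcoe, Real.norm_eq_abs]
    · intro i hi
      rw [hcoe, Finsupp.notMem_support_iff.1 fun h => hi (hS h)]
      simp [hpos.ne']

end lpNormOn

theorem lpNormOn_map {ι κ : Type*} {p : ℝ≥0∞} (e : κ ↪ ι) (S : Finset κ) (a : ι → ℝ) :
    lpNormOn p (S.map e) a = lpNormOn p S (fun j => a (e j)) := by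
  unfold lpNormOn
  rw [Finset.sum_map, Finset.sup_map]
  rfl

/-! ### Successive families and closure properties of the norming set -/

/-- The members of the family `f` indexed by `T` are nonzero with successive supports. -/
def SuccessiveOn {ι : Type*} [LinearOrder ι] (T : Finset ι) (f : ι → ℕ+ →₀ ℝ) : Prop :=
  (∀ q ∈ T, f q ≠ 0) ∧
    ∀ q ∈ T, ∀ r ∈ T, q < r → ∀ i ∈ (f q).support, ∀ j ∈ (f r).support, i < j

theorem Successive.successiveOn {d : ℕ} {f : Fin d → ℕ+ →₀ ℝ} (h : Successive f)
    (T : Finset (Fin d)) : SuccessiveOn T f :=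
  ⟨fun q _ => h.1 q, fun q _ r _ => h.2 q r⟩

theorem VeryFastGrowing.of_lt {d : ℕ} {f : Fin d → ℕ+ →₀ ℝ} {s : Fin d → ℕ}
    (h : VeryFastGrowing f s) (hf : Successive f) {q r : Fin d} (hqr : q < r) {i : ℕ+}
    (hi : i ∈ (f q).support) : (∀ j ∈ (f r).support, i ^ 2 < j) ∧ (i : ℕ) < s r := by
  -- The definition compares neighbours only. The predecessor `r'` of `r` has a support point at or
  -- beyond `i`, to which the hypothesis applies.
  let r' : Fin d := ⟨r - 1, by omega⟩
  have hr' : (r' : ℕ) + 1 = r := by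
    have : (q : ℕ) < r := hqr
    simp only [r']
    omega
  obtain ⟨i', hi', hii⟩ : ∃ i' ∈ (f r').support, i ≤ i' := by
    rcases eq_or_ne q r' with h1 | h1
    · exact ⟨i, h1 ▸ hi, le_rfl⟩
    · obtain ⟨i', hi'⟩ := Finsupp.support_nonempty_iff.2 (hf.1 r')
      have : q < r' := by
        refine lt_of_le_of_ne ?_ h1
        rw [Fin.le_def]
        have : (q : ℕ) < r := hqr
        omega
      exact ⟨i', hi', (hf.2 q r' this i hi i' hi').le⟩
  obtain ⟨h1, h2⟩ := h r' r hr' i' hi'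
  refine ⟨fun j hj => lt_of_le_of_lt (by gcongr) (h1 j hj), lt_of_le_of_lt ?_ h2⟩
  exact_mod_cast hii

theorem Admissible.card_le {d : ℕ} {f : Fin d → ℕ+ →₀ ℝ} (h : Admissible f) (q : Fin d) {i : ℕ+}
    (hi : i ∈ (f q).support) : d ≤ (i : ℕ) := by
  let z : Fin d := ⟨0, q.pos⟩
  rcases eq_or_ne q z with h1 | h1
  · exact h.2 q (by rw [h1]) i hi
  · obtain ⟨j, hj⟩ := Finsupp.support_nonempty_iff.2 (h.1.1 z)
    have hzq : z < q := lt_of_le_of_ne (by rw [Fin.le_def]; exact Nat.zero_le _) (Ne.symm h1)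
    have := h.1.2 z q hzq j hj i hi
    exact (h.2 z rfl j hj).trans (by exact_mod_cast this.le)

namespace SpaceParams

variable (P : SpaceParams)

theorem one_le_p' {k : ℕ∞} (h1 : 1 ≤ k) (hk : k ≤ P.ξ) : 1 ≤ P.p k :=
  P.one_le_p.trans (P.p_strictMono.monotoneOn
    ⟨le_rfl, (by norm_num : (1 : ℕ∞) ≤ 2).trans P.two_le_ξ⟩ ⟨h1, hk⟩ h1)

theorem one_le_ξ : 1 ≤ P.ξ := (by norm_num : (1 : ℕ∞) ≤ 2).trans P.two_le_ξ

theorem holderConjugate {k : ℕ∞} (h1 : 1 ≤ k) (hk : k ≤ P.ξ) :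
    (P.p k).HolderConjugate (P.conj k) :=
  ENNReal.HolderConjugate.conjExponent (P.one_le_p' h1 hk)

theorem pairing_combination {ι : Type*} (θ : ℝ) (T : Finset ι) (c : ι → ℝ) (f : ι → ℕ+ →₀ ℝ)
    (x : ℕ+ →₀ ℝ) :
    pairing (θ • ∑ q ∈ T, c q • f q) x = θ * ∑ q ∈ T, c q * pairing (f q) x := by
  simp only [pairing_eq_sum]
  simp only [Finsupp.smul_apply, Finsupp.finsetSum_apply, smul_eq_mul, Finset.mul_sum,
    Finset.sum_mul]
  rw [Finset.sum_comm]
  refine Finset.sum_congr rfl fun q _ => Finset.sum_congr rfl fun j _ => by ring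

theorem pairing_sum {ι : Type*} (f : ℕ+ →₀ ℝ) (S : Finset ι) (x : ι → ℕ+ →₀ ℝ) :
    pairing f (∑ i ∈ S, x i) = ∑ i ∈ S, pairing f (x i) := by
  classical
  induction S using Finset.induction_on with
  | empty => simp [pairing]
  | insert i S hi ih => rw [Finset.sum_insert hi, Finset.sum_insert hi, pairing_add, ih]

theorem pairing_sum_smul {ι : Type*} (f : ℕ+ →₀ ℝ) (S : Finset ι) (a : ι → ℝ)
    (x : ι → ℕ+ →₀ ℝ) :
    pairing f (∑ i ∈ S, a i • x i) = ∑ i ∈ S, a i * pairing f (x i) := by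
  rw [pairing_sum]
  exact Finset.sum_congr rfl fun i _ => pairing_smul _ _ _

theorem pairing_eq_zero {f x : ℕ+ →₀ ℝ} (h : Disjoint f.support x.support) : pairing f x = 0 := by
  rw [pairing_eq_sum]
  refine Finset.sum_eq_zero fun j hj => ?_
  rw [Finsupp.notMem_support_iff.1 (Finset.disjoint_right.1 h hj), zero_mul]

theorem pairing_neg_left (f x : ℕ+ →₀ ℝ) : pairing (-f) x = -pairing f x := by
  simp [pairing_eq_sum]

theorem pairing_filter (f x : ℕ+ →₀ ℝ) (D : Finset ℕ+) :
    pairing (f.filter (· ∈ D)) x = pairing f (x.filter (· ∈ D)) := by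
  rw [pairing_eq_sum, pairing_eq_sum, Finsupp.support_filter, Finset.sum_filter]
  refine Finset.sum_congr rfl fun j _ => ?_
  by_cases h : j ∈ D <;> simp [h]

variable {P}

/-- Passing to a subfamily destroys the indexing by an initial segment; the increasing enumeration
of `T` restores it. The next two lemmas serve the same purpose for the other rules. -/
theorem Norming.orderZero_finset {ι : Type*} [LinearOrder ι] {T : Finset ι} (hT : T.Nonempty)
    {f : ι → ℕ+ →₀ ℝ} (hf : ∀ q ∈ T, f q ∈ P.normingSet) (hs : SuccessiveOn T f) {c : ι → ℝ}
    (hc : lpNormOn (P.conj P.ξ) T c ≤ 1) :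
    P.Norming none (P.θ • ∑ q ∈ T, c q • f q) := by
  let e := T.orderEmbOfFin rfl
  have he : ∀ q, e q ∈ T := T.orderEmbOfFin_mem rfl
  have hmap : Finset.univ.map e.toEmbedding = T := T.map_orderEmbOfFin_univ rfl
  choose l hl using fun q => hf (e q) (he q)
  have h := Norming.orderZero (P := P) (Finset.card_pos.2 hT) (fun q => f (e q)) l hl
    ⟨fun q => hs.1 _ (he q), fun q r hqr => hs.2 _ (he q) _ (he r) (e.strictMono hqr)⟩
    (fun q => c (e q))
    ((inLpUnitBall_iff (P.one_le_conj _)).2 (by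
      have := lpNormOn_map (p := P.conj P.ξ) e.toEmbedding Finset.univ c
      rw [hmap] at this
      exact this.symm.trans_le hc))
  have hsum : ∑ q, c (e q) • f (e q) = ∑ q ∈ T, c q • f q := by
    conv_rhs => rw [← hmap, Finset.sum_map]
    rfl
  rwa [hsum] at h

theorem Norming.orderZeroSized_finset {ι : Type*} [LinearOrder ι] {T : Finset ι}
    (hT : T.Nonempty) {n : ℕ} (hn : T.card ≤ n)
    {f : ι → ℕ+ →₀ ℝ} (hf : ∀ q ∈ T, f q ∈ P.normingSet) (hs : SuccessiveOn T f) :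
    P.Norming (some (0, n))
      (P.θ • ∑ q ∈ T, ((1 / (n : ℝ)) ^ (1 / (P.conj P.ξ).toReal)) • f q) := by
  let e := T.orderEmbOfFin rfl
  have he : ∀ q, e q ∈ T := T.orderEmbOfFin_mem rfl
  have hmap : Finset.univ.map e.toEmbedding = T := T.map_orderEmbOfFin_univ rfl
  choose l hl using fun q => hf (e q) (he q)
  have h := Norming.orderZeroSized (P := P) (Finset.card_pos.2 hT) hn (fun q => f (e q)) l hl
    ⟨fun q => hs.1 _ (he q), fun q r hqr => hs.2 _ (he q) _ (he r) (e.strictMono hqr)⟩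
  have hsum : ∑ q, ((1 / (n : ℝ)) ^ (1 / (P.conj P.ξ).toReal)) • f (e q)
      = ∑ q ∈ T, ((1 / (n : ℝ)) ^ (1 / (P.conj P.ξ).toReal)) • f q := by
    conv_rhs => rw [← hmap, Finset.sum_map]
    rfl
  rwa [hsum] at h

theorem Norming.orderPos_finset {ι : Type*} [LinearOrder ι] {T : Finset ι} (hT : T.Nonempty)
    {k : ℕ} (hk : 1 ≤ k) (hkξ : (k : ℕ∞) < P.ξ) {f : ι → ℕ+ →₀ ℝ} {o s : ι → ℕ}
    (hf : ∀ q ∈ T, P.Norming (some (o q, s q)) (f q)) (ho : ∀ q ∈ T, o q < k)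
    (hs : SuccessiveOn T f) (hadm : ∀ q ∈ T, ∀ i ∈ (f q).support, T.card ≤ (i : ℕ))
    (hvfg : ∀ q ∈ T, ∀ r ∈ T, q < r → ∀ i ∈ (f q).support,
      (∀ j ∈ (f r).support, i ^ 2 < j) ∧ (i : ℕ) < s r)
    {c : ι → ℝ} (hc : lpNormOn (P.conj k) T c ≤ 1) :
    ∃ q ∈ T, P.Norming (some (k, s q)) (P.θ • ∑ q ∈ T, c q • f q) := by
  let e := T.orderEmbOfFin rfl
  have he : ∀ q, e q ∈ T := T.orderEmbOfFin_mem rfl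
  have hmap : Finset.univ.map e.toEmbedding = T := T.map_orderEmbOfFin_univ rfl
  have hpos := Finset.card_pos.2 hT
  have : Nonempty (Fin T.card) := ⟨⟨0, hpos⟩⟩
  obtain ⟨q₀, hq₀⟩ := Finite.exists_min (fun q => s (e q))
  refine ⟨e q₀, he q₀, ?_⟩
  have h := Norming.orderPos (P := P) hpos k hk hkξ (fun q => f (e q)) (fun q => o (e q))
    (fun q => s (e q)) (fun q => hf _ (he q)) (fun q => ho _ (he q))
    ⟨⟨fun q => hs.1 _ (he q), fun q r hqr => hs.2 _ (he q) _ (he r) (e.strictMono hqr)⟩,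
      fun q _ => hadm _ (he q)⟩
    (fun q r hqr => hvfg _ (he q) _ (he r) (e.strictMono (by rw [Fin.lt_def]; omega)))
    (fun q => c (e q))
    ((inLpUnitBall_iff (P.one_le_conj _)).2 (by
      have := lpNormOn_map (p := P.conj k) e.toEmbedding Finset.univ c
      rw [hmap] at this
      exact this.symm.trans_le hc))
    (s (e q₀)) ⟨⟨q₀, rfl⟩, by rintro _ ⟨q, rfl⟩; exact hq₀ q⟩
  have hsum : ∑ q, c (e q) • f (e q) = ∑ q ∈ T, c q • f q := by
    conv_rhs => rw [← hmap, Finset.sum_map]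
    rfl
  rwa [hsum] at h

theorem Norming.neg {l : Option (ℕ × ℕ)} {f : ℕ+ →₀ ℝ} (h : P.Norming l f) :
    P.Norming l (-f) := by
  induction h with
  | unit j ε hε =>
    rw [← Finsupp.single_neg]
    exact .unit j (-ε) (by rcases hε with rfl | rfl <;> simp)
  | orderZero hd f l hf hs c hc ih =>
    have := Norming.orderZero hd (fun q => -f q) l ih
      ⟨fun q => neg_ne_zero.2 (hs.1 q), by simpa using hs.2⟩ c hc
    simpa using this
  | orderZeroSized hd hdn f l hf hs ih =>
    have := Norming.orderZeroSized hd hdn (fun q => -f q) l ih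
      ⟨fun q => neg_ne_zero.2 (hs.1 q), by simpa using hs.2⟩
    simpa using this
  | orderPos hd k hk hkξ f o s hf ho hadm hvfg c hc m hm ih =>
    have := Norming.orderPos hd k hk hkξ (fun q => -f q) o s ih ho
      ⟨⟨fun q => neg_ne_zero.2 (hadm.1.1 q), by simpa using hadm.1.2⟩, by simpa using hadm.2⟩
      (by simpa [VeryFastGrowing] using hvfg) c hc m hm
    simpa using this

theorem filter_combination {d : ℕ} (θ : ℝ) (c : Fin d → ℝ) (f : Fin d → ℕ+ →₀ ℝ)
    (D : Finset ℕ+) :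
    (θ • ∑ q, c q • f q).filter (· ∈ D) =
      θ • ∑ q with (f q).filter (· ∈ D) ≠ 0, c q • (f q).filter (· ∈ D) := by
  rw [Finset.sum_filter_of_ne (p := fun q => (f q).filter (· ∈ D) ≠ 0)
    (fun q _ h h0 => h (by rw [h0, smul_zero])), Finsupp.filter_smul]
  congr 1
  ext j
  by_cases h : j ∈ D <;> simp [h, Finsupp.finsetSum_apply]

theorem successiveOn_filter {d : ℕ} {f : Fin d → ℕ+ →₀ ℝ} (h : Successive f) (D : Finset ℕ+) :
    SuccessiveOn (Finset.univ.filter fun q => (f q).filter (· ∈ D) ≠ 0)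
      (fun q => (f q).filter (· ∈ D)) := by
  refine ⟨fun q hq => (Finset.mem_filter.1 hq).2, fun q _ r _ hqr i hi j hj => ?_⟩
  rw [Finsupp.support_filter, Finset.mem_filter] at hi hj
  exact h.2 q r hqr i hi.1 j hj.1

/-- The norming set is closed under restrictions of the support; orders are kept and sizes do not
decrease. -/
theorem Norming.restrict {l : Option (ℕ × ℕ)} {f : ℕ+ →₀ ℝ} (h : P.Norming l f)
    (D : Finset ℕ+) : f.filter (· ∈ D) ≠ 0 → ∃ l', P.Norming l' (f.filter (· ∈ D)) ∧
      ∀ o s, l = some (o, s) → ∃ s', s ≤ s' ∧ l' = some (o, s') := by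
  induction h with
  | unit j ε hε =>
    intro h0
    by_cases hj : j ∈ D
    · rw [Finsupp.filter_single_of_pos (· ∈ D) hj]
      exact ⟨none, .unit j ε hε, by simp⟩
    · exact absurd (Finsupp.filter_single_of_neg (· ∈ D) hj) h0
  | orderZero hd f l hf hs c hc ih =>
    rw [filter_combination]
    intro h0
    refine ⟨none, Norming.orderZero_finset ?_ ?_ (successiveOn_filter hs D) ?_, by simp⟩
    · by_contra hT
      rw [Finset.not_nonempty_iff_eq_empty] at hT
      simp [hT] at h0
    · intro q hq
      obtain ⟨l', h', -⟩ := ih q (Finset.mem_filter.1 hq).2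
      exact ⟨l', h'⟩
    · exact (lpNormOn_mono (P.one_le_conj _) (Finset.subset_univ _) fun _ _ => le_rfl).trans
        ((inLpUnitBall_iff (P.one_le_conj _)).1 hc)
  -- Fewer functionals may survive, but the rule only asks that their number be at most `n`, so
  -- coefficients and size stay as they are.
  | @orderZeroSized d n hd hdn f l hf hs ih =>
    rw [filter_combination]
    intro h0
    refine ⟨some (0, n), Norming.orderZeroSized_finset ?_ ?_ ?_ (successiveOn_filter hs D),
      fun o s h => ⟨n, ?_⟩⟩
    · by_contra hT
      rw [Finset.not_nonempty_iff_eq_empty] at hT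
      simp [hT] at h0
    · exact ((Finset.card_le_univ _).trans_eq (Fintype.card_fin d)).trans hdn
    · intro q hq
      obtain ⟨l', h', -⟩ := ih q (Finset.mem_filter.1 hq).2
      exact ⟨l', h'⟩
    · simp only [Option.some.injEq, Prod.mk.injEq] at h
      simp [h.1, h.2]
  | @orderPos d hd k hk hkξ f o s hf ho hadm hvfg c hc m hm ih =>
    rw [filter_combination]
    intro h0
    -- Members restricted to zero are dropped later; `s q` is a dummy size for them.
    have ih' : ∀ q, ∃ s', s q ≤ s' ∧ ((f q).filter (· ∈ D) ≠ 0 →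
        P.Norming (some (o q, s')) ((f q).filter (· ∈ D))) := by
      intro q
      by_cases hq : (f q).filter (· ∈ D) ≠ 0
      · obtain ⟨l', h1, h2⟩ := ih q hq
        obtain ⟨s', h3, rfl⟩ := h2 _ _ rfl
        exact ⟨s', h3, fun _ => h1⟩
      · exact ⟨s q, le_rfl, fun h => absurd h hq⟩
    choose s' hs' hN using ih'
    have hsub : ∀ q, ∀ i ∈ ((f q).filter (· ∈ D)).support, i ∈ (f q).support := fun q i hi => by
      rw [Finsupp.support_filter, Finset.mem_filter] at hi
      exact hi.1
    have hT : (Finset.univ.filter fun q => (f q).filter (· ∈ D) ≠ 0).Nonempty := by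
      by_contra hT
      rw [Finset.not_nonempty_iff_eq_empty] at hT
      simp [hT] at h0
    obtain ⟨q, -, hq⟩ := Norming.orderPos_finset (P := P)
      (T := Finset.univ.filter fun q => (f q).filter (· ∈ D) ≠ 0)
      (f := fun q => (f q).filter (· ∈ D)) (o := o) (s := s') (c := c) hT hk hkξ
      (fun q hq => hN q (Finset.mem_filter.1 hq).2) (fun q _ => ho q)
      (successiveOn_filter hadm.1 D)
      (fun q _ i hi => ((Finset.card_le_univ _).trans_eq (Fintype.card_fin d)).trans
        (hadm.card_le q (hsub q i hi)))
      (fun q _ r _ hqr i hi => by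
        obtain ⟨h1, h2⟩ := hvfg.of_lt hadm.1 hqr (hsub q i hi)
        exact ⟨fun j hj => h1 j (hsub r j hj), h2.trans_le (hs' r)⟩)
      ((lpNormOn_mono (P.one_le_conj _) (Finset.subset_univ _) fun _ _ => le_rfl).trans
        ((inLpUnitBall_iff (P.one_le_conj _)).1 hc))
    refine ⟨_, hq, fun o₁ s₁ h => ⟨s' q, ?_, ?_⟩⟩
    · simp only [Option.some.injEq, Prod.mk.injEq] at h
      rw [← h.2]
      exact (hm.2 ⟨q, rfl⟩).trans (hs' q)
    · simp only [Option.some.injEq, Prod.mk.injEq] at h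
      rw [h.1]

/-- Restricting a vector amounts to restricting the functionals, and the norming set is closed under
that. Coordinate restrictions are thus contractive, which later makes block sequences monotone. -/
theorem c00Norm_filter_le (x : ℕ+ →₀ ℝ) (D : Finset ℕ+) :
    P.c00Norm (x.filter (· ∈ D)) ≤ P.c00Norm x := by
  refine P.c00Norm_le fun f ⟨l, hf⟩ => ?_
  rw [← pairing_filter]
  by_cases h0 : f.filter (· ∈ D) = 0
  · rw [h0]
    simpa [pairing] using P.c00Norm_nonneg x
  · obtain ⟨l', h', -⟩ := hf.restrict D h0
    exact P.abs_pairing_le ⟨l', h'⟩ x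

end SpaceParams

/-! ### Conjugate exponents and upper estimates on block combinations -/

theorem ENNReal.HolderConjugate.one_div_toReal_add {p q : ℝ≥0∞} (h : p.HolderConjugate q) :
    1 / p.toReal + 1 / q.toReal = 1 := by
  have h1 := ENNReal.HolderConjugate.inv_add_inv_eq_one p q
  have hp : p⁻¹ ≠ ⊤ := fun h0 => by simp [h0] at h1
  have hq : q⁻¹ ≠ ⊤ := fun h0 => by simp [h0] at h1
  have := congrArg ENNReal.toReal h1
  rw [ENNReal.toReal_add hp hq, ENNReal.toReal_inv, ENNReal.toReal_inv] at this
  simpa using this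

theorem ENNReal.conjExponent_antitone {p q : ℝ≥0∞} (h : p ≤ q) :
    ENNReal.conjExponent q ≤ ENNReal.conjExponent p := by
  unfold ENNReal.conjExponent
  gcongr

namespace SpaceParams

variable {P : SpaceParams}

/-- The supports of `f` and `x` intersect. -/
def Meets (f x : ℕ+ →₀ ℝ) : Prop := ∃ u, u ∈ f.support ∧ u ∈ x.support

theorem pairing_eq_zero_of_not_meets {f x : ℕ+ →₀ ℝ} (h : ¬ Meets f x) : pairing f x = 0 :=
  pairing_eq_zero (Finset.disjoint_left.2 fun u h1 h2 => h ⟨u, h1, h2⟩)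

/-- The supports of the vectors of the sequence are successive. -/
def BlockSupports (X : ℕ → ℕ+ →₀ ℝ) : Prop :=
  ∀ i j, i < j → ∀ u ∈ (X i).support, ∀ v ∈ (X j).support, u < v

/-- `f q` is the first member of the family `f` meeting `x`. -/
def FirstMeet {d : ℕ} (f : Fin d → ℕ+ →₀ ℝ) (x : ℕ+ →₀ ℝ) (q : Fin d) : Prop :=
  Meets (f q) x ∧ ∀ r < q, ¬ Meets (f r) x

/-- `f q` is a member of the family `f`, other than the first one, meeting `x`. -/
def LaterMeet {d : ℕ} (f : Fin d → ℕ+ →₀ ℝ) (x : ℕ+ →₀ ℝ) (q : Fin d) : Prop :=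
  Meets (f q) x ∧ ∃ r < q, Meets (f r) x

theorem FirstMeet.eq {d : ℕ} {f : Fin d → ℕ+ →₀ ℝ} {x : ℕ+ →₀ ℝ} {q r : Fin d}
    (hq : FirstMeet f x q) (hr : FirstMeet f x r) : q = r := by
  rcases lt_trichotomy q r with h | h | h
  · exact absurd hq.1 (hr.2 q h)
  · exact h
  · exact absurd hr.1 (hq.2 r h)

theorem not_meets_of_lt {d : ℕ} {f : Fin d → ℕ+ →₀ ℝ} (hf : Successive f) {X : ℕ → ℕ+ →₀ ℝ}
    (hX : BlockSupports X) {i j : ℕ} (hij : i < j) {q r : Fin d} (hqr : q < r)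
    (hi : Meets (f r) (X i)) : ¬ Meets (f q) (X j) := by
  rintro ⟨v, hv, hv'⟩
  obtain ⟨u, hu, hu'⟩ := hi
  exact lt_asymm (hf.2 q r hqr v hv u hu) (hX i j hij u hu' v hv')

/-- If `f q` already meets an earlier block, the members before it lie too far left to meet the
later one. So `f q` can be a non-first functional for one block only. -/
theorem LaterMeet.eq {d : ℕ} {f : Fin d → ℕ+ →₀ ℝ} (hf : Successive f) {X : ℕ → ℕ+ →₀ ℝ}
    (hX : BlockSupports X) {i j : ℕ} {q : Fin d}
    (hi : LaterMeet f (X i) q) (hj : LaterMeet f (X j) q) : i = j := by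
  rcases lt_trichotomy i j with h | h | h
  · obtain ⟨r, hr, hr'⟩ := hj.2
    exact absurd hr' (not_meets_of_lt hf hX h hr hi.1)
  · exact h
  · obtain ⟨r, hr, hr'⟩ := hi.2
    exact absurd hr' (not_meets_of_lt hf hX h hr hj.1)

open Classical in
theorem sum_pairing_split {d : ℕ} (c : Fin d → ℝ) (f : Fin d → ℕ+ →₀ ℝ) (X : ℕ → ℕ+ →₀ ℝ)
    (J : Finset ℕ) (a : ℕ → ℝ) :
    ∑ q, c q * pairing (f q) (∑ i ∈ J, a i • X i) =
      ∑ q, c q * pairing (f q) (∑ i ∈ J with FirstMeet f (X i) q, a i • X i) +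
      ∑ i ∈ J, a i * ∑ q with LaterMeet f (X i) q, c q * pairing (f q) (X i) := by
  simp only [pairing_sum_smul, Finset.mul_sum]
  simp only [Finset.sum_filter]
  rw [Finset.sum_comm (s := J), ← Finset.sum_add_distrib]
  refine Finset.sum_congr rfl fun q _ => ?_
  rw [← Finset.sum_add_distrib]
  refine Finset.sum_congr rfl fun i _ => ?_
  by_cases hm : Meets (f q) (X i)
  · by_cases hr : ∃ r < q, Meets (f r) (X i)
    · have h1 : LaterMeet f (X i) q := ⟨hm, hr⟩
      have h2 : ¬ FirstMeet f (X i) q := fun h => by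
        obtain ⟨r, hr, hr'⟩ := hr
        exact h.2 r hr hr'
      simp only [h1, h2, if_true, if_false]
      ring
    · have h1 : ¬ LaterMeet f (X i) q := fun h => hr h.2
      have h2 : FirstMeet f (X i) q := ⟨hm, fun r h h' => hr ⟨r, h, h'⟩⟩
      simp only [h1, h2, if_true, if_false]
      ring
  · simp [pairing_eq_zero_of_not_meets hm]

/-- Homogeneity: dividing by the norm of the coefficients gives a member of the norming set;
coefficients of norm zero are treated apart. -/
theorem abs_sum_pairing_le {d : ℕ} {r : ℝ≥0∞} (hr : 1 ≤ r) {f : Fin d → ℕ+ →₀ ℝ}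
    (hW : ∀ (T : Finset (Fin d)) (c : Fin d → ℝ), T.Nonempty → lpNormOn r T c ≤ 1 →
      P.θ • ∑ q ∈ T, c q • f q ∈ P.normingSet) (T : Finset (Fin d)) (c : Fin d → ℝ)
    (x : ℕ+ →₀ ℝ) :
    |P.θ * ∑ q ∈ T, c q * pairing (f q) x| ≤ lpNormOn r T c * P.c00Norm x := by
  rcases T.eq_empty_or_nonempty with rfl | hT
  · simpa using mul_nonneg lpNormOn_nonneg (P.c00Norm_nonneg x)
  rcases lpNormOn_nonneg.eq_or_lt' (a := lpNormOn r T c) with h0 | h0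
  · have : ∑ q ∈ T, c q * pairing (f q) x = 0 := by
      refine Finset.sum_eq_zero fun q hq => ?_
      have := abs_le_lpNormOn (a := c) hr hq
      rw [h0] at this
      rw [abs_nonpos_iff.1 this, zero_mul]
    rw [this, h0]
    simp
  · have h := P.abs_pairing_le (hW T (fun q => (lpNormOn r T c)⁻¹ * c q) hT (by
      rw [lpNormOn_const_mul hr, abs_of_pos (inv_pos.2 h0), inv_mul_cancel₀ h0.ne'])) x
    rw [pairing_combination] at h
    have h2 : P.θ * ∑ q ∈ T, c q * pairing (f q) x = lpNormOn r T c *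
        (P.θ * ∑ q ∈ T, (lpNormOn r T c)⁻¹ * c q * pairing (f q) x) := by
      simp only [mul_assoc, ← Finset.mul_sum]
      field_simp
    rw [h2, abs_mul, abs_of_pos h0]
    gcongr

/-- The basic estimate: split the action of a combination of functionals on a block combination
according to the first functional met by each block. -/
theorem abs_pairing_combination_le {d : ℕ} {f : Fin d → ℕ+ →₀ ℝ} (hf : Successive f)
    {X : ℕ → ℕ+ →₀ ℝ} (hX : BlockSupports X) {J : Finset ℕ} (hX1 : ∀ i ∈ J, P.c00Norm (X i) ≤ 1)
    {r r' p p' : ℝ≥0∞} (hr : r.HolderConjugate r') (hp : p.HolderConjugate p')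
    {c : Fin d → ℝ} (hc : lpNormOn r' Finset.univ c ≤ 1)
    (hW : ∀ (T : Finset (Fin d)) (c : Fin d → ℝ), T.Nonempty → lpNormOn r' T c ≤ 1 →
      P.θ • ∑ q ∈ T, c q • f q ∈ P.normingSet)
    {a : ℕ → ℝ} {C : ℝ} (hC : 0 ≤ C)
    (ih : ∀ q, ∀ I ⊆ J, |pairing (f q) (∑ i ∈ I, a i • X i)| ≤ C * lpNormOn p I a) :
    |pairing (P.θ • ∑ q, c q • f q) (∑ i ∈ J, a i • X i)| ≤
      1 / 4 * C * lpNormOn p' Finset.univ c * lpNormOn p J a + lpNormOn r J a := by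
  classical
  have hp1 : 1 ≤ p := ENNReal.HolderConjugate.one_le p p'
  have hr1 : 1 ≤ r := ENNReal.HolderConjugate.one_le r r'
  have hr'1 : 1 ≤ r' := ENNReal.HolderConjugate.one_le r' r
  have hθ := P.θ_pos
  have hθ' := P.θ_le
  rw [pairing_combination, sum_pairing_split, mul_add]
  refine (abs_add_le _ _).trans (add_le_add ?_ ?_)
  -- First meetings: each block is charged to at most one functional, so the inductive bounds live
  -- on disjoint sets of blocks and Hölder with `p, p'` combines them.
  · have h1 : |∑ q, c q * pairing (f q) (∑ i ∈ J with FirstMeet f (X i) q, a i • X i)| ≤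
        C * lpNormOn p' Finset.univ c * lpNormOn p J a := by
      calc |∑ q, c q * pairing (f q) (∑ i ∈ J with FirstMeet f (X i) q, a i • X i)|
          ≤ ∑ q, |c q| * |C * lpNormOn p {i ∈ J | FirstMeet f (X i) q} a| := by
            refine (Finset.abs_sum_le_sum_abs _ _).trans (Finset.sum_le_sum fun q _ => ?_)
            rw [abs_mul, abs_of_nonneg (mul_nonneg hC lpNormOn_nonneg)]
            gcongr
            exact ih q _ (Finset.filter_subset _ _)
        _ ≤ lpNormOn p' Finset.univ c *
            lpNormOn p Finset.univ (fun q => C * lpNormOn p {i ∈ J | FirstMeet f (X i) q} a) :=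
            sum_abs_mul_le hp.symm
        _ ≤ lpNormOn p' Finset.univ c * (C * lpNormOn p J a) := by
            rw [lpNormOn_const_mul hp1, abs_of_nonneg hC]
            gcongr
            · exact lpNormOn_nonneg
            · refine lpNormOn_blocks_le hp1 (fun q _ => Finset.filter_subset _ _) ?_
              intro q _ q' _ hne
              rw [Function.onFun, Finset.disjoint_left]
              intro i hi hi'
              exact hne ((Finset.mem_filter.1 hi).2.eq (Finset.mem_filter.1 hi').2)
        _ = _ := by ring
    rw [abs_mul, abs_of_pos hθ]
    have h2 : 0 ≤ C * lpNormOn p' Finset.univ c * lpNormOn p J a :=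
      mul_nonneg (mul_nonneg hC lpNormOn_nonneg) lpNormOn_nonneg
    calc P.θ * _ ≤ 1 / 4 * (C * lpNormOn p' Finset.univ c * lpNormOn p J a) := by gcongr
      _ = _ := by ring
  -- Later meetings: the functionals charged to block `i` form, up to the norm of their
  -- coefficients, a member of the norming set. These sets of functionals are disjoint for different
  -- `i`, so Hölder with `r, r'` suffices.
  · calc |P.θ * ∑ i ∈ J, a i * ∑ q with LaterMeet f (X i) q, c q * pairing (f q) (X i)|
        = |∑ i ∈ J, a i * (P.θ * ∑ q with LaterMeet f (X i) q, c q * pairing (f q) (X i))| := by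
          rw [Finset.mul_sum]
          congr 1
          exact Finset.sum_congr rfl fun i _ => by ring
      _ ≤ ∑ i ∈ J, |a i| * |lpNormOn r' {q | LaterMeet f (X i) q} c| := by
          refine (Finset.abs_sum_le_sum_abs _ _).trans (Finset.sum_le_sum fun i hi => ?_)
          rw [abs_mul, abs_of_nonneg (a := lpNormOn _ _ _) lpNormOn_nonneg]
          gcongr
          exact (abs_sum_pairing_le hr'1 hW _ c _).trans
            (mul_le_of_le_one_right lpNormOn_nonneg (hX1 i hi))
      _ ≤ lpNormOn r J a * lpNormOn r' J (fun i => lpNormOn r' {q | LaterMeet f (X i) q} c) :=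
          sum_abs_mul_le hr
      _ ≤ lpNormOn r J a * 1 := by
          gcongr
          · exact lpNormOn_nonneg
          · refine (lpNormOn_blocks_le (S := Finset.univ) hr'1 (fun q _ => Finset.subset_univ _)
              ?_).trans hc
            intro i _ j _ hne
            rw [Function.onFun, Finset.disjoint_left]
            intro q hq hq'
            exact hne ((Finset.mem_filter.1 hq).2.eq hf hX (Finset.mem_filter.1 hq').2)
      _ = _ := mul_one _

/-- The blocks `X i`, `i ∈ S`, are so far out that functionals of order below `k` and large size are
negligible on them. -/
def Sparse (P : SpaceParams) (k : ℕ) (S : Finset ℕ) (X : ℕ → ℕ+ →₀ ℝ) : Prop :=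
  ∀ f o s, P.Norming (some (o, s)) f → o < k → ∀ i ∈ S, ∀ j ∈ S, i < j →
    (∀ u ∈ (X i).support, (u : ℕ) < s → |pairing f (X j)| ≤ 1 / S.card) ∧
    (∀ u ∈ (X i).support, ∀ v ∈ (X j).support, (v : ℕ) < s →
      |pairing f (X j)| ≤ 1 / (S.card * (u : ℕ)))

/-- Let `X i₁` be the first block met and `f q₀` the first functional meeting it. The block `X i₁`
costs at most `A`. On later blocks every `f q` with `q ≠ q₀` is zero or has size exceeding a support
point of `X i₁`, and sparseness makes their total contribution at most `A / 2`. Only `f q₀` remains,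
with the factor `θ ≤ 1/4`. -/
theorem exists_abs_pairing_orderPos_le {d k K : ℕ} (hd : 0 < d) (hkK : k ≤ K)
    {f : Fin d → ℕ+ →₀ ℝ} {o s : Fin d → ℕ} (hf : ∀ q, P.Norming (some (o q, s q)) (f q))
    (ho : ∀ q, o q < k) (hadm : Admissible f) (hvfg : VeryFastGrowing f s)
    {c : Fin d → ℝ} (hc : ∀ q, |c q| ≤ 1) (hW : P.θ • ∑ q, c q • f q ∈ P.normingSet)
    {X : ℕ → ℕ+ →₀ ℝ} (hX : BlockSupports X) {S J : Finset ℕ} (hJ : J ⊆ S)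
    (hX1 : ∀ i ∈ S, P.c00Norm (X i) ≤ 1) (hS : P.Sparse K S X) {a : ℕ → ℝ} {A : ℝ} (hA : 0 ≤ A)
    (ha : ∀ i ∈ J, |a i| ≤ A) :
    ∃ q, ∃ I ⊆ J, |pairing (P.θ • ∑ q, c q • f q) (∑ i ∈ J, a i • X i)| ≤
      3 / 2 * A + 1 / 4 * |pairing (f q) (∑ i ∈ I, a i • X i)| := by
  classical
  have hθ := P.θ_pos
  have hθ' := P.θ_le
  set g := P.θ • ∑ q, c q • f q with hg
  have hgp : ∀ x, pairing g x = P.θ * ∑ q, c q * pairing (f q) x := fun x => by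
    rw [hg, pairing_combination]
  by_cases hne : (J.filter fun i => ∃ q, Meets (f q) (X i)).Nonempty
  swap
  -- No block is met and the pairing vanishes, so any witness will do.
  · refine ⟨⟨0, hd⟩, ∅, by simp, ?_⟩
    rw [Finset.not_nonempty_iff_eq_empty, Finset.filter_eq_empty_iff] at hne
    rw [pairing_sum_smul, Finset.sum_eq_zero]
    · rw [abs_zero]
      positivity
    · intro i hi
      rw [hgp, Finset.sum_eq_zero, mul_zero, mul_zero]
      intro q _
      rw [pairing_eq_zero_of_not_meets fun h => hne hi ⟨q, h⟩, mul_zero]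
  set i₁ := (J.filter fun i => ∃ q, Meets (f q) (X i)).min' hne with hi₁
  have hi₁mem := Finset.min'_mem _ hne
  rw [← hi₁, Finset.mem_filter] at hi₁mem
  obtain ⟨hi₁J, hex⟩ := hi₁mem
  have hne' : (Finset.univ.filter fun q => Meets (f q) (X i₁)).Nonempty := by
    obtain ⟨q, hq⟩ := hex
    exact ⟨q, by simpa using hq⟩
  set q₀ := (Finset.univ.filter fun q => Meets (f q) (X i₁)).min' hne' with hq₀
  have hq₀mem := Finset.min'_mem _ hne'
  rw [← hq₀, Finset.mem_filter] at hq₀mem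
  obtain ⟨w, hw, hw'⟩ := hq₀mem.2
  have hcardS : (0 : ℝ) < S.card := by
    exact_mod_cast Finset.card_pos.2 ⟨i₁, hJ hi₁J⟩
  have hwpos : (0 : ℝ) < (w : ℕ) := by exact_mod_cast w.pos
  have hdw : (d : ℝ) ≤ (w : ℕ) := by exact_mod_cast hadm.card_le q₀ hw
  set I := J.filter (fun i => i₁ < i) with hI
  have hbound : ∀ i ∈ I, ∑ q with q ≠ q₀, |c q| * |pairing (f q) (X i)| ≤ 2 / S.card := by
    intro i hi
    rw [hI, Finset.mem_filter] at hi
    -- The first functional meeting `X i` may cost `1 / |S|`. Any other has size beyond a support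
    -- point of `X i`, since an earlier functional also meets `X i`, and costs only `1 / (|S| w)`.
    have hterm : ∀ q ∈ (Finset.univ.filter fun q => q ≠ q₀), |c q| * |pairing (f q) (X i)| ≤
        (if FirstMeet f (X i) q then 1 / (S.card : ℝ) else 0) + 1 / (S.card * (w : ℕ)) := by
      intro q hq
      have hq : q ≠ q₀ := by simpa using hq
      have h0 : |c q| * |pairing (f q) (X i)| ≤ |pairing (f q) (X i)| :=
        mul_le_of_le_one_left (abs_nonneg _) (hc q)
      refine h0.trans ?_
      by_cases hm : Meets (f q) (X i)
      · have hlt : q₀ < q := by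
          by_contra hlt
          exact not_meets_of_lt hadm.1 hX hi.2 (lt_of_le_of_ne (not_lt.1 hlt) hq) hq₀mem.2 hm
        obtain ⟨hS1, hS2⟩ := hS (f q) (o q) (s q) (hf q) ((ho q).trans_le hkK) i₁ (hJ hi₁J) i
          (hJ hi.1) hi.2
        by_cases hF : FirstMeet f (X i) q
        · rw [if_pos hF]
          exact (hS1 w hw' (hvfg.of_lt hadm.1 hlt hw).2).trans
            (le_add_of_nonneg_right (by positivity))
        · rw [if_neg hF, zero_add]
          have : ∃ r < q, Meets (f r) (X i) := by
            by_contra hcon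
            push Not at hcon
            exact hF ⟨hm, hcon⟩
          obtain ⟨r, hr, v, hv, hv'⟩ := this
          exact hS2 w hw' v hv' (hvfg.of_lt hadm.1 hr hv).2
      · rw [pairing_eq_zero_of_not_meets hm, abs_zero]
        split_ifs <;> positivity
    refine (Finset.sum_le_sum hterm).trans ?_
    rw [Finset.sum_add_distrib]
    have e1 : ∑ q with q ≠ q₀, (if FirstMeet f (X i) q then 1 / (S.card : ℝ) else 0) ≤
        1 / S.card := by
      rw [← Finset.sum_filter, Finset.sum_const, nsmul_eq_mul]
      refine mul_le_of_le_one_left (by positivity) ?_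
      have : (Finset.filter (fun q => FirstMeet f (X i) q)
          (Finset.univ.filter fun q => q ≠ q₀)).card ≤ 1 := by
        rw [Finset.card_le_one]
        intro q hq r hr
        exact (Finset.mem_filter.1 hq).2.eq (Finset.mem_filter.1 hr).2
      exact_mod_cast this
    -- Admissibility enters here: there are at most `d ≤ w` such functionals, because `w` lies in
    -- the support of one of them.
    have e2 : ∑ q : Fin d with q ≠ q₀, 1 / ((S.card : ℝ) * (w : ℕ)) ≤ 1 / S.card := by
      rw [Finset.sum_const, nsmul_eq_mul]
      have : (((Finset.univ.filter fun q : Fin d => q ≠ q₀).card : ℕ) : ℝ) ≤ (w : ℕ) := by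
        refine le_trans ?_ hdw
        exact_mod_cast (Finset.card_le_univ _).trans_eq (Fintype.card_fin d)
      calc _ ≤ ((w : ℕ) : ℝ) * (1 / ((S.card : ℝ) * (w : ℕ))) := by gcongr
        _ = 1 / S.card := by field_simp
    calc _ ≤ 1 / (S.card : ℝ) + 1 / S.card := add_le_add e1 e2
      _ = 2 / S.card := by ring
  refine ⟨q₀, I, Finset.filter_subset _ _, ?_⟩
  have hsplit : pairing g (∑ i ∈ J, a i • X i) = a i₁ * pairing g (X i₁) +
      (P.θ * (c q₀ * pairing (f q₀) (∑ i ∈ I, a i • X i)) +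
        P.θ * ∑ i ∈ I, a i * ∑ q with q ≠ q₀, c q * pairing (f q) (X i)) := by
    have hsub : insert i₁ I ⊆ J := by
      intro i hi
      rcases Finset.mem_insert.1 hi with rfl | hi
      · exact hi₁J
      · exact (Finset.mem_filter.1 hi).1
    rw [pairing_sum_smul, ← Finset.sum_subset hsub, Finset.sum_insert (by simp [hI])]
    · congr 1
      rw [← mul_add, pairing_sum_smul, Finset.mul_sum, ← Finset.sum_add_distrib, Finset.mul_sum]
      refine Finset.sum_congr rfl fun i _ => ?_
      have : ∑ q, c q * pairing (f q) (X i) =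
          c q₀ * pairing (f q₀) (X i) + ∑ q with q ≠ q₀, c q * pairing (f q) (X i) := by
        rw [Finset.filter_ne',
          Finset.add_sum_erase _ (fun q => c q * pairing (f q) (X i)) (Finset.mem_univ _)]
      rw [hgp, this]
      ring
    · intro i hi hi'
      rw [hgp, Finset.sum_eq_zero, mul_zero, mul_zero]
      intro q _
      rw [pairing_eq_zero_of_not_meets, mul_zero]
      intro hm
      have : i₁ ≤ i := Finset.min'_le _ _ (Finset.mem_filter.2 ⟨hi, q, hm⟩)
      apply hi'
      rcases this.eq_or_lt with h | h
      · simp [h]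
      · exact Finset.mem_insert_of_mem (Finset.mem_filter.2 ⟨hi, h⟩)
  rw [hsplit]
  have t1 : |a i₁ * pairing g (X i₁)| ≤ A := by
    rw [abs_mul, ← mul_one A]
    exact mul_le_mul (ha _ hi₁J) ((P.abs_pairing_le hW _).trans (hX1 _ (hJ hi₁J))) (abs_nonneg _) hA
  have t2 : |P.θ * (c q₀ * pairing (f q₀) (∑ i ∈ I, a i • X i))| ≤
      1 / 4 * |pairing (f q₀) (∑ i ∈ I, a i • X i)| := by
    rw [abs_mul, abs_of_pos hθ, abs_mul]
    gcongr
    exact mul_le_of_le_one_left (abs_nonneg _) (hc _)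
  have t3 : |P.θ * ∑ i ∈ I, a i * ∑ q with q ≠ q₀, c q * pairing (f q) (X i)| ≤
      1 / 4 * (2 * A) := by
    rw [abs_mul, abs_of_pos hθ]
    gcongr
    calc |∑ i ∈ I, a i * ∑ q with q ≠ q₀, c q * pairing (f q) (X i)|
        ≤ ∑ i ∈ I, A * (2 / S.card) := by
          refine (Finset.abs_sum_le_sum_abs _ _).trans (Finset.sum_le_sum fun i hi => ?_)
          rw [abs_mul]
          refine mul_le_mul (ha i (Finset.mem_filter.1 hi).1) ?_ (abs_nonneg _) hA
          refine (Finset.abs_sum_le_sum_abs _ _).trans (le_trans (le_of_eq ?_) (hbound i hi))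
          exact Finset.sum_congr rfl fun q _ => abs_mul _ _
      _ = (I.card : ℝ) * (A * (2 / S.card)) := by rw [Finset.sum_const, nsmul_eq_mul]
      _ ≤ S.card * (A * (2 / S.card)) := by
          gcongr
          exact (Finset.filter_subset _ _).trans hJ
      _ = 2 * A := by field_simp
  calc _ ≤ A + (1 / 4 * |pairing (f q₀) (∑ i ∈ I, a i • X i)| + 1 / 4 * (2 * A)) :=
        (abs_add_le _ _).trans (add_le_add t1 ((abs_add_le _ _).trans (add_le_add t2 t3)))
    _ = _ := by ring

theorem abs_apply_le_c00Norm (x : ℕ+ →₀ ℝ) (j : ℕ+) : |x j| ≤ P.c00Norm x := by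
  simpa [pairing] using P.abs_pairing_le (P.single_mem_normingSet j) x

/-- At most one block is nonzero at the coordinate `j`, and normalization bounds its entry by one.
-/
theorem abs_apply_sum_le {X : ℕ → ℕ+ →₀ ℝ} (hX : BlockSupports X) {J : Finset ℕ}
    (hX1 : ∀ i ∈ J, P.c00Norm (X i) ≤ 1) {a : ℕ → ℝ} {A : ℝ} (hA : 0 ≤ A)
    (ha : ∀ i ∈ J, |a i| ≤ A) {j : ℕ+} {ε : ℝ} (hε : ε = 1 ∨ ε = -1) :
    |pairing (Finsupp.single j ε) (∑ i ∈ J, a i • X i)| ≤ A := by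
  have hε' : |ε| = 1 := by rcases hε with rfl | rfl <;> simp
  have h1 : pairing (Finsupp.single j ε) (∑ i ∈ J, a i • X i) = ε * ∑ i ∈ J, a i * X i j := by
    simp [pairing, Finsupp.finsetSum_apply]
  rw [h1, abs_mul, hε', one_mul]
  by_cases h : ∃ i ∈ J, X i j ≠ 0
  · obtain ⟨i, hi, hij⟩ := h
    rw [Finset.sum_eq_single i]
    · rw [abs_mul, ← mul_one A]
      exact mul_le_mul (ha i hi) ((abs_apply_le_c00Norm _ j).trans (hX1 i hi)) (abs_nonneg _) hA
    · intro i' _ hne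
      by_contra h0
      have h1 : j ∈ (X i').support := Finsupp.mem_support_iff.2 (right_ne_zero_of_mul h0)
      have h2 : j ∈ (X i).support := Finsupp.mem_support_iff.2 hij
      rcases lt_or_gt_of_ne hne with h | h
      · exact lt_irrefl _ (hX _ _ h j h1 j h2)
      · exact lt_irrefl _ (hX _ _ h j h2 j h1)
    · exact fun h => absurd hi h
  · push Not at h
    rw [Finset.sum_eq_zero fun i hi => by rw [h i hi, mul_zero], abs_zero]
    exact hA

theorem mem_normingSet_of_orderZero {d : ℕ} {f : Fin d → ℕ+ →₀ ℝ}
    (hf : ∀ q, f q ∈ P.normingSet) (hs : Successive f) (T : Finset (Fin d)) (c : Fin d → ℝ)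
    (hT : T.Nonempty) (hc : lpNormOn (P.conj P.ξ) T c ≤ 1) :
    P.θ • ∑ q ∈ T, c q • f q ∈ P.normingSet :=
  ⟨_, Norming.orderZero_finset hT (fun q _ => hf q) (hs.successiveOn T) hc⟩

theorem mem_normingSet_of_orderPos {d k : ℕ} (hk : 1 ≤ k) (hkξ : (k : ℕ∞) < P.ξ)
    {f : Fin d → ℕ+ →₀ ℝ} {o s : Fin d → ℕ} (hf : ∀ q, P.Norming (some (o q, s q)) (f q))
    (ho : ∀ q, o q < k) (hadm : Admissible f) (hvfg : VeryFastGrowing f s)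
    (T : Finset (Fin d)) (c : Fin d → ℝ)
    (hT : T.Nonempty) (hc : lpNormOn (P.conj k) T c ≤ 1) :
    P.θ • ∑ q ∈ T, c q • f q ∈ P.normingSet := by
  obtain ⟨q, -, h⟩ := Norming.orderPos_finset hT hk hkξ (fun q _ => hf q) (fun q _ => ho q)
    (hadm.1.successiveOn T)
    (fun q _ i hi => ((Finset.card_le_univ _).trans_eq (Fintype.card_fin d)).trans
      (hadm.card_le q hi))
    (fun q _ r _ hqr i hi => hvfg.of_lt hadm.1 hqr hi) hc
  exact ⟨_, h⟩

/-- Upper `ℓ_{p_{K+1}}` estimate on sparse blocks. -/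
theorem Norming.abs_pairing_sum_le {K : ℕ} (hK : ((K + 1 : ℕ) : ℕ∞) ≤ P.ξ)
    {X : ℕ → ℕ+ →₀ ℝ} (hX : BlockSupports X) {S : Finset ℕ}
    (hX1 : ∀ i ∈ S, P.c00Norm (X i) ≤ 1) (hS : P.Sparse K S X) (a : ℕ → ℝ)
    {l : Option (ℕ × ℕ)} {f : ℕ+ →₀ ℝ} (h : P.Norming l f) :
    ∀ J ⊆ S, |pairing f (∑ i ∈ J, a i • X i)| ≤ 2 * lpNormOn (P.p (K + 1 : ℕ)) J a := by
  have h1K : (1 : ℕ∞) ≤ ((K + 1 : ℕ) : ℕ∞) := by exact_mod_cast Nat.le_add_left 1 K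
  have hp1 := P.one_le_p' h1K hK
  have hgen : ∀ κ : ℕ∞, ((K + 1 : ℕ) : ℕ∞) ≤ κ → κ ≤ P.ξ → ∀ {d : ℕ} (f : Fin d → ℕ+ →₀ ℝ),
      Successive f → ∀ c : Fin d → ℝ, InLpUnitBall (P.conj κ) c →
      (∀ (T : Finset (Fin d)) (c : Fin d → ℝ), T.Nonempty → lpNormOn (P.conj κ) T c ≤ 1 →
        P.θ • ∑ q ∈ T, c q • f q ∈ P.normingSet) → ∀ J ⊆ S,
      (∀ q, ∀ I ⊆ J, |pairing (f q) (∑ i ∈ I, a i • X i)| ≤ 2 * lpNormOn (P.p (K + 1 : ℕ)) I a) →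
      |pairing (P.θ • ∑ q, c q • f q) (∑ i ∈ J, a i • X i)| ≤
        2 * lpNormOn (P.p (K + 1 : ℕ)) J a := by
    intro κ hκ hκξ d f hs c hc hW J hJ ih
    have hc' := (inLpUnitBall_iff (P.one_le_conj _)).1 hc
    have hpκ : P.p (K + 1 : ℕ) ≤ P.p κ :=
      P.p_strictMono.monotoneOn ⟨h1K, hK⟩ ⟨h1K.trans hκ, hκξ⟩ hκ
    have e := abs_pairing_combination_le hs hX (fun i hi => hX1 i (hJ hi))
      (P.holderConjugate (h1K.trans hκ) hκξ) (P.holderConjugate h1K hK) hc' hW zero_le_two ih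
    -- Conjugation reverses order: `p_{K+1} ≤ p_κ` puts the unit ball of `ℓ_{p'_κ}` inside that of
    -- `ℓ_{p'_{K+1}}`.
    have e1 : lpNormOn (P.conj (K + 1 : ℕ)) Finset.univ c ≤ 1 :=
      (lpNormOn_antitone (P.one_le_conj _) (ENNReal.conjExponent_antitone hpκ)).trans hc'
    have e2 : lpNormOn (P.p κ) J a ≤ lpNormOn (P.p (K + 1 : ℕ)) J a := lpNormOn_antitone hp1 hpκ
    have e3 : 0 ≤ lpNormOn (P.p (K + 1 : ℕ)) J a := lpNormOn_nonneg
    have e4 := mul_le_mul_of_nonneg_right e1 e3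
    -- The recursion gives `(1/4) * 2 + 1 = 3/2 ≤ 2`.
    nlinarith
  induction h with
  | unit j ε hε =>
    intro J hJ
    have := abs_apply_sum_le (P := P) hX (fun i hi => hX1 i (hJ hi)) (a := a)
      (lpNormOn_nonneg (p := P.p (K + 1 : ℕ)) (S := J) (a := a))
      (fun i hi => abs_le_lpNormOn hp1 hi) (j := j) hε
    linarith [lpNormOn_nonneg (p := P.p (K + 1 : ℕ)) (S := J) (a := a)]
  | orderZero hd f l hf hs c hc ih =>
    intro J hJ
    exact hgen P.ξ hK le_rfl f hs c hc
      (mem_normingSet_of_orderZero (fun q => ⟨_, hf q⟩) hs) J hJ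
      fun q I hI => ih q I (hI.trans hJ)
  | @orderZeroSized d n hd hdn f l hf hs ih =>
    intro J hJ
    refine hgen P.ξ hK le_rfl f hs _ ?_ (mem_normingSet_of_orderZero (fun q => ⟨_, hf q⟩) hs) J hJ
      fun q I hI => ih q I (hI.trans hJ)
    have hn : (0 : ℝ) < n := by exact_mod_cast hd.trans_le hdn
    rw [inLpUnitBall_iff (P.one_le_conj _)]
    refine (lpNormOn_le_card_rpow (P.one_le_conj _) (M := (1 / (n : ℝ)) ^
      (1 / (P.conj P.ξ).toReal)) (by positivity) fun q _ =>
        (abs_of_nonneg (by positivity)).le).trans ?_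
    rw [← Real.mul_rpow (by positivity) (by positivity)]
    refine Real.rpow_le_one (by positivity) ?_ (by positivity)
    rw [Finset.card_univ, Fintype.card_fin, one_div, inv_mul_le_iff₀ hn, mul_one]
    exact_mod_cast hdn
  | @orderPos d hd k hk hkξ f o s hf ho hadm hvfg c hc m hm ih =>
    intro J hJ
    have hW := mem_normingSet_of_orderPos hk hkξ hf ho hadm hvfg
    by_cases hkK : k ≤ K
    · have hc' := abs_le_one_of_inLpUnitBall (P.one_le_conj _) hc
      have : Nonempty (Fin d) := ⟨⟨0, hd⟩⟩
      obtain ⟨q, I, hI, hb⟩ := exists_abs_pairing_orderPos_le hd hkK hf ho hadm hvfg hc'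
        (hW _ c Finset.univ_nonempty ((inLpUnitBall_iff (P.one_le_conj _)).1 hc)) hX hJ hX1 hS
        (lpNormOn_nonneg (p := P.p (K + 1 : ℕ)) (S := J) (a := a))
        (fun i hi => abs_le_lpNormOn hp1 hi)
      have e1 := ih q I (hI.trans hJ)
      have e2 : lpNormOn (P.p (K + 1 : ℕ)) I a ≤ lpNormOn (P.p (K + 1 : ℕ)) J a :=
        lpNormOn_mono hp1 hI fun _ _ => le_rfl
      -- Here the constant 2 is reproduced exactly: `3/2 + (1/4) * 2 = 2`.
      linarith
    · exact hgen k (by exact_mod_cast Nat.succ_le_of_lt (not_le.1 hkK)) hkξ.le f hadm.1 c hc hW J hJ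
        fun q I hI => ih q I (hI.trans hJ)

theorem c00Norm_sum_le {K : ℕ} (hK : ((K + 1 : ℕ) : ℕ∞) ≤ P.ξ)
    {X : ℕ → ℕ+ →₀ ℝ} (hX : BlockSupports X) {S : Finset ℕ}
    (hX1 : ∀ i ∈ S, P.c00Norm (X i) ≤ 1) (hS : P.Sparse K S X) (a : ℕ → ℝ) :
    P.c00Norm (∑ i ∈ S, a i • X i) ≤ 2 * lpNormOn (P.p (K + 1 : ℕ)) S a :=
  P.c00Norm_le fun _ ⟨_, hf⟩ => hf.abs_pairing_sum_le hK hX hX1 hS a S subset_rfl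

/-- Functionals of order at most `K` and large size are small on `ℓ_{p_{K+1}}` averages of sparse
blocks. -/
theorem Norming.abs_pairing_sum_le_of_size {K : ℕ} (hK : ((K + 1 : ℕ) : ℕ∞) < P.ξ)
    {X : ℕ → ℕ+ →₀ ℝ} (hX : BlockSupports X) {S : Finset ℕ}
    (hX1 : ∀ i ∈ S, P.c00Norm (X i) ≤ 1) (hS : P.Sparse K S X) {a : ℕ → ℝ}
    (ha : ∀ i ∈ S, |a i| ≤ 1) {N : ℕ} (hN : 1 ≤ N)
    {l : Option (ℕ × ℕ)} {f : ℕ+ →₀ ℝ} (h : P.Norming l f) :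
    ∀ o s, l = some (o, s) → o ≤ K → N ≤ s → ∀ J ⊆ S, |pairing f (∑ i ∈ J, a i • X i)| ≤
      2 + (S.card : ℝ) ^ (1 / (P.p P.ξ).toReal) + (S.card : ℝ) ^ (1 / (P.p (K + 1 : ℕ)).toReal) *
        (N : ℝ) ^ (1 / (P.p P.ξ).toReal - 1 / (P.p (K + 1 : ℕ)).toReal) := by
  have h1K : (1 : ℕ∞) ≤ ((K + 1 : ℕ) : ℕ∞) := by exact_mod_cast Nat.le_add_left 1 K
  have hp1 := P.one_le_p' h1K hK.le
  have hpξ1 := P.one_le_p' P.one_le_ξ le_rfl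
  have hpp : P.p (K + 1 : ℕ) < P.p P.ξ := P.p_strictMono ⟨h1K, hK.le⟩ ⟨P.one_le_ξ, le_rfl⟩ hK
  set B := 2 + (S.card : ℝ) ^ (1 / (P.p P.ξ).toReal) +
    (S.card : ℝ) ^ (1 / (P.p (K + 1 : ℕ)).toReal) *
      (N : ℝ) ^ (1 / (P.p P.ξ).toReal - 1 / (P.p (K + 1 : ℕ)).toReal) with hB
  have hB2 : 2 ≤ B := by
    rw [hB, add_assoc]
    exact le_add_of_nonneg_right (by positivity)
  induction h with
  | unit => simp
  | orderZero => simp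
  | @orderZeroSized d n hd hdn f l hf hs ih =>
    intro o s hos _ hNs J hJ
    obtain rfl : n = s := by
      simp only [Option.some.injEq, Prod.mk.injEq] at hos
      exact hos.2
    have hn : (0 : ℝ) < n := by exact_mod_cast hd.trans_le hdn
    set c : Fin d → ℝ := fun _ => (1 / (n : ℝ)) ^ (1 / (P.conj P.ξ).toReal) with hc
    have hcn : ∀ r : ℝ≥0∞, 1 ≤ r → lpNormOn r Finset.univ c ≤
        (1 / (n : ℝ)) ^ (1 / (P.conj P.ξ).toReal) * (n : ℝ) ^ (1 / r.toReal) := by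
      intro r hr
      refine (lpNormOn_le_card_rpow hr (M := (1 / (n : ℝ)) ^
        (1 / (P.conj P.ξ).toReal)) (by positivity) fun q _ =>
          (abs_of_nonneg (by positivity)).le).trans ?_
      rw [Finset.card_univ, Fintype.card_fin]
      gcongr
    -- The base of the recursion. The uniform coefficients have norm at most `1` in `ℓ_{p'_ξ}` but
    -- only about `n^{1/p_ξ - 1/p_{K+1}}` in `ℓ_{p'_{K+1}}`; this gain beats the trivial bound.
    have e := abs_pairing_combination_le hs hX (fun i hi => hX1 i (hJ hi))
      (P.holderConjugate P.one_le_ξ le_rfl) (P.holderConjugate h1K hK.le) (c := c) (a := a)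
      ((hcn _ (P.one_le_conj _)).trans_eq (by
        rw [← Real.mul_rpow (by positivity) (by positivity), one_div_mul_cancel hn.ne',
          Real.one_rpow]))
      (mem_normingSet_of_orderZero (fun q => ⟨_, hf q⟩) hs) zero_le_two
      (fun q I hI => (hf q).abs_pairing_sum_le hK.le hX hX1 hS a I (hI.trans hJ))
    refine e.trans ?_
    have hJcard : (J.card : ℝ) ≤ S.card := by exact_mod_cast Finset.card_le_card hJ
    have e1 : lpNormOn (P.p P.ξ) J a ≤ (S.card : ℝ) ^ (1 / (P.p P.ξ).toReal) := by
      refine (lpNormOn_le_card_rpow hpξ1 zero_le_one fun i hi => ha i (hJ hi)).trans ?_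
      rw [one_mul]
      gcongr
    have e2 : lpNormOn (P.p (K + 1 : ℕ)) J a ≤
        (S.card : ℝ) ^ (1 / (P.p (K + 1 : ℕ)).toReal) := by
      refine (lpNormOn_le_card_rpow hp1 zero_le_one fun i hi => ha i (hJ hi)).trans ?_
      rw [one_mul]
      gcongr
    have e3 : lpNormOn (P.conj (K + 1 : ℕ)) Finset.univ c ≤
        (N : ℝ) ^ (1 / (P.p P.ξ).toReal - 1 / (P.p (K + 1 : ℕ)).toReal) := by
      refine (hcn _ (P.one_le_conj _)).trans ?_
      have h1 := (P.holderConjugate h1K hK.le).one_div_toReal_add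
      have h2 := (P.holderConjugate P.one_le_ξ le_rfl).one_div_toReal_add
      rw [one_div (n : ℝ), Real.inv_rpow hn.le, ← Real.rpow_neg hn.le, ← Real.rpow_add hn]
      have h3 : -(1 / (P.conj P.ξ).toReal) + 1 / (P.conj (K + 1 : ℕ)).toReal =
          1 / (P.p P.ξ).toReal - 1 / (P.p (K + 1 : ℕ)).toReal := by linarith
      rw [h3]
      refine Real.rpow_le_rpow_of_nonpos (by exact_mod_cast hN) (by exact_mod_cast hNs) ?_
      have h4 := ENNReal.conjExponent_antitone hpp.le
      have h5 : (P.p P.ξ)⁻¹ ≤ (P.p (K + 1 : ℕ))⁻¹ := ENNReal.inv_le_inv.2 hpp.le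
      have h6 := ENNReal.toReal_mono (ENNReal.inv_ne_top.2 (zero_lt_one.trans_le hp1).ne') h5
      rw [ENNReal.toReal_inv, ENNReal.toReal_inv] at h6
      rw [one_div, one_div]
      linarith
    have e4 : lpNormOn (P.conj (K + 1 : ℕ)) Finset.univ c * lpNormOn (P.p (K + 1 : ℕ)) J a ≤
        (N : ℝ) ^ (1 / (P.p P.ξ).toReal - 1 / (P.p (K + 1 : ℕ)).toReal) *
        (S.card : ℝ) ^ (1 / (P.p (K + 1 : ℕ)).toReal) :=
      mul_le_mul e3 e2 lpNormOn_nonneg (by positivity)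
    have e5 : 0 ≤ (N : ℝ) ^ (1 / (P.p P.ξ).toReal - 1 / (P.p (K + 1 : ℕ)).toReal) *
        (S.card : ℝ) ^ (1 / (P.p (K + 1 : ℕ)).toReal) := by positivity
    rw [hB]
    nlinarith
  | @orderPos d hd k hk hkξ f o s hf ho hadm hvfg c hc m hm ih =>
    intro o₁ s₁ hos hoK hNs J hJ
    simp only [Option.some.injEq, Prod.mk.injEq] at hos
    have : Nonempty (Fin d) := ⟨⟨0, hd⟩⟩
    obtain ⟨q, I, hI, hb⟩ := exists_abs_pairing_orderPos_le hd (hos.1.trans_le hoK) hf ho hadm hvfg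
      (abs_le_one_of_inLpUnitBall (P.one_le_conj _) hc)
      (mem_normingSet_of_orderPos hk hkξ hf ho hadm hvfg _ c Finset.univ_nonempty
        ((inLpUnitBall_iff (P.one_le_conj _)).1 hc)) hX hJ hX1 hS
      zero_le_one (fun i hi => ha i (hJ hi))
    -- The size of the combination is the least size of its members, so `f q` again has size at
    -- least `N`. The bound closes since `3/2 + B/4 ≤ B` for `B ≥ 2`.
    have e1 := ih q _ _ rfl (((ho q).le.trans_eq hos.1).trans hoK)
      ((hNs.trans_eq hos.2.symm).trans (hm.2 ⟨q, rfl⟩)) I (hI.trans hJ)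
    linarith

end SpaceParams

/-! ### Extraction of subsequences, sparse tuples and lower estimates -/

theorem exists_strictMono_of_eventually {R : ℕ → ℕ → Prop}
    (h : ∀ i, ∀ᶠ j in atTop, R i j) :
    ∃ φ : ℕ → ℕ, StrictMono φ ∧ ∀ a b, a < b → R (φ a) (φ b) := by
  obtain ⟨φ, -, hφ⟩ := exists_seq_of_forall_finset_exists (fun _ : ℕ => True)
    (fun i j => i < j ∧ R i j) fun s _ => by
      have : ∀ᶠ j in atTop, ∀ i ∈ s, i < j ∧ R i j :=
        (Filter.eventually_all_finset s).2 fun i _ => (eventually_gt_atTop i).and (h i)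
      obtain ⟨j, hj⟩ := this.exists
      exact ⟨j, trivial, hj⟩
  exact ⟨φ, fun a b hab => (hφ a b hab).1, fun a b hab => (hφ a b hab).2⟩

theorem exists_successive_finsets {Q : Finset ℕ → Prop}
    (h : ∀ N m, ∃ F : Finset ℕ, F.card = m ∧ (∀ i ∈ F, N ≤ i) ∧ Q F) :
    ∃ F : ℕ → Finset ℕ, (∀ j, j < (F j).card ∧ Q (F j)) ∧
      ∀ i j, i < j → ∀ a ∈ F i, ∀ b ∈ F j, a < b := by
  obtain ⟨F, hF, hr⟩ := exists_seq_of_forall_finset_exists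
    (fun F : Finset ℕ => 0 < F.card ∧ Q F)
    (fun F G => (∀ a ∈ F, ∀ b ∈ G, a < b) ∧ F.card < G.card) fun s _ => by
      obtain ⟨G, hG, hN, hQ⟩ := h (s.sup (fun F => F.sup id) + 1) (s.sup Finset.card + 1)
      refine ⟨G, ⟨by omega, hQ⟩, fun F hF => ⟨fun a ha b hb => ?_, ?_⟩⟩
      · have h1 : a ≤ F.sup id := Finset.le_sup (f := id) ha
        have h2 : F.sup id ≤ s.sup (fun F => F.sup id) :=
          Finset.le_sup (f := fun F : Finset ℕ => F.sup id) hF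
        have := hN b hb
        omega
      · have := Finset.le_sup (f := Finset.card) hF
        omega
  have hmono : StrictMono fun j => (F j).card := fun a b hab => (hr a b hab).2
  refine ⟨F, fun j => ⟨?_, (hF j).2⟩, fun i j hij => (hr i j hij).1⟩
  induction j with
  | zero => exact (hF 0).1
  | succ j ih => exact lt_of_le_of_lt ih (hmono (Nat.lt_succ_self j))

namespace SpaceParams

variable {P : SpaceParams}

/-- Functionals of order below `k` and size tending to infinity tend to zero on the sequence. -/
def Vanishing (P : SpaceParams) (k : ℕ) (X : ℕ → ℕ+ →₀ ℝ) : Prop :=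
  ∀ ε > 0, ∃ N, ∀ f o s j, P.Norming (some (o, s)) f → o < k → N ≤ s → N ≤ j →
    |pairing f (X j)| ≤ ε

theorem vanishing_zero (X : ℕ → ℕ+ →₀ ℝ) : P.Vanishing 0 X :=
  fun _ _ => ⟨0, fun _ _ _ _ _ h => absurd h (Nat.not_lt_zero _)⟩

theorem Vanishing.comp {k : ℕ} {X : ℕ → ℕ+ →₀ ℝ} (h : P.Vanishing k X) {φ : ℕ → ℕ}
    (hφ : StrictMono φ) : P.Vanishing k (X ∘ φ) := fun ε hε => by
  obtain ⟨N, hN⟩ := h ε hε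
  exact ⟨N, fun f o s j hf ho hs hj => hN f o s (φ j) hf ho hs (hj.trans (hφ.id_le j))⟩

theorem BlockSupports.comp {X : ℕ → ℕ+ →₀ ℝ} (h : BlockSupports X) {φ : ℕ → ℕ}
    (hφ : StrictMono φ) : BlockSupports (X ∘ φ) := fun i j hij => h (φ i) (φ j) (hφ hij)

/-- Supports move to the right by at least one place per block. This converts "far out in the
sequence" into "large support point", hence into large size. -/
theorem BlockSupports.lt_of_mem {X : ℕ → ℕ+ →₀ ℝ} (h : BlockSupports X) (h0 : ∀ i, X i ≠ 0)
    {i : ℕ} : ∀ {u : ℕ+}, u ∈ (X i).support → i < (u : ℕ) := by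
  induction i with
  | zero => exact fun {u} _ => u.pos
  | succ i ih =>
    intro u hu
    obtain ⟨v, hv⟩ := Finsupp.support_nonempty_iff.2 (h0 i)
    exact lt_of_le_of_lt (ih hv) (by exact_mod_cast h i (i + 1) (Nat.lt_succ_self i) v hv u hu)

/-- Tuples far out in the sequence are sparse. -/
def EventuallySparse (P : SpaceParams) (k : ℕ) (X : ℕ → ℕ+ →₀ ℝ) : Prop :=
  ∀ n, ∃ M, ∀ S : Finset ℕ, S.card = n → (∀ i ∈ S, M ≤ i) → P.Sparse k S X

/-- The first bound in `Sparse` holds far out without thinning. The second involves a support point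
`u` of the earlier block, so the later block must be chosen after it: the subsequence secures `1 /
u²`, and far out `u` exceeds the length of the tuple. -/
theorem Vanishing.exists_eventuallySparse {k : ℕ} {X : ℕ → ℕ+ →₀ ℝ} (h : P.Vanishing k X)
    (hX : BlockSupports X) (h0 : ∀ i, X i ≠ 0) :
    ∃ φ : ℕ → ℕ, StrictMono φ ∧ P.EventuallySparse k (X ∘ φ) := by
  obtain ⟨φ, hφ, hR⟩ := exists_strictMono_of_eventually
    (R := fun i j => ∀ f o s, P.Norming (some (o, s)) f → o < k → ∀ u ∈ (X i).support,
      ∀ v ∈ (X j).support, (v : ℕ) < s → |pairing f (X j)| ≤ 1 / ((u : ℕ) * (u : ℕ) : ℝ)) (by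
    intro i
    obtain ⟨w, hw, hmax⟩ := Finset.exists_max_image (X i).support id
      (Finsupp.support_nonempty_iff.2 (h0 i))
    have hwpos : (0 : ℝ) < (w : ℕ) := by exact_mod_cast w.pos
    obtain ⟨N, hN⟩ := h (1 / ((w : ℕ) * (w : ℕ) : ℝ)) (by positivity)
    filter_upwards [eventually_ge_atTop N] with j hj f o s hf ho u hu v hv hvs
    refine (hN f o s j hf ho (hj.trans ((hX.lt_of_mem h0 hv).trans hvs).le) hj).trans ?_
    have hupos : (0 : ℝ) < (u : ℕ) := by exact_mod_cast u.pos
    have huw : ((u : ℕ) : ℝ) ≤ (w : ℕ) := by exact_mod_cast hmax u hu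
    gcongr)
  refine ⟨φ, hφ, fun n => ?_⟩
  obtain ⟨N, hN⟩ := h (1 / (n + 1 : ℝ)) (by positivity)
  refine ⟨max N n, fun S hS hM f o s hf ho i hi j hj hij => ⟨fun u hu hus => ?_,
    fun u hu v hv hvs => ?_⟩⟩
  · have hi' := (le_max_left _ _).trans ((hM i hi).trans (hφ.id_le i))
    have hj' := (le_max_left _ _).trans ((hM j hj).trans (hφ.id_le j))
    refine (hN f o s (φ j) hf ho (hi'.trans ((hX.lt_of_mem h0 hu).trans hus).le) hj').trans ?_
    have : (0 : ℝ) < S.card := by exact_mod_cast Finset.card_pos.2 ⟨i, hi⟩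
    rw [hS] at this ⊢
    gcongr
    linarith
  · refine (hR i j hij f o s hf ho u hu v hv hvs).trans ?_
    have hupos : (0 : ℝ) < (u : ℕ) := by exact_mod_cast u.pos
    have hcard : (0 : ℝ) < S.card := by exact_mod_cast Finset.card_pos.2 ⟨i, hi⟩
    have hSu : (S.card : ℝ) ≤ (u : ℕ) := by
      rw [hS]
      exact_mod_cast (le_max_right N n).trans
        ((hM i hi).trans ((hφ.id_le i).trans (hX.lt_of_mem h0 hu).le))
    gcongr

/-- The functionals `h i` have order below `r`, are supported on the blocks `X i`, form a very fast
growing sequence, and are bounded below by `δ` on the corresponding blocks. -/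
structure Tracks (P : SpaceParams) (r : ℕ) (δ : ℝ) (X h : ℕ → ℕ+ →₀ ℝ) (o s : ℕ → ℕ) :
    Prop where
  norming : ∀ i, P.Norming (some (o i, s i)) (h i)
  order_lt : ∀ i, o i < r
  support_subset : ∀ i, (h i).support ⊆ (X i).support
  fast : ∀ i j, i < j → ∀ u ∈ (h i).support, (∀ v ∈ (h j).support, u ^ 2 < v) ∧ (u : ℕ) < s j
  le_size : ∀ i, i ≤ s i
  le_pairing : ∀ i, δ ≤ pairing (h i) (X i)

/-- Restriction to the support of `x` keeps the pairing and the order and does not lower the size; a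
change of sign makes the pairing positive. -/
theorem Norming.exists_supported {l : Option (ℕ × ℕ)} {f x : ℕ+ →₀ ℝ} (h : P.Norming l f)
    (hx : pairing f x ≠ 0) :
    ∃ l' g, P.Norming l' g ∧ g.support ⊆ x.support ∧ pairing g x = |pairing f x| ∧
      ∀ o s, l = some (o, s) → ∃ s', s ≤ s' ∧ l' = some (o, s') := by
  have h1 : pairing (f.filter (· ∈ x.support)) x = pairing f x := by
    rw [pairing_filter]
    congr 1
    exact Finsupp.filter_eq_self_iff _ _ |>.2 fun j hj => Finsupp.mem_support_iff.2 hj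
  have h0 : f.filter (· ∈ x.support) ≠ 0 := fun h0 => hx (by
    rw [← h1, h0]
    simp [pairing])
  have hsub : (f.filter (· ∈ x.support)).support ⊆ x.support := fun j hj => by
    rw [Finsupp.support_filter, Finset.mem_filter] at hj
    exact hj.2
  obtain ⟨l', hl', hs⟩ := h.restrict x.support h0
  rcases abs_choice (pairing f x) with ha | ha
  · exact ⟨l', _, hl', hsub, by rw [h1, ha], hs⟩
  · exact ⟨l', _, hl'.neg, by rwa [Finsupp.support_neg], by rw [pairing_neg_left, h1, ha], hs⟩

theorem exists_tracks {r : ℕ} {X : ℕ → ℕ+ →₀ ℝ} (hX : BlockSupports X) (h0 : ∀ i, X i ≠ 0)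
    (hv : ¬ P.Vanishing r X) :
    ∃ δ > 0, ∃ φ : ℕ → ℕ, StrictMono φ ∧ ∃ h o s, P.Tracks r δ (X ∘ φ) h o s := by
  unfold Vanishing at hv
  push Not at hv
  obtain ⟨δ, hδ, hv⟩ := hv
  refine ⟨δ, hδ, ?_⟩
  let good : (ℕ+ →₀ ℝ) × ℕ × ℕ × ℕ → Prop := fun a =>
    P.Norming (some (a.2.1, a.2.2.1)) a.1 ∧ a.2.1 < r ∧ a.1.support ⊆ (X a.2.2.2).support ∧
      δ ≤ pairing a.1 (X a.2.2.2)
  have hgood : ∀ N, ∃ a, good a ∧ N ≤ a.2.2.1 ∧ N ≤ a.2.2.2 := by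
    intro N
    obtain ⟨f, o, s, j, hf, ho, hs, hj, hp⟩ := hv N
    have hne : pairing f (X j) ≠ 0 := abs_pos.1 (hδ.trans hp)
    obtain ⟨l', g, hg, hsub, hgp, hl⟩ := hf.exists_supported hne
    obtain ⟨s', hs', rfl⟩ := hl _ _ rfl
    exact ⟨(g, o, s', j), ⟨hg, ho, hsub, hp.le.trans_eq hgp.symm⟩, hs.trans hs', hj⟩
  obtain ⟨a, ha, hr⟩ := exists_seq_of_forall_finset_exists good
    (fun a b => a.2.2.2 < b.2.2.2 ∧ a.2.2.1 < b.2.2.1 ∧ ∀ u ∈ a.1.support,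
      (∀ v ∈ b.1.support, u ^ 2 < v) ∧ (u : ℕ) < b.2.2.1) fun S _ => by
      -- The threshold lies beyond all earlier indices, sizes and squared support points at once.
      obtain ⟨b, hb, hb1, hb2⟩ := hgood (S.sup (fun a => a.2.2.2) + S.sup (fun a => a.2.2.1) +
        S.sup (fun a => a.1.support.sup fun u => (u : ℕ) ^ 2) + 1)
      refine ⟨b, hb, fun a ha => ?_⟩
      have e1 := Finset.le_sup (f := fun a : (ℕ+ →₀ ℝ) × ℕ × ℕ × ℕ => a.2.2.2) ha
      have e2 := Finset.le_sup (f := fun a : (ℕ+ →₀ ℝ) × ℕ × ℕ × ℕ => a.2.2.1) ha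
      have e3 := Finset.le_sup (f := fun a : (ℕ+ →₀ ℝ) × ℕ × ℕ × ℕ =>
        a.1.support.sup fun u => (u : ℕ) ^ 2) ha
      refine ⟨by omega, by omega, fun u hu => ?_⟩
      have e4 := Finset.le_sup (f := fun u : ℕ+ => (u : ℕ) ^ 2) hu
      have e5 : (u : ℕ) ≤ (u : ℕ) ^ 2 := Nat.le_self_pow two_ne_zero _
      refine ⟨fun v hv => ?_, by omega⟩
      have e6 := hX.lt_of_mem h0 (hb.2.2.1 hv)
      have : (u : ℕ) ^ 2 < (v : ℕ) := by omega
      exact_mod_cast this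
  refine ⟨fun i => (a i).2.2.2, fun i j hij => (hr i j hij).1, fun i => (a i).1,
    fun i => (a i).2.1, fun i => (a i).2.2.1, ?_⟩
  have hmono : StrictMono fun i => (a i).2.2.1 := fun i j hij => (hr i j hij).2.1
  exact ⟨fun i => (ha i).1, fun i => (ha i).2.1, fun i => (ha i).2.2.1,
    fun i j hij => (hr i j hij).2.2, fun i => hmono.id_le i, fun i => (ha i).2.2.2⟩

theorem Tracks.comp {r : ℕ} {δ : ℝ} {X h : ℕ → ℕ+ →₀ ℝ} {o s : ℕ → ℕ} (H : P.Tracks r δ X h o s)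
    {φ : ℕ → ℕ} (hφ : StrictMono φ) :
    P.Tracks r δ (X ∘ φ) (h ∘ φ) (o ∘ φ) (s ∘ φ) :=
  ⟨fun _ => H.norming _, fun _ => H.order_lt _, fun _ => H.support_subset _,
    fun _ _ hij => H.fast _ _ (hφ hij), fun i => (hφ.id_le i).trans (H.le_size _),
    fun _ => H.le_pairing _⟩

theorem pairing_combination_diagonal {X h : ℕ → ℕ+ →₀ ℝ} (hX : BlockSupports X)
    (hsub : ∀ i, (h i).support ⊆ (X i).support) (S : Finset ℕ) (a c : ℕ → ℝ) :
    pairing (P.θ • ∑ i ∈ S, c i • h i) (∑ i ∈ S, a i • X i) =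
      P.θ * ∑ i ∈ S, c i * (a i * pairing (h i) (X i)) := by
  rw [pairing_combination]
  congr 1
  refine Finset.sum_congr rfl fun i hi => ?_
  rw [pairing_sum_smul, Finset.sum_eq_single_of_mem i hi]
  intro j _ hne
  rw [pairing_eq_zero, mul_zero]
  rw [Finset.disjoint_left]
  intro u hu hu'
  rcases lt_or_gt_of_ne hne with h | h
  · exact lt_irrefl _ (hX _ _ h u hu' u (hsub i hu))
  · exact lt_irrefl _ (hX _ _ h u (hsub i hu) u hu')

theorem successiveOn_of_support_subset {X h : ℕ → ℕ+ →₀ ℝ} (hX : BlockSupports X)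
    (hsub : ∀ i, (h i).support ⊆ (X i).support) {δ : ℝ} (hδ : 0 < δ)
    (hp : ∀ i, δ ≤ pairing (h i) (X i)) (S : Finset ℕ) : SuccessiveOn S h :=
  ⟨fun q _ h0 => (hδ.trans_le (hp q)).ne' (by simp [h0, pairing]), fun q _ r _ hqr u hu v hv =>
    hX q r hqr u (hsub q hu) v (hsub r hv)⟩

/-- Each `h i` sees only its own block, so the pairing is diagonal, and a dual vector for `a i *
pairing (h i) (X i)` attains the `ℓ_r` norm. -/
theorem le_c00Norm_of_functionals {X h : ℕ → ℕ+ →₀ ℝ} (hX : BlockSupports X)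
    (hsub : ∀ i, (h i).support ⊆ (X i).support) {δ : ℝ} (hδ : 0 < δ)
    (hp : ∀ i, δ ≤ pairing (h i) (X i)) {r r' : ℝ≥0∞} (hr : r.HolderConjugate r')
    {S : Finset ℕ} (hW : ∀ c : ℕ → ℝ, lpNormOn r' S c ≤ 1 →
      P.θ • ∑ i ∈ S, c i • h i ∈ P.normingSet) (a : ℕ → ℝ) :
    P.θ * δ * lpNormOn r S a ≤ P.c00Norm (∑ i ∈ S, a i • X i) := by
  have hr1 : 1 ≤ r := ENNReal.HolderConjugate.one_le r r'
  obtain ⟨c, hc, hca⟩ := exists_dual_lpNormOn hr S fun i => a i * pairing (h i) (X i)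
  refine le_trans ?_ ((le_abs_self _).trans (P.abs_pairing_le (hW c hc) _))
  rw [pairing_combination_diagonal hX hsub, hca, mul_assoc]
  have hθ := P.θ_pos
  gcongr
  rw [← abs_of_pos hδ, ← lpNormOn_const_mul hr1]
  refine lpNormOn_mono hr1 subset_rfl fun i _ => ?_
  rw [mul_comm, abs_mul, abs_mul, abs_of_pos hδ]
  gcongr
  exact (hp i).trans (le_abs_self _)

theorem Tracks.exists_norming {r : ℕ} {δ : ℝ} {X h : ℕ → ℕ+ →₀ ℝ} {o s : ℕ → ℕ}
    (H : P.Tracks r δ X h o s) (hδ : 0 < δ) (hr : 1 ≤ r) (hrξ : (r : ℕ∞) < P.ξ)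
    (hX : BlockSupports X) (h0 : ∀ i, X i ≠ 0) {S : Finset ℕ} (hS : S.Nonempty)
    (hSi : ∀ i ∈ S, S.card ≤ i) {c : ℕ → ℝ} (hc : lpNormOn (P.conj r) S c ≤ 1) :
    ∃ m, S.card ≤ m ∧ P.Norming (some (r, m)) (P.θ • ∑ i ∈ S, c i • h i) := by
  obtain ⟨q, hq, hN⟩ := Norming.orderPos_finset hS hr hrξ (fun q _ => H.norming q)
    (fun q _ => H.order_lt q)
    (successiveOn_of_support_subset hX H.support_subset hδ H.le_pairing S)
    (fun q hq u hu => (hSi q hq).trans (hX.lt_of_mem h0 (H.support_subset q hu)).le)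
    (fun q _ r _ hqr u hu => H.fast q r hqr u hu) hc
  exact ⟨s q, (hSi q hq).trans (H.le_size q), hN⟩

theorem Tracks.le_c00Norm {r : ℕ} {δ : ℝ} {X h : ℕ → ℕ+ →₀ ℝ} {o s : ℕ → ℕ}
    (H : P.Tracks r δ X h o s) (hδ : 0 < δ) (hr : 1 ≤ r) (hrξ : (r : ℕ∞) < P.ξ)
    (hX : BlockSupports X) (h0 : ∀ i, X i ≠ 0) {S : Finset ℕ} (hS : S.Nonempty)
    (hSi : ∀ i ∈ S, S.card ≤ i) (a : ℕ → ℝ) :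
    P.θ * δ * lpNormOn (P.p r) S a ≤ P.c00Norm (∑ i ∈ S, a i • X i) := by
  refine le_c00Norm_of_functionals hX H.support_subset hδ H.le_pairing
    (P.holderConjugate (by exact_mod_cast hr) hrξ.le) (fun c hc => ?_) a
  obtain ⟨m, -, hN⟩ := H.exists_norming hδ hr hrξ hX h0 hS hSi hc
  exact ⟨_, hN⟩

theorem exists_functionals {X : ℕ → ℕ+ →₀ ℝ} (hX1 : ∀ i, P.c00Norm (X i) = 1) :
    ∃ h : ℕ → ℕ+ →₀ ℝ, (∀ i, h i ∈ P.normingSet) ∧ (∀ i, (h i).support ⊆ (X i).support) ∧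
      ∀ i, 1 / 2 ≤ pairing (h i) (X i) := by
  have : ∀ i, ∃ g ∈ P.normingSet, g.support ⊆ (X i).support ∧ 1 / 2 ≤ pairing g (X i) := by
    intro i
    have : ∃ f ∈ P.normingSet, 1 / 2 < |pairing f (X i)| := by
      by_contra hcon
      push Not at hcon
      have := P.c00Norm_le hcon
      rw [hX1] at this
      norm_num at this
    obtain ⟨f, ⟨l, hf⟩, hp⟩ := this
    obtain ⟨l', g, hg, hsub, hgp, -⟩ := hf.exists_supported (abs_pos.1 (by linarith))
    exact ⟨g, ⟨l', hg⟩, hsub, hgp ▸ hp.le⟩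
  choose h h1 h2 h3 using this
  exact ⟨h, h1, h2, h3⟩

/-- Every normalized block sequence has a lower `ℓ_{p_ξ}` estimate. -/
theorem le_c00Norm_sum {X : ℕ → ℕ+ →₀ ℝ} (hX : BlockSupports X) (hX1 : ∀ i, P.c00Norm (X i) = 1)
    {S : Finset ℕ} (hS : S.Nonempty) (a : ℕ → ℝ) :
    P.θ * (1 / 2) * lpNormOn (P.p P.ξ) S a ≤ P.c00Norm (∑ i ∈ S, a i • X i) := by
  obtain ⟨h, h1, h2, h3⟩ := exists_functionals hX1
  exact le_c00Norm_of_functionals hX h2 one_half_pos h3 (P.holderConjugate P.one_le_ξ le_rfl)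
    (fun c hc => ⟨_, Norming.orderZero_finset hS (fun q _ => h1 q)
      (successiveOn_of_support_subset hX h2 one_half_pos h3 S) hc⟩) a

end SpaceParams

/-! ### Iterated limits and tuples realizing them -/

theorem IteratedLimit.exists_strictMono {n : ℕ} : ∀ {F : (Fin n → ℕ) → ℝ} {L : ℝ},
    IteratedLimit n F L → ∀ {φ : ℕ → ℕ}, StrictMono φ → ∀ {ε : ℝ}, 0 < ε → ∀ N : ℕ,
    ∃ τ : Fin n → ℕ, StrictMono τ ∧ (∀ i, N ≤ τ i) ∧ |F (fun i => φ (τ i)) - L| < ε := by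
  induction n with
  | zero =>
    intro F L h φ _ ε hε N
    refine ⟨Fin.elim0, fun i => i.elim0, fun i => i.elim0, ?_⟩
    have h : F Fin.elim0 = L := h
    rw [Subsingleton.elim (fun i : Fin 0 => φ (Fin.elim0 i)) Fin.elim0, h, sub_self, abs_zero]
    exact hε
  | succ n ih =>
    rintro F L ⟨g, hg, hgL⟩ φ hφ ε hε N
    have h1 : ∀ᶠ t in atTop, |g t - L| < ε / 2 := by
      have := (Metric.tendsto_nhds.1 hgL) (ε / 2) (half_pos hε)
      simpa [Real.dist_eq] using this
    obtain ⟨t, ⟨ht1, ht2⟩, htN⟩ :=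
      ((hφ.tendsto_atTop.eventually (hg.and h1)).and (eventually_ge_atTop N)).exists
    -- The remaining indices start at `t + 1`, which makes the tuple strictly increasing.
    obtain ⟨τ, hτ, hτN, hτF⟩ := ih ht1 hφ (half_pos hε) (t + 1)
    refine ⟨Fin.cons t τ, ?_, ?_, ?_⟩
    · intro i j hij
      induction i using Fin.cases with
      | zero =>
        induction j using Fin.cases with
        | zero => exact absurd hij (lt_irrefl _)
        | succ j => simpa using Nat.lt_of_succ_le (hτN j)
      | succ i =>
        induction j using Fin.cases with
        | zero => exact absurd hij (Fin.not_lt_zero _)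
        | succ j => simpa using hτ (Fin.succ_lt_succ_iff.1 hij)
    · intro i
      induction i using Fin.cases with
      | zero => simpa using htN
      | succ i =>
        have := hτN i
        simp only [Fin.cons_succ]
        omega
    · have hcons : (fun i => φ ((Fin.cons t τ : Fin (n + 1) → ℕ) i)) =
          Fin.cons (φ t) (fun i => φ (τ i)) := by
        ext i
        induction i using Fin.cases <;> simp
      rw [hcons]
      calc |F (Fin.cons (φ t) fun i => φ (τ i)) - L|
          ≤ |F (Fin.cons (φ t) fun i => φ (τ i)) - g (φ t)| + |g (φ t) - L| := abs_sub_le _ _ _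
        _ < ε := by linarith

theorem IteratedLimit.sub {n : ℕ} : ∀ {F G : (Fin n → ℕ) → ℝ} {L M : ℝ},
    IteratedLimit n F L → IteratedLimit n G M → IteratedLimit n (fun t => F t - G t) (L - M) := by
  induction n with
  | zero =>
    intro F G L M hF hG
    have hF : F Fin.elim0 = L := hF
    have hG : G Fin.elim0 = M := hG
    change F Fin.elim0 - G Fin.elim0 = L - M
    rw [hF, hG]
  | succ n ih =>
    rintro F G L M ⟨f, hf, hfL⟩ ⟨g, hg, hgM⟩
    exact ⟨fun t => f t - g t, by filter_upwards [hf, hg] with t h1 h2 using ih h1 h2,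
      hfL.sub hgM⟩

theorem IteratedLimit.le_of_forall {n : ℕ} {F : (Fin n → ℕ) → ℝ} {L B : ℝ}
    (h : IteratedLimit n F L) {N : ℕ}
    (hB : ∀ τ : Fin n → ℕ, StrictMono τ → (∀ i, N ≤ τ i) → F τ ≤ B) : L ≤ B := by
  refine le_of_forall_pos_lt_add fun ε hε => ?_
  obtain ⟨τ, hτ, hN, hF⟩ := h.exists_strictMono strictMono_id hε N
  have := hB τ hτ hN
  have := (abs_lt.1 hF).1
  simp only [id] at this
  linarith

theorem IteratedLimit.ge_of_forall {n : ℕ} {F : (Fin n → ℕ) → ℝ} {L B : ℝ}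
    (h : IteratedLimit n F L) {N : ℕ}
    (hB : ∀ τ : Fin n → ℕ, StrictMono τ → (∀ i, N ≤ τ i) → B ≤ F τ) : B ≤ L := by
  refine le_of_forall_pos_lt_add fun ε hε => ?_
  obtain ⟨τ, hτ, hN, hF⟩ := h.exists_strictMono strictMono_id hε N
  have := hB τ hτ hN
  have := (abs_lt.1 hF).2
  simp only [id] at this
  linarith

/-- The spreading model is tested on vectors of ones. The constant `C` precedes the subsequence `φ`
and the length `m`, so growth rates in `m` can be compared; the summand `1` absorbs the error of the
limit. -/
theorem GeneratesLpSpreadingModel.exists_tuple {X : Type*} [NormedAddCommGroup X]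
    [NormedSpace ℝ X] {p : ℝ≥0∞} (hp : 1 ≤ p) {x : ℕ → X} (h : GeneratesLpSpreadingModel p x) :
    ∃ C : ℝ, 1 ≤ C ∧ ∀ φ : ℕ → ℕ, StrictMono φ → ∀ m N : ℕ, 0 < m →
      ∃ τ : Fin m → ℕ, StrictMono τ ∧ (∀ i, N ≤ τ i) ∧
        C⁻¹ * (m : ℝ) ^ (1 / p.toReal) ≤ ‖∑ i, x (φ (τ i))‖ + 1 ∧
        ‖∑ i, x (φ (τ i))‖ ≤ C * (m : ℝ) ^ (1 / p.toReal) + 1 := by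
  obtain ⟨E, _, _, _, e, ⟨-, -, hlim⟩, C, hC, hCe⟩ := h
  refine ⟨C, hC, fun φ hφ m N hm => ?_⟩
  have h1 := hlim m fun _ => 1
  simp only [one_smul] at h1
  obtain ⟨τ, hτ, hN, hF⟩ := h1.exists_strictMono hφ one_pos N
  have h2 := hCe (∑ i ∈ Finset.range m, Finsupp.single i 1)
  have hsupp : (∑ i ∈ Finset.range m, Finsupp.single i (1 : ℝ)).support ⊆ Finset.range m := by
    intro j hj
    by_contra hj'
    rw [Finsupp.mem_support_iff] at hj
    exact hj (by simpa [Finsupp.finsetSum_apply, Finsupp.single_apply] using hj')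
  have hval : ∀ j ∈ Finset.range m, |(∑ i ∈ Finset.range m, Finsupp.single i (1 : ℝ)) j| =
      |(fun _ : ℕ => (1 : ℝ)) j| := by
    intro j hj
    simp [Finsupp.finsetSum_apply, Finsupp.single_apply, Finset.mem_range.1 hj]
  rw [norm_linearCombination_lpUnitVector hp _ hsupp, lpNormOn_congr hval,
    lpNormOn_one (Finset.nonempty_range_iff.2 hm.ne'), Finset.card_range] at h2
  simp only [map_sum, Finsupp.linearCombination_single, one_smul, Finset.sum_range] at h2
  obtain ⟨h3, h4⟩ := abs_lt.1 hF
  exact ⟨τ, hτ, hN, by linarith [h2.1], by linarith [h2.2]⟩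

/-! ### A criterion for basic sequences -/

section basic

variable {E : Type*} [NormedAddCommGroup E] [NormedSpace ℝ E]

theorem mem_span_range_iff_exists_range {e : ℕ → E} {v : E}
    (hv : v ∈ Submodule.span ℝ (Set.range e)) :
    ∃ (a : ℕ → ℝ) (n : ℕ), (∀ i, n ≤ i → a i = 0) ∧ v = ∑ i ∈ Finset.range n, a i • e i := by
  obtain ⟨a, rfl⟩ := Finsupp.mem_span_range_iff_exists_finsupp.1 hv
  refine ⟨a, a.support.sup id + 1, fun i hi => ?_, ?_⟩
  · by_contra h
    have := Finset.le_sup (f := id) (Finsupp.mem_support_iff.2 h)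
    simp only [id] at this
    omega
  · refine Finset.sum_subset (fun i hi => ?_) fun i _ hi => ?_
    · have := Finset.le_sup (f := id) hi
      simp only [id] at this
      simp only [Finset.mem_range]
      omega
    · simp [Finsupp.notMem_support_iff.1 hi]

/-- A sequence of nonzero vectors whose initial projections are contractive is basic. -/
theorem isBasicSequence_of_norm_le {e : ℕ → E} (h0 : ∀ i, e i ≠ 0)
    (hm : ∀ (a : ℕ → ℝ) (m n : ℕ), m ≤ n →
      ‖∑ i ∈ Finset.range m, a i • e i‖ ≤ ‖∑ i ∈ Finset.range n, a i • e i‖) :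
    IsBasicSequence e := by
  classical
  have hcoef : ∀ (a : ℕ → ℝ) (i n : ℕ), i < n →
      |a i| ≤ 2 / ‖e i‖ * ‖∑ j ∈ Finset.range n, a j • e j‖ := by
    intro a i n hin
    have h1 := hm a i n hin.le
    have h2 := hm a (i + 1) n hin
    rw [Finset.sum_range_succ] at h2
    have h3 : ‖a i • e i‖ ≤ ‖∑ j ∈ Finset.range i, a j • e j + a i • e i‖ +
        ‖∑ j ∈ Finset.range i, a j • e j‖ := by
      have := norm_sub_le (∑ j ∈ Finset.range i, a j • e j + a i • e i)
        (∑ j ∈ Finset.range i, a j • e j)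
      rwa [add_sub_cancel_left] at this
    rw [norm_smul, Real.norm_eq_abs] at h3
    have hpos : 0 < ‖e i‖ := norm_pos_iff.2 (h0 i)
    rw [div_mul_eq_mul_div, le_div_iff₀ hpos]
    linarith
  have hli : LinearIndependent ℝ e := by
    rw [linearIndependent_iff']
    intro s g hg i hi
    obtain ⟨n, hn⟩ := s.exists_nat_subset_range
    have h1 : ∑ j ∈ Finset.range n, (if j ∈ s then g j else 0) • e j = 0 := by
      rw [← hg]
      simp only [ite_smul, zero_smul]
      rw [Finset.sum_ite_mem, Finset.inter_eq_right.2 hn]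
    have := hcoef (fun j => if j ∈ s then g j else 0) i n (Finset.mem_range.1 (hn hi))
    rw [h1, norm_zero, mul_zero] at this
    simpa [hi] using this
  let M := Submodule.span ℝ (Set.range e)
  let b : Module.Basis ℕ ℝ M := Module.Basis.span hli
  have hb : ∀ i, (b i : E) = e i := fun i => by
    exact congrArg Subtype.val (Module.Basis.span_apply hli i)
  have hrepr : ∀ (a : ℕ → ℝ) (n : ℕ) (v : M), (v : E) = ∑ j ∈ Finset.range n, a j • e j →
      ∀ i, b.coord i v = if i < n then a i else 0 := by
    intro a n v hv i
    have : v = ∑ j ∈ Finset.range n, a j • b j := by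
      ext
      rw [hv]
      simp [hb]
    rw [this]
    simp [Finsupp.single_apply]
  have hbound : ∀ i (v : M), ‖b.coord i v‖ ≤ 2 / ‖e i‖ * ‖v‖ := by
    intro i v
    obtain ⟨a, n, han, hv⟩ := mem_span_range_iff_exists_range v.2
    rw [hrepr a n v hv i]
    split_ifs with h
    · have := hcoef a i n h
      rwa [← hv] at this
    · rw [norm_zero]
      positivity
  -- The coordinate functionals are bounded on the span; Hahn–Banach extends them to all of `E`,
  -- which covers the closed span.
  choose g hg _ using fun i => exists_extension_norm_eq M
    ((b.coord i).mkContinuous (2 / ‖e i‖) (hbound i))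
  have hg' : ∀ i (v : M), g i v = b.coord i v := fun i v => hg i v
  have hge : ∀ i j, g i (e j) = if i = j then 1 else 0 := by
    intro i j
    have := hg' i (b j)
    rw [hb] at this
    rw [this]
    simp [Finsupp.single_apply, eq_comm]
  have hgsum : ∀ (a : ℕ → ℝ) n, (∀ i, n ≤ i → a i = 0) → ∀ i,
      g i (∑ j ∈ Finset.range n, a j • e j) = a i := by
    intro a n han i
    simp only [map_sum, map_smul, hge, smul_eq_mul, mul_ite, mul_one, mul_zero,
      Finset.sum_ite_eq, Finset.mem_range]
    split_ifs with h
    · rfl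
    · exact (han i (not_lt.1 h)).symm
  have hS : ∀ n, ∀ v ∈ M, ‖∑ i ∈ Finset.range n, g i v • e i‖ ≤ ‖v‖ := by
    intro n v hv
    obtain ⟨a, m, ha, rfl⟩ := mem_span_range_iff_exists_range hv
    simp only [hgsum a m ha]
    rcases le_total n m with h | h
    · exact hm a n m h
    · refine le_of_eq ?_
      congr 1
      symm
      refine Finset.sum_subset (Finset.range_mono h) fun i _ hi => ?_
      rw [ha i (not_lt.1 fun h => hi (Finset.mem_range.2 h)), zero_smul]
  -- Contractivity is a closed condition and passes to the closure; convergence there then follows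
  -- by approximation from the span.
  have hScl : ∀ n, ∀ v ∈ M.topologicalClosure, ‖∑ i ∈ Finset.range n, g i v • e i‖ ≤ ‖v‖ := by
    intro n v hv
    have hclosed : IsClosed {v : E | ‖∑ i ∈ Finset.range n, g i v • e i‖ ≤ ‖v‖} := by
      refine isClosed_le ?_ continuous_norm
      fun_prop
    exact hclosed.closure_subset_iff.2 (hS n) hv
  have htend : ∀ v ∈ M.topologicalClosure,
      Tendsto (fun n => ∑ i ∈ Finset.range n, g i v • e i) atTop (𝓝 v) := by
    intro v hv
    rw [Metric.tendsto_atTop]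
    intro ε hε
    obtain ⟨w, hw, hvw⟩ := Metric.mem_closure_iff.1 (show v ∈ closure (M : Set E) from hv)
      (ε / 2) (half_pos hε)
    obtain ⟨a, m, ha, rfl⟩ := mem_span_range_iff_exists_range hw
    refine ⟨m, fun n hn => ?_⟩
    set w := ∑ i ∈ Finset.range m, a i • e i with hwdef
    have hSw : ∑ i ∈ Finset.range n, g i w • e i = w := by
      simp only [hwdef, hgsum a m ha]
      symm
      refine Finset.sum_subset (Finset.range_mono hn) fun i _ hi => ?_
      rw [ha i (not_lt.1 fun h => hi (Finset.mem_range.2 h)), zero_smul]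
    have h1 := hScl n (v - w) (M.topologicalClosure.sub_mem hv (M.le_topologicalClosure hw))
    simp only [map_sub, sub_smul, Finset.sum_sub_distrib, hSw] at h1
    rw [dist_eq_norm] at hvw ⊢
    calc ‖∑ i ∈ Finset.range n, g i v • e i - v‖
        = ‖(∑ i ∈ Finset.range n, g i v • e i - w) - (v - w)‖ := by rw [sub_sub_sub_cancel_right]
      _ ≤ ‖∑ i ∈ Finset.range n, g i v • e i - w‖ + ‖v - w‖ := norm_sub_le _ _
      _ < ε := by linarith
  refine ⟨⟨fun i => ⟨e i, M.le_topologicalClosure (Submodule.subset_span ⟨i, rfl⟩)⟩,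
    fun i => (g i).comp M.topologicalClosure.subtypeL, fun i j => ?_, fun v => ?_⟩, fun _ => rfl⟩
  · simp [hge, Pi.single_apply]
  · rw [HasSum, SummationFilter.conditional_filter_eq_map_range, tendsto_map'_iff]
    rw [tendsto_subtype_rng]
    have := htend v v.2
    simpa [Function.comp_def] using this

end basic

/-! ### Existence of spreading models through ultrafilter limits -/

section iterNorm

variable {E : Type*} [NormedAddCommGroup E] [NormedSpace ℝ E]

/-- The iterated limit along the ultrafilter `U` of `‖v + ∑ i < n, a i • z (t i)‖`. -/
def iterNorm (U : Ultrafilter ℕ) (z : ℕ → E) : ℕ → (ℕ → ℝ) → E → ℝ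
  | 0, _, v => ‖v‖
  | n + 1, a, v => limUnder (U : Filter ℕ) fun t =>
      iterNorm U z n (fun i => a (i + 1)) (v + a 0 • z t)

variable {U : Ultrafilter ℕ} {z : ℕ → E}

/-- Bounds and convergence are proved together: the bound at stage `n` confines the values to a
compact interval, where the ultrafilter limit exists and obeys the next bound. -/
theorem iterNorm_mem_Icc_and_tendsto (hz : ∀ i, ‖z i‖ = 1) (n : ℕ) :
    (∀ a v, iterNorm U z n a v ∈ Set.Icc 0 (‖v‖ + ∑ i ∈ Finset.range n, |a i|)) ∧
      ∀ a v, Tendsto (fun t => iterNorm U z n (fun i => a (i + 1)) (v + a 0 • z t)) U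
        (𝓝 (iterNorm U z (n + 1) a v)) := by
  have step : ∀ n, (∀ a v, iterNorm U z n a v ∈
      Set.Icc 0 (‖v‖ + ∑ i ∈ Finset.range n, |a i|)) → ∀ a v,
      iterNorm U z (n + 1) a v ∈ Set.Icc 0 (‖v‖ + ∑ i ∈ Finset.range (n + 1), |a i|) ∧
      Tendsto (fun t => iterNorm U z n (fun i => a (i + 1)) (v + a 0 • z t)) U
        (𝓝 (iterNorm U z (n + 1) a v)) := by
    intro n hn a v
    have hmem : ∀ t, iterNorm U z n (fun i => a (i + 1)) (v + a 0 • z t) ∈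
        Set.Icc 0 (‖v‖ + ∑ i ∈ Finset.range (n + 1), |a i|) := by
      intro t
      refine ⟨(hn _ _).1, (hn _ _).2.trans ?_⟩
      have := norm_add_le v (a 0 • z t)
      rw [norm_smul, hz, mul_one, Real.norm_eq_abs] at this
      rw [Finset.sum_range_succ']
      linarith
    obtain ⟨L, hL, hlim⟩ := isCompact_Icc.ultrafilter_le_nhds
      (U.map fun t => iterNorm U z n (fun i => a (i + 1)) (v + a 0 • z t))
      (le_principal_iff.2 (Filter.mem_map.2 (Filter.univ_mem' hmem)))
    have hlim' : Tendsto (fun t => iterNorm U z n (fun i => a (i + 1)) (v + a 0 • z t)) U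
        (𝓝 L) := hlim
    have : iterNorm U z (n + 1) a v = L := hlim'.limUnder_eq
    rw [this]
    exact ⟨hL, hlim'⟩
  have hall : ∀ n, ∀ a v, iterNorm U z n a v ∈
      Set.Icc 0 (‖v‖ + ∑ i ∈ Finset.range n, |a i|) := by
    intro n
    induction n with
    | zero => exact fun a v => ⟨norm_nonneg v, by simp [iterNorm]⟩
    | succ n ih => exact fun a v => (step n ih a v).1
  exact ⟨hall n, fun a v => (step n (hall n) a v).2⟩

theorem iterNorm_nonneg (hz : ∀ i, ‖z i‖ = 1) (n : ℕ) (a : ℕ → ℝ) (v : E) :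
    0 ≤ iterNorm U z n a v := ((iterNorm_mem_Icc_and_tendsto hz n).1 a v).1

theorem iterNorm_le (hz : ∀ i, ‖z i‖ = 1) (n : ℕ) (a : ℕ → ℝ) (v : E) :
    iterNorm U z n a v ≤ ‖v‖ + ∑ i ∈ Finset.range n, |a i| :=
  ((iterNorm_mem_Icc_and_tendsto hz n).1 a v).2

theorem tendsto_iterNorm (hz : ∀ i, ‖z i‖ = 1) (n : ℕ) (a : ℕ → ℝ) (v : E) :
    Tendsto (fun t => iterNorm U z n (fun i => a (i + 1)) (v + a 0 • z t)) U
        (𝓝 (iterNorm U z (n + 1) a v)) := (iterNorm_mem_Icc_and_tendsto hz n).2 a v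

theorem iterNorm_add_le (hz : ∀ i, ‖z i‖ = 1) (n : ℕ) : ∀ (a b : ℕ → ℝ) (v w : E),
    iterNorm U z n (fun i => a i + b i) (v + w) ≤ iterNorm U z n a v + iterNorm U z n b w := by
  induction n with
  | zero => exact fun _ _ v w => norm_add_le v w
  | succ n ih =>
    intro a b v w
    refine le_of_tendsto_of_tendsto (tendsto_iterNorm hz n _ _)
      ((tendsto_iterNorm hz n a v).add (tendsto_iterNorm hz n b w)) (Eventually.of_forall fun t => ?_)
    have h1 : v + w + (a 0 + b 0) • z t = (v + a 0 • z t) + (w + b 0 • z t) := by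
      rw [add_smul]
      abel
    simp only [h1]
    exact ih _ _ _ _

theorem iterNorm_smul (hz : ∀ i, ‖z i‖ = 1) (n : ℕ) : ∀ (c : ℝ) (a : ℕ → ℝ) (v : E),
    iterNorm U z n (fun i => c * a i) (c • v) = |c| * iterNorm U z n a v := by
  induction n with
  | zero => exact fun c _ v => norm_smul c v
  | succ n ih =>
    intro c a v
    refine tendsto_nhds_unique (tendsto_iterNorm hz n _ _)
      (((tendsto_iterNorm hz n a v).const_mul |c|).congr fun t => ?_)
    rw [← ih, smul_add, smul_smul]

theorem iterNorm_le_add (hz : ∀ i, ‖z i‖ = 1) (n : ℕ) (a b : ℕ → ℝ) (v w : E) :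
    iterNorm U z n a v ≤
      iterNorm U z n b w + (‖v - w‖ + ∑ i ∈ Finset.range n, |a i - b i|) := by
  have h1 := iterNorm_add_le (U := U) hz n b (fun i => a i - b i) w (v - w)
  simp only [add_sub_cancel] at h1
  exact h1.trans (add_le_add le_rfl (iterNorm_le hz n _ _))

theorem iterNorm_succ_of_eq_zero (hz : ∀ i, ‖z i‖ = 1) (n : ℕ) : ∀ (a : ℕ → ℝ) (v : E),
    a n = 0 → iterNorm U z (n + 1) a v = iterNorm U z n a v := by
  induction n with
  | zero =>
    intro a v h
    refine tendsto_nhds_unique (tendsto_iterNorm hz 0 a v) ?_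
    simp [h, iterNorm]
  | succ n ih =>
    intro a v h
    refine tendsto_nhds_unique (tendsto_iterNorm hz (n + 1) a v)
      ((tendsto_iterNorm hz n a v).congr fun t => ?_)
    exact (ih _ _ h).symm

theorem iterNorm_eq_of_le (hz : ∀ i, ‖z i‖ = 1) {m n : ℕ} (hmn : m ≤ n) (a : ℕ → ℝ) (v : E)
    (h : ∀ i, m ≤ i → a i = 0) : iterNorm U z n a v = iterNorm U z m a v := by
  induction n, hmn using Nat.le_induction with
  | base => rfl
  | succ n hn ih => rw [iterNorm_succ_of_eq_zero hz n a v (h n hn), ih]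

/-- A subsequence along which the iterated limits along the ultrafilter are ordinary limits. -/
theorem exists_subseq_tendsto_iterNorm [TopologicalSpace.SeparableSpace E]
    (hz : ∀ i, ‖z i‖ = 1) :
    ∃ ψ : ℕ → ℕ, StrictMono ψ ∧ ∀ (n : ℕ) (a : ℕ → ℝ) (v : E),
      Tendsto (fun j => iterNorm (hyperfilter ℕ) z n (fun i => a (i + 1)) (v + a 0 • z (ψ j))) atTop
        (𝓝 (iterNorm (hyperfilter ℕ) z (n + 1) a v)) := by
  -- `iterNorm` is Lipschitz in the vector and in the finitely many coefficients used, so control on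
  -- a countable dense set suffices.
  let D : ℕ → (ℕ → ℝ) × E := TopologicalSpace.denseSeq _
  have hD : DenseRange D := TopologicalSpace.denseRange_denseSeq _
  let u : ℕ → ℕ × ℕ → ℝ := fun t k =>
    iterNorm (hyperfilter ℕ) z k.1 (fun i => (D k.2).1 (i + 1)) ((D k.2).2 + (D k.2).1 0 • z t)
  let L : ℕ × ℕ → ℝ := fun k => iterNorm (hyperfilter ℕ) z (k.1 + 1) (D k.2).1 (D k.2).2
  have hu : Tendsto u (hyperfilter ℕ : Filter ℕ) (𝓝 L) :=
    tendsto_pi_nhds.2 fun k => tendsto_iterNorm hz k.1 _ _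
  -- A limit along a nonprincipal ultrafilter is a cluster point at infinity, and in the first
  -- countable space of sequences a cluster point is a subsequential limit.
  have hcl : MapClusterPt L atTop u := by
    refine hu.mapClusterPt.mono ?_
    rw [← Nat.cofinite_eq_atTop]
    exact hyperfilter_le_cofinite
  obtain ⟨ψ, hψ, hlim⟩ := hcl.tendsto_subseq
  refine ⟨ψ, hψ, fun n a v => ?_⟩
  rw [Metric.tendsto_atTop]
  intro ε hε
  let O : Set ((ℕ → ℝ) × E) :=
    {w | ‖v - w.2‖ + ∑ i ∈ Finset.range (n + 1), |a i - w.1 i| < ε / 3}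
  have hO : IsOpen O := by
    refine isOpen_lt ?_ continuous_const
    fun_prop
  obtain ⟨k, hk⟩ := hD.exists_mem_open hO ⟨(a, v), by simp [O, hε]⟩
  have hk' : ‖v - (D k).2‖ + ∑ i ∈ Finset.range (n + 1), |a i - (D k).1 i| < ε / 3 := hk
  have hlimk := (tendsto_pi_nhds.1 hlim) (n, k)
  obtain ⟨N, hN⟩ := Metric.tendsto_atTop.1 hlimk (ε / 3) (by linarith)
  refine ⟨N, fun j hj => ?_⟩
  have h1 := hN j hj
  simp only [Real.dist_eq, Function.comp_apply, u, L] at h1 ⊢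
  have hstep : ∀ (b c : ℕ → ℝ) (w w' : E) t,
      ‖(w + b 0 • z t) - (w' + c 0 • z t)‖ + ∑ i ∈ Finset.range n, |b (i + 1) - c (i + 1)| ≤
        ‖w - w'‖ + ∑ i ∈ Finset.range (n + 1), |b i - c i| := by
    intro b c w w' t
    have e1 : (w + b 0 • z t) - (w' + c 0 • z t) = (w - w') + (b 0 - c 0) • z t := by
      rw [sub_smul]
      abel
    have e2 := norm_add_le (w - w') ((b 0 - c 0) • z t)
    rw [norm_smul, hz, mul_one, Real.norm_eq_abs] at e2
    rw [e1, Finset.sum_range_succ']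
    linarith
  have hk'' : ‖(D k).2 - v‖ + ∑ i ∈ Finset.range (n + 1), |(D k).1 i - a i| < ε / 3 := by
    rw [norm_sub_rev]
    simp_rw [abs_sub_comm ((D k).1 _)]
    exact hk'
  have a1 := (iterNorm_le_add (U := hyperfilter ℕ) hz n (fun i => a (i + 1))
    (fun i => (D k).1 (i + 1)) (v + a 0 • z (ψ j)) ((D k).2 + (D k).1 0 • z (ψ j))).trans
    (add_le_add le_rfl (hstep _ _ _ _ _))
  have a2 := (iterNorm_le_add (U := hyperfilter ℕ) hz n (fun i => (D k).1 (i + 1))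
    (fun i => a (i + 1)) ((D k).2 + (D k).1 0 • z (ψ j)) (v + a 0 • z (ψ j))).trans
    (add_le_add le_rfl (hstep _ _ _ _ _))
  have a3 := iterNorm_le_add (U := hyperfilter ℕ) hz (n + 1) a (D k).1 v (D k).2
  have a4 := iterNorm_le_add (U := hyperfilter ℕ) hz (n + 1) (D k).1 a (D k).2 v
  rw [abs_lt] at h1 ⊢
  constructor <;> linarith [h1.1, h1.2]

theorem iteratedLimit_iterNorm {y : ℕ → E}
    (h : ∀ (n : ℕ) (a : ℕ → ℝ) (v : E),
      Tendsto (fun j => iterNorm U z n (fun i => a (i + 1)) (v + a 0 • y j)) atTop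
        (𝓝 (iterNorm U z (n + 1) a v))) (n : ℕ) : ∀ (a : ℕ → ℝ) (v : E),
    IteratedLimit n (fun t => ‖v + ∑ i : Fin n, a i • y (t i)‖) (iterNorm U z n a v) := by
  induction n with
  | zero =>
    intro a v
    simp [IteratedLimit, iterNorm]
  | succ n ih =>
    intro a v
    refine ⟨_, Eventually.of_forall fun t => ?_, h n a v⟩
    have := ih (fun i => a (i + 1)) (v + a 0 • y t)
    convert! this using 3 with s
    rw [Fin.sum_univ_succ, ← add_assoc]
    simp

end iterNorm

/-- A norm on `ℕ →₀ ℝ` is realized by the span of a sequence in a Banach space. -/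
theorem exists_banach_of_norm (ρ : (ℕ →₀ ℝ) → ℝ) (h0 : ∀ a, 0 ≤ ρ a)
    (hadd : ∀ a b, ρ (a + b) ≤ ρ a + ρ b)
    (hsmul : ∀ (c : ℝ) a, ρ (c • a) = |c| * ρ a) (hpos : ∀ a, ρ a = 0 → a = 0) :
    ∃ (E : Type) (_ : NormedAddCommGroup E) (_ : NormedSpace ℝ E) (_ : CompleteSpace E)
      (e : ℕ → E), ∀ a, ‖Finsupp.linearCombination ℝ e a‖ = ρ a := by
  let _ : Norm (ℕ →₀ ℝ) := ⟨ρ⟩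
  have core : NormedSpace.Core ℝ (ℕ →₀ ℝ) :=
    { norm_nonneg := h0
      norm_smul := fun c a => hsmul c a
      norm_triangle := hadd
      norm_eq_zero_iff := fun a => ⟨hpos a, fun h => by
        have := hsmul 0 0
        rw [zero_smul, abs_zero, zero_mul] at this
        rwa [h]⟩ }
  let _ : NormedAddCommGroup (ℕ →₀ ℝ) := NormedAddCommGroup.ofCore core
  let _ : NormedSpace ℝ (ℕ →₀ ℝ) := NormedSpace.ofCore core
  let T : (ℕ →₀ ℝ) →ₗᵢ[ℝ] UniformSpace.Completion (ℕ →₀ ℝ) := UniformSpace.Completion.toComplₗᵢ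
  refine ⟨UniformSpace.Completion (ℕ →₀ ℝ), inferInstance, inferInstance, inferInstance,
    fun i => T (Finsupp.single i 1), fun a => ?_⟩
  have h1 : Finsupp.linearCombination ℝ (fun i => T (Finsupp.single i 1)) a = T a := by
    conv_rhs => rw [← Finsupp.sum_single a]
    rw [Finsupp.linearCombination_apply, Finsupp.sum, Finsupp.sum, map_sum]
    refine Finset.sum_congr rfl fun i _ => ?_
    rw [← map_smul, Finsupp.smul_single, smul_eq_mul, mul_one]
  rw [h1, T.norm_map]
  rfl

/-- The finitely supported sequence with prescribed first `n` terms. -/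
def finsuppOfFin {n : ℕ} (a : Fin n → ℝ) : ℕ →₀ ℝ := ∑ i : Fin n, Finsupp.single (i : ℕ) (a i)

theorem finsuppOfFin_apply {n : ℕ} (a : Fin n → ℝ) (j : Fin n) : finsuppOfFin a j = a j := by
  simp [finsuppOfFin, Finsupp.finsetSum_apply, Finsupp.single_apply, Fin.val_inj]

theorem finsuppOfFin_apply_of_le {n : ℕ} (a : Fin n → ℝ) {j : ℕ} (hj : n ≤ j) :
    finsuppOfFin a j = 0 := by
  rw [finsuppOfFin, Finsupp.finsetSum_apply]
  exact Finset.sum_eq_zero fun i _ => Finsupp.single_eq_of_ne (by omega)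

theorem linearCombination_finsuppOfFin {E : Type*} [AddCommGroup E] [Module ℝ E] (e : ℕ → E)
    {n : ℕ} (a : Fin n → ℝ) :
    Finsupp.linearCombination ℝ e (finsuppOfFin a) = ∑ i, a i • e i := by
  simp [finsuppOfFin, map_sum]

theorem finsuppOfFin_restrict {n : ℕ} {a : ℕ →₀ ℝ} (h : ∀ i, n ≤ i → a i = 0) :
    finsuppOfFin (fun i : Fin n => a i) = a := by
  ext j
  by_cases hj : j < n
  · exact finsuppOfFin_apply (fun i : Fin n => a i) ⟨j, hj⟩
  · rw [finsuppOfFin_apply_of_le _ (not_lt.1 hj), h j (not_lt.1 hj)]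

theorem Finsupp.eq_zero_of_sup_lt {a : ℕ →₀ ℝ} {i : ℕ} (hi : a.support.sup id + 1 ≤ i) :
    a i = 0 := by
  by_contra h
  have := Finset.le_sup (f := id) (Finsupp.mem_support_iff.2 h)
  simp only [id] at this
  omega

theorem sum_range_eq_sum_fin {G : Type*} [AddCommGroup G] [Module ℝ G] (w : ℕ → G) (a : ℕ → ℝ)
    {m n : ℕ} (hmn : m ≤ n) : ∑ i ∈ Finset.range m, a i • w i =
      ∑ i : Fin n, (if (i : ℕ) < m then a i else 0) • w i := by
  rw [← Finset.sum_range (fun i => (if i < m then a i else 0) • w i)]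
  simp only [ite_smul, zero_smul]
  rw [← Finset.sum_filter]
  congr 1
  ext i
  simp only [Finset.mem_range, Finset.mem_filter]
  omega

/-- A normalized monotone sequence whose tuples far out satisfy `ℓ_p` estimates has a subsequence
generating an `ℓ_p` spreading model. -/
theorem exists_subseq_generatesLpSpreadingModel {E : Type*} [NormedAddCommGroup E]
    [NormedSpace ℝ E] [TopologicalSpace.SeparableSpace E] {p : ℝ≥0∞} (hp : 1 ≤ p) {z : ℕ → E}
    (hz : ∀ i, ‖z i‖ = 1)
    (hmono : ∀ (n m : ℕ) (τ : Fin n → ℕ), StrictMono τ → ∀ a : Fin n → ℝ,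
      ‖∑ i : Fin n, (if (i : ℕ) < m then a i else 0) • z (τ i)‖ ≤ ‖∑ i, a i • z (τ i)‖)
    {c C : ℝ} (hc : 0 < c)
    (hest : ∀ n, ∃ M, ∀ τ : Fin n → ℕ, StrictMono τ → (∀ i, M ≤ τ i) → ∀ a : Fin n → ℝ,
      c * lpNormOn p Finset.univ a ≤ ‖∑ i, a i • z (τ i)‖ ∧
      ‖∑ i, a i • z (τ i)‖ ≤ C * lpNormOn p Finset.univ a) :
    ∃ ψ : ℕ → ℕ, StrictMono ψ ∧ GeneratesLpSpreadingModel p (z ∘ ψ) := by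
  obtain ⟨ψ, hψ, hlim⟩ := exists_subseq_tendsto_iterNorm hz
  refine ⟨ψ, hψ, ?_⟩
  have hIL : ∀ (n : ℕ) (a : ℕ → ℝ), IteratedLimit n
      (fun t => ‖∑ i : Fin n, a i • z (ψ (t i))‖) (iterNorm (hyperfilter ℕ) z n a 0) := by
    intro n a
    have := iteratedLimit_iterNorm (y := z ∘ ψ) hlim n a 0
    simpa using this
  -- The number of steps is any bound for the support, since vanishing trailing coefficients do not
  -- change `iterNorm`.
  let ρ : (ℕ →₀ ℝ) → ℝ := fun a => iterNorm (hyperfilter ℕ) z (a.support.sup id + 1) a 0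
  have hρ : ∀ (a : ℕ →₀ ℝ) n, (∀ i, n ≤ i → a i = 0) →
      ρ a = iterNorm (hyperfilter ℕ) z n a 0 := by
    intro a n hn
    rcases le_total n (a.support.sup id + 1) with h | h
    · exact iterNorm_eq_of_le hz h a 0 hn
    · exact (iterNorm_eq_of_le hz h a 0 fun i hi => Finsupp.eq_zero_of_sup_lt hi).symm
  have hρest : ∀ (n : ℕ) (a : Fin n → ℝ), c * lpNormOn p Finset.univ a ≤ ρ (finsuppOfFin a) ∧
      ρ (finsuppOfFin a) ≤ C * lpNormOn p Finset.univ a := by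
    intro n a
    obtain ⟨M, hM⟩ := hest n
    rw [hρ _ n fun i hi => finsuppOfFin_apply_of_le a hi]
    have h := hIL n (finsuppOfFin a)
    simp only [finsuppOfFin_apply] at h
    have hM' := fun (τ : Fin n → ℕ) (hτ : StrictMono τ) (hτM : ∀ i, M ≤ τ i) =>
      hM (fun i => ψ (τ i)) (hψ.comp hτ) (fun i => (hτM i).trans (hψ.id_le _)) a
    exact ⟨h.ge_of_forall fun τ hτ hτM => (hM' τ hτ hτM).1,
      h.le_of_forall fun τ hτ hτM => (hM' τ hτ hτM).2⟩
  have hlp : ∀ a : ℕ →₀ ℝ, ∃ n, (∀ i, n ≤ i → a i = 0) ∧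
      ‖Finsupp.linearCombination ℝ (lpUnitVector p) a‖ =
        lpNormOn p Finset.univ (fun i : Fin n => a i) := by
    intro a
    refine ⟨a.support.sup id + 1, fun i hi => Finsupp.eq_zero_of_sup_lt hi, ?_⟩
    rw [norm_linearCombination_lpUnitVector hp a
      (S := Finset.univ.map (Fin.valEmbedding (n := a.support.sup id + 1))), lpNormOn_map]
    · rfl
    · intro i hi
      have := Finset.le_sup (f := id) hi
      simp only [id] at this
      exact Finset.mem_map.2 ⟨⟨i, by omega⟩, Finset.mem_univ _, rfl⟩
  have hlow : ∀ a : ℕ →₀ ℝ, c * ‖Finsupp.linearCombination ℝ (lpUnitVector p) a‖ ≤ ρ a ∧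
      ρ a ≤ C * ‖Finsupp.linearCombination ℝ (lpUnitVector p) a‖ := by
    intro a
    obtain ⟨n, hn, h⟩ := hlp a
    have := hρest n fun i => a i
    rw [finsuppOfFin_restrict hn] at this
    rwa [h]
  obtain ⟨F, i1, i2, i3, e, he⟩ := exists_banach_of_norm ρ
    (fun a => iterNorm_nonneg hz _ _ _)
    (fun a b => by
      have hab : ∀ i, max (a.support.sup id + 1) (b.support.sup id + 1) ≤ i →
          a i = 0 ∧ b i = 0 := fun i hi =>
        ⟨Finsupp.eq_zero_of_sup_lt ((le_max_left _ _).trans hi),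
          Finsupp.eq_zero_of_sup_lt ((le_max_right _ _).trans hi)⟩
      rw [hρ a _ fun i hi => (hab i hi).1, hρ b _ fun i hi => (hab i hi).2,
        hρ (a + b) _ fun i hi => by rw [Finsupp.add_apply, (hab i hi).1, (hab i hi).2, add_zero]]
      have h := iterNorm_add_le (U := hyperfilter ℕ) hz
        (max (a.support.sup id + 1) (b.support.sup id + 1)) a b (0 : E) 0
      rw [add_zero] at h
      exact h)
    (fun t a => by
      rw [hρ (t • a) (a.support.sup id + 1) fun i hi => by
        rw [Finsupp.smul_apply, Finsupp.eq_zero_of_sup_lt hi, smul_zero]]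
      have h := iterNorm_smul (U := hyperfilter ℕ) hz (a.support.sup id + 1) t a (0 : E)
      rw [smul_zero] at h
      exact h)
    (fun a ha => by
      obtain ⟨n, hn, h⟩ := hlp a
      have h1 := (hlow a).1
      rw [ha, h] at h1
      have h2 : lpNormOn p Finset.univ (fun i : Fin n => a i) ≤ 0 := by
        by_contra hcon
        have := mul_pos hc (not_le.1 hcon)
        linarith
      ext j
      by_cases hj : j < n
      · exact abs_nonpos_iff.1
          ((abs_le_lpNormOn (a := fun i : Fin n => a i) hp (Finset.mem_univ ⟨j, hj⟩)).trans h2)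
      · exact hn j (not_lt.1 hj))
  have hnorm : ∀ (n : ℕ) (a : Fin n → ℝ), ‖∑ i, a i • e i‖ = ρ (finsuppOfFin a) := fun n a => by
    rw [← he, linearCombination_finsuppOfFin]
  have hspread : ∀ (n : ℕ) (a : Fin n → ℝ), IteratedLimit n
      (fun t => ‖∑ i, a i • z (ψ (t i))‖) ‖∑ i, a i • e i‖ := by
    intro n a
    rw [hnorm, hρ _ n fun i hi => finsuppOfFin_apply_of_le a hi]
    simpa only [finsuppOfFin_apply] using hIL n (finsuppOfFin a)
  refine ⟨F, i1, i2, i3, e, ⟨?_, ?_, hspread⟩, max c⁻¹ (max C 1), ?_, fun a => ?_⟩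
  · refine isBasicSequence_of_norm_le (fun i h0 => ?_) fun a m n hmn => ?_
    · have h1 := hlow (Finsupp.single i 1)
      rw [← he, norm_linearCombination_lpUnitVector hp _ subset_rfl,
        Finsupp.linearCombination_single, h0, smul_zero, norm_zero] at h1
      have h2 := abs_le_lpNormOn (a := Finsupp.single i (1 : ℝ)) hp
        (S := (Finsupp.single i (1 : ℝ)).support) (i := i) (by simp)
      simp only [Finsupp.single_eq_same, abs_one] at h2
      have := mul_pos hc (zero_lt_one.trans_le h2)
      linarith [h1.1]
    · rw [sum_range_eq_sum_fin e a hmn, Finset.sum_range]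
      -- Monotonicity of `z` passes to the spreading model as the sign of an iterated limit of
      -- differences.
      have h1 := (hspread n fun i => if (i : ℕ) < m then a i else 0).sub (hspread n fun i => a i)
      have := h1.le_of_forall (N := 0) (B := 0) fun τ hτ _ =>
        sub_nonpos.2 (hmono n m (fun i => ψ (τ i)) (hψ.comp hτ) fun i => a i)
      linarith
  · refine isBasicSequence_of_norm_le (fun i h0 => ?_) fun a m n hmn => ?_
    · have := hz (ψ i)
      rw [Function.comp_apply] at h0
      rw [h0, norm_zero] at this
      exact zero_ne_one this
    · rw [sum_range_eq_sum_fin (z ∘ ψ) a hmn, Finset.sum_range]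
      exact hmono n m (fun i => ψ i) (hψ.comp Fin.val_strictMono) fun i => a i
  · exact (le_max_right _ _).trans (le_max_right _ _)
  · rw [he]
    have hc' : 0 < max c⁻¹ (max C 1) := (inv_pos.2 hc).trans_le (le_max_left _ _)
    obtain ⟨h1, h2⟩ := hlow a
    have h3 : 0 ≤ ‖Finsupp.linearCombination ℝ (lpUnitVector p) a‖ := by
      obtain ⟨n, -, h⟩ := hlp a
      exact h ▸ lpNormOn_nonneg
    constructor
    · refine le_trans ?_ h1
      refine mul_le_mul_of_nonneg_right ?_ h3
      rw [inv_le_comm₀ hc' hc]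
      exact le_max_left _ _
    · refine h2.trans (mul_le_mul_of_nonneg_right ?_ h3)
      exact (le_max_left _ _).trans (le_max_right _ _)

/-! ### Growth comparison, uniform coefficients and block sums -/

theorem one_div_toReal_lt {p q : ℝ≥0∞} (hp : 1 ≤ p) (hpq : p < q) :
    1 / q.toReal < 1 / p.toReal := by
  have h := ENNReal.toReal_strict_mono (ENNReal.inv_ne_top.2 (zero_lt_one.trans_le hp).ne')
    (ENNReal.inv_lt_inv.2 hpq)
  rwa [ENNReal.toReal_inv, ENNReal.toReal_inv, ← one_div, ← one_div] at h

theorem exists_rpow_gt {α β A B : ℝ} (hβ : 0 ≤ β) (hαβ : β < α) (hA : 0 < A) :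
    ∃ m : ℕ, 0 < m ∧ B * (m : ℝ) ^ β + 1 < A * (m : ℝ) ^ α := by
  have h1 : Tendsto (fun m : ℕ => (m : ℝ) ^ (α - β)) atTop atTop :=
    (tendsto_rpow_atTop (sub_pos.2 hαβ)).comp tendsto_natCast_atTop_atTop
  obtain ⟨m, hm, hm0⟩ := ((h1.eventually_gt_atTop ((|B| + 1) / A)).and
    (eventually_gt_atTop 0)).exists
  refine ⟨m, hm0, ?_⟩
  have hmpos : (0 : ℝ) < m := by exact_mod_cast hm0
  rw [div_lt_iff₀ hA] at hm
  have h2 : (m : ℝ) ^ α = (m : ℝ) ^ (α - β) * (m : ℝ) ^ β := by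
    rw [← Real.rpow_add hmpos, sub_add_cancel]
  have h3 : 1 ≤ (m : ℝ) ^ β := Real.one_le_rpow (by exact_mod_cast hm0) hβ
  have h4 := mul_lt_mul_of_pos_right hm (zero_lt_one.trans_le h3)
  have h5 := mul_le_mul_of_nonneg_right (le_abs_self B) (zero_le_one.trans h3)
  rw [h2]
  linarith

theorem sum_map_extend {E : Type*} [AddCommGroup E] [Module ℝ E] {n : ℕ} {τ : Fin n → ℕ}
    (hτ : Function.Injective τ) (a : Fin n → ℝ) (X : ℕ → E) :
    ∑ i ∈ Finset.univ.map ⟨τ, hτ⟩, Function.extend τ a 0 i • X i = ∑ i, a i • X (τ i) := by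
  rw [Finset.sum_map]
  exact Finset.sum_congr rfl fun i _ => by simp [hτ.extend_apply]

theorem lpNormOn_map_extend {p : ℝ≥0∞} {n : ℕ} {τ : Fin n → ℕ}
    (hτ : Function.Injective τ) (a : Fin n → ℝ) :
    lpNormOn p (Finset.univ.map ⟨τ, hτ⟩) (Function.extend τ a 0) = lpNormOn p Finset.univ a := by
  rw [lpNormOn_map]
  exact lpNormOn_congr fun i _ => by simp [hτ.extend_apply]

theorem card_mul_rpow_eq {p p' : ℝ≥0∞} (h : p.HolderConjugate p') {n : ℕ} (hn : 0 < n) :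
    (n : ℝ) * (1 / (n : ℝ)) ^ (1 / p'.toReal) = (n : ℝ) ^ (1 / p.toReal) := by
  have hn' : (0 : ℝ) < n := by exact_mod_cast hn
  rw [one_div (n : ℝ), Real.inv_rpow hn'.le, ← Real.rpow_neg hn'.le]
  nth_rewrite 1 [← Real.rpow_one (n : ℝ)]
  rw [← Real.rpow_add hn']
  congr 1
  linarith [h.one_div_toReal_add]

theorem lpNormOn_uniform_le {ι : Type*} {r : ℝ≥0∞} (hr : 1 ≤ r) {S : Finset ι}
    (hS : S.Nonempty) :
    lpNormOn r S (fun _ => (1 / (S.card : ℝ)) ^ (1 / r.toReal)) ≤ 1 := by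
  have hn : (0 : ℝ) < S.card := by exact_mod_cast hS.card_pos
  refine (lpNormOn_le_card_rpow hr (M := (1 / (S.card : ℝ)) ^ (1 / r.toReal)) (by positivity)
    fun _ _ => (abs_of_nonneg (by positivity)).le).trans_eq ?_
  rw [← Real.mul_rpow (by positivity) (by positivity), one_div_mul_cancel hn.ne', Real.one_rpow]

theorem isBlockSequence_of_finsets {E : Type*} [AddCommGroup E] [Module ℝ E] (x : ℕ → E)
    {G : ℕ → Finset ℕ} (hG : ∀ j, (G j).Nonempty)
    (hs : ∀ j, ∀ a ∈ G j, ∀ b ∈ G (j + 1), a < b) {t : ℕ → ℝ} (ht : ∀ j, t j ≠ 0) :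
    IsBlockSequence (fun j => t j • ∑ i ∈ G j, x i) x := by
  classical
  have happ : ∀ j i, (∑ k ∈ G j, Finsupp.single k (t j)) i = if i ∈ G j then t j else 0 := by
    intro j i
    simp [Finsupp.finsetSum_apply, Finsupp.single_apply]
  have hsupp : ∀ j i, i ∈ (∑ k ∈ G j, Finsupp.single k (t j)).support → i ∈ G j := by
    intro j i hi
    rw [Finsupp.mem_support_iff, happ] at hi
    by_contra h
    exact hi (if_neg h)
  refine ⟨fun j => ∑ i ∈ G j, Finsupp.single i (t j), fun j h0 => ?_,
    fun j a ha b hb => hs j a (hsupp j a ha) b (hsupp _ b hb), fun j => ?_⟩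
  · obtain ⟨i, hi⟩ := hG j
    have h1 := happ j i
    rw [show ∑ k ∈ G j, Finsupp.single k (t j) = 0 from h0, if_pos hi] at h1
    exact ht j h1.symm
  · simp [map_sum, Finset.smul_sum]

theorem mem_span_single (a : ℕ+ →₀ ℝ) :
    a ∈ Submodule.span ℝ (Set.range fun j : ℕ+ => Finsupp.single j (1 : ℝ)) :=
  Finsupp.mem_span_range_iff_exists_finsupp.2 ⟨a, by simp⟩

/-! ### Block sequences inside the completion -/

namespace SpaceParams

/-- The canonical map of `c₀₀` into the completion. -/
def toSpace (P : SpaceParams) : (ℕ+ →₀ ℝ) →ₗ[ℝ] P.Space :=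
  (UniformSpace.Completion.toComplₗᵢ (𝕜 := ℝ) (E := P.C00)).toLinearMap

variable {P : SpaceParams}

theorem norm_toSpace (x : ℕ+ →₀ ℝ) : ‖P.toSpace x‖ = P.c00Norm x :=
  (UniformSpace.Completion.toComplₗᵢ (𝕜 := ℝ) (E := P.C00)).norm_map x

theorem linearCombination_basis (a : ℕ+ →₀ ℝ) :
    Finsupp.linearCombination ℝ P.basis a = P.toSpace a := by
  conv_rhs => rw [← Finsupp.sum_single a]
  rw [Finsupp.linearCombination_apply, Finsupp.sum, Finsupp.sum, map_sum]
  refine Finset.sum_congr rfl fun i _ => ?_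
  have : P.basis i = P.toSpace (Finsupp.single i 1) := rfl
  rw [this, ← map_smul, Finsupp.smul_single, smul_eq_mul, mul_one]

instance : TopologicalSpace.SeparableSpace P.C00 := by
  let e : ℕ+ → P.C00 := fun j => Finsupp.single j (1 : ℝ)
  have h2 := (Set.countable_range e).isSeparable.span (R := ℝ)
  rw [← TopologicalSpace.isSeparable_univ_iff]
  exact h2.mono fun a _ => mem_span_single a

theorem BlockSupports.of_succ {X : ℕ → ℕ+ →₀ ℝ} (h0 : ∀ i, X i ≠ 0)
    (h : ∀ i, ∀ u ∈ (X i).support, ∀ v ∈ (X (i + 1)).support, u < v) : BlockSupports X := by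
  intro i j hij
  induction j, Nat.succ_le_of_lt hij using Nat.le_induction with
  | base => exact h i
  | succ j hj ih =>
    intro u hu v hv
    obtain ⟨w, hw⟩ := Finsupp.support_nonempty_iff.2 (h0 j)
    exact (ih (Nat.lt_of_succ_le hj) u hu w hw).trans (h j w hw v hv)

theorem ne_zero_of_c00Norm {x : ℕ+ →₀ ℝ} (h : P.c00Norm x = 1) : x ≠ 0 := by
  rintro rfl
  have : ‖P.toSpace 0‖ = 1 := by rw [norm_toSpace, h]
  rw [map_zero, norm_zero] at this
  exact zero_ne_one this

/-- Dropping the last blocks is the restriction to the supports of the first `m`, hence contractive.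
-/
theorem c00Norm_truncate_le {X : ℕ → ℕ+ →₀ ℝ} (hX : BlockSupports X) {n : ℕ} (m : ℕ)
    {τ : Fin n → ℕ} (hτ : StrictMono τ) (a : Fin n → ℝ) :
    P.c00Norm (∑ i : Fin n, (if (i : ℕ) < m then a i else 0) • X (τ i)) ≤
      P.c00Norm (∑ i, a i • X (τ i)) := by
  classical
  let D : Finset ℕ+ := Finset.univ.biUnion fun i : Fin n =>
    if (i : ℕ) < m then (X (τ i)).support else ∅
  have : ∑ i : Fin n, (if (i : ℕ) < m then a i else 0) • X (τ i) =
      (∑ i, a i • X (τ i)).filter (· ∈ D) := by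
    ext j
    by_cases hj : j ∈ D
    · rw [Finsupp.filter_apply_pos (· ∈ D) _ hj, Finsupp.finsetSum_apply, Finsupp.finsetSum_apply]
      obtain ⟨i₀, -, hi₀⟩ := Finset.mem_biUnion.1 hj
      refine Finset.sum_congr rfl fun i _ => ?_
      split_ifs with hi
      · rfl
      · have hi₀m : (i₀ : ℕ) < m := by
          by_contra h
          simp [h] at hi₀
        rw [if_pos hi₀m] at hi₀
        have hlt : τ i₀ < τ i := hτ (by rw [Fin.lt_def]; omega)
        have : X (τ i) j = 0 := by
          by_contra h
          exact lt_irrefl _ (hX _ _ hlt j hi₀ j (Finsupp.mem_support_iff.2 h))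
        simp [this]
    · rw [Finsupp.filter_apply_neg (· ∈ D) _ hj, Finsupp.finsetSum_apply]
      refine Finset.sum_eq_zero fun i _ => ?_
      split_ifs with hi
      · have : X (τ i) j = 0 := by
          by_contra h
          refine hj (Finset.mem_biUnion.2 ⟨i, Finset.mem_univ _, ?_⟩)
          rw [if_pos hi]
          exact Finsupp.mem_support_iff.2 h
        simp [this]
      · simp
  rw [this]
  exact c00Norm_filter_le _ D

/-! ### From vanishing behaviour to the spreading model -/

theorem exists_subseq_generates {K : ℕ} (hK : ((K + 1 : ℕ) : ℕ∞) ≤ P.ξ) {Y : ℕ → ℕ+ →₀ ℝ}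
    (hY : BlockSupports Y) (hY1 : ∀ i, P.c00Norm (Y i) = 1) (hv : P.Vanishing K Y)
    (hnv : ((K + 1 : ℕ) : ℕ∞) < P.ξ → ¬ P.Vanishing (K + 1) Y) :
    ∃ φ : ℕ → ℕ, StrictMono φ ∧
      GeneratesLpSpreadingModel (P.p (K + 1 : ℕ)) fun j => P.toSpace (Y (φ j)) := by
  have h1K : (1 : ℕ∞) ≤ ((K + 1 : ℕ) : ℕ∞) := by exact_mod_cast Nat.le_add_left 1 K
  have hp1 := P.one_le_p' h1K hK
  have hY0 : ∀ i, Y i ≠ 0 := fun i => ne_zero_of_c00Norm (hY1 i)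
  -- The lower estimate comes from order `0` functionals if `K + 1 = ξ`, and from order `K + 1`
  -- combinations of tracking functionals otherwise. It must survive the later thinning `ψ`; `S.card
  -- ≤ i` provides admissibility.
  obtain ⟨φ₁, hφ₁, c, hc, hlow⟩ : ∃ φ₁ : ℕ → ℕ, StrictMono φ₁ ∧ ∃ c : ℝ, 0 < c ∧
      ∀ ψ : ℕ → ℕ, StrictMono ψ → ∀ S : Finset ℕ, S.Nonempty → (∀ i ∈ S, S.card ≤ i) →
        ∀ a : ℕ → ℝ, c * lpNormOn (P.p (K + 1 : ℕ)) S a ≤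
          P.c00Norm (∑ i ∈ S, a i • (Y ∘ φ₁ ∘ ψ) i) := by
    have hθ := P.θ_pos
    rcases hK.eq_or_lt with h | h
    · refine ⟨id, strictMono_id, P.θ * (1 / 2), by positivity, fun ψ hψ S hS _ a => ?_⟩
      rw [h]
      exact le_c00Norm_sum (hY.comp hψ) (fun i => hY1 _) hS a
    · obtain ⟨δ, hδ, φ, hφ, g, o, s, H⟩ := exists_tracks hY hY0 (hnv h)
      exact ⟨φ, hφ, P.θ * δ, by positivity, fun ψ hψ S hS hSi a =>
        (H.comp hψ).le_c00Norm hδ (by omega) h ((hY.comp hφ).comp hψ) (fun i => hY0 _) hS hSi a⟩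
  obtain ⟨φ₂, hφ₂, hsp⟩ := (hv.comp hφ₁).exists_eventuallySparse (hY.comp hφ₁) fun i => hY0 _
  set Z : ℕ → ℕ+ →₀ ℝ := Y ∘ φ₁ ∘ φ₂ with hZ
  have hZb : BlockSupports Z := hY.comp (hφ₁.comp hφ₂)
  have hnorm : ∀ (n : ℕ) (τ : Fin n → ℕ) (a : Fin n → ℝ),
      ‖∑ i, a i • P.toSpace (Z (τ i))‖ = P.c00Norm (∑ i, a i • Z (τ i)) := by
    intro n τ a
    rw [← norm_toSpace]
    simp only [map_sum, map_smul]
  obtain ⟨ψ, hψ, hgen⟩ := exists_subseq_generatesLpSpreadingModel hp1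
    (z := fun j => P.toSpace (Z j)) (fun i => (norm_toSpace _).trans (hY1 _))
    (fun n m τ hτ a => by
      rw [hnorm, hnorm]
      exact c00Norm_truncate_le hZb m hτ a) (C := 2) hc (fun n => by
      obtain ⟨M, hM⟩ := hsp n
      refine ⟨max M n, fun τ hτ hτM a => ?_⟩
      rw [hnorm, ← sum_map_extend hτ.injective, ← lpNormOn_map_extend hτ.injective]
      have hcard : (Finset.univ.map ⟨τ, hτ.injective⟩).card = n := by simp
      have hmem : ∀ i ∈ Finset.univ.map ⟨τ, hτ.injective⟩, max M n ≤ i := by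
        intro i hi
        obtain ⟨j, -, rfl⟩ := Finset.mem_map.1 hi
        exact hτM j
      constructor
      · rcases (Finset.univ.map ⟨τ, hτ.injective⟩).eq_empty_or_nonempty with h | h
        · rw [h]
          have : lpNormOn (P.p (K + 1 : ℕ)) ∅ (Function.extend τ a 0) ≤ 0 :=
            (lpNormOn_le_card_rpow hp1 le_rfl (by simp)).trans_eq (zero_mul _)
          exact (mul_nonpos_of_nonneg_of_nonpos hc.le this).trans (P.c00Norm_nonneg _)
        · exact hlow φ₂ hφ₂ _ h (fun i hi => hcard.le.trans ((le_max_right _ _).trans (hmem i hi))) _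
      · exact c00Norm_sum_le hK hZb (fun i _ => (hY1 _).le)
          (hM _ hcard fun i hi => (le_max_left _ _).trans (hmem i hi)) _)
  exact ⟨φ₁ ∘ φ₂ ∘ ψ, hφ₁.comp (hφ₂.comp hψ), hgen⟩

/-! ### Normalized block sums and the two claims -/

/-- The normalized sums of `X` over the finite sets `F j`. -/
def normalizedSums (P : SpaceParams) (X : ℕ → ℕ+ →₀ ℝ) (F : ℕ → Finset ℕ) (j : ℕ) : ℕ+ →₀ ℝ :=
  (P.c00Norm (∑ i ∈ F j, X i))⁻¹ • ∑ i ∈ F j, X i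

theorem abs_pairing_normalizedSums (X : ℕ → ℕ+ →₀ ℝ) (F : ℕ → Finset ℕ) (j : ℕ) (f : ℕ+ →₀ ℝ) :
    |pairing f (P.normalizedSums X F j)| =
      |pairing f (∑ i ∈ F j, X i)| / P.c00Norm (∑ i ∈ F j, X i) := by
  rw [normalizedSums, pairing_smul, abs_mul, abs_inv, abs_of_nonneg (P.c00Norm_nonneg _),
    inv_mul_eq_div]

theorem exists_block_generates {K : ℕ} (hK : ((K + 1 : ℕ) : ℕ∞) ≤ P.ξ) {X : ℕ → ℕ+ →₀ ℝ}
    (hX : BlockSupports X) {φ : ℕ → ℕ} (hφ : StrictMono φ) {F : ℕ → Finset ℕ}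
    (hF : ∀ j, (F j).Nonempty) (hFs : ∀ i j, i < j → ∀ a ∈ F i, ∀ b ∈ F j, a < b)
    (hpos : ∀ j, 0 < P.c00Norm (∑ i ∈ F j, (X ∘ φ) i))
    (hv : P.Vanishing K (P.normalizedSums (X ∘ φ) F))
    (hnv : ((K + 1 : ℕ) : ℕ∞) < P.ξ → ¬ P.Vanishing (K + 1) (P.normalizedSums (X ∘ φ) F)) :
    ∃ y : ℕ → P.Space, IsBlockSequence y (fun j => P.toSpace (X j)) ∧ (∀ j, ‖y j‖ = 1) ∧
      GeneratesLpSpreadingModel (P.p (K + 1 : ℕ)) y := by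
  set Y := P.normalizedSums (X ∘ φ) F with hYdef
  have hY1 : ∀ j, P.c00Norm (Y j) = 1 := by
    intro j
    rw [← norm_toSpace, hYdef, normalizedSums, map_smul, norm_smul, norm_toSpace, Real.norm_eq_abs,
      abs_inv, abs_of_pos (hpos j), inv_mul_cancel₀ (hpos j).ne']
  have hsupp : ∀ j, ∀ u ∈ (Y j).support, ∃ i ∈ F j, u ∈ (X (φ i)).support := by
    intro j u hu
    by_contra hcon
    push Not at hcon
    rw [Finsupp.mem_support_iff] at hu
    apply hu
    have h0 : ∑ i ∈ F j, ((X ∘ φ) i) u = 0 :=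
      Finset.sum_eq_zero fun i hi => Finsupp.notMem_support_iff.1 (hcon i hi)
    rw [hYdef, normalizedSums, Finsupp.smul_apply, Finsupp.finsetSum_apply, h0, smul_zero]
  have hY : BlockSupports Y := by
    intro i j hij u hu v hv
    obtain ⟨a, ha, hu'⟩ := hsupp i u hu
    obtain ⟨b, hb, hv'⟩ := hsupp j v hv
    exact hX _ _ (hφ (hFs i j hij a ha b hb)) u hu' v hv'
  obtain ⟨ψ, hψ, hgen⟩ := exists_subseq_generates hK hY hY1 hv hnv
  refine ⟨_, ?_, fun j => (norm_toSpace _).trans (hY1 _), hgen⟩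
  have hb := isBlockSequence_of_finsets (fun j => P.toSpace (X j))
    (G := fun j => (F (ψ j)).map ⟨φ, hφ.injective⟩)
    (t := fun j => (P.c00Norm (∑ i ∈ F (ψ j), (X ∘ φ) i))⁻¹)
    (fun j => Finset.map_nonempty.2 (hF _))
    (fun j a ha b hb => by
      obtain ⟨a', ha', rfl⟩ := Finset.mem_map.1 ha
      obtain ⟨b', hb', rfl⟩ := Finset.mem_map.1 hb
      exact hφ (hFs _ _ (hψ (Nat.lt_succ_self j)) a' ha' b' hb'))
    (fun j => inv_ne_zero (hpos _).ne')
  convert! hb using 2 with j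
  rw [hYdef, normalizedSums, map_smul, map_sum, Finset.sum_map]
  rfl

/-- The uniform coefficients `|S|^{-1/r'}` summed over `|S|` blocks give `|S|^{1/r}`. -/
theorem le_pairing_uniform {X h : ℕ → ℕ+ →₀ ℝ} (hX : BlockSupports X)
    (hsub : ∀ i, (h i).support ⊆ (X i).support) {δ : ℝ} (hp : ∀ i, δ ≤ pairing (h i) (X i))
    {r r' : ℝ≥0∞} (hr : r.HolderConjugate r') {S : Finset ℕ} (hS : S.Nonempty) :
    P.θ * δ * (S.card : ℝ) ^ (1 / r.toReal) ≤
      pairing (P.θ • ∑ i ∈ S, ((1 / (S.card : ℝ)) ^ (1 / r'.toReal)) • h i) (∑ i ∈ S, X i) := by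
  have h1 := pairing_combination_diagonal (P := P) hX hsub S (fun _ => 1)
    (fun _ => (1 / (S.card : ℝ)) ^ (1 / r'.toReal))
  simp only [one_smul, one_mul] at h1
  rw [h1, ← card_mul_rpow_eq hr hS.card_pos, mul_assoc]
  have hθ := P.θ_pos
  refine mul_le_mul_of_nonneg_left ?_ hθ.le
  rw [← Finset.mul_sum]
  have h2 : (S.card : ℝ) * δ ≤ ∑ i ∈ S, pairing (h i) (X i) := by
    rw [← nsmul_eq_mul]
    exact Finset.card_nsmul_le_sum _ _ _ fun i _ => hp i
  calc _ = (1 / (S.card : ℝ)) ^ (1 / r'.toReal) * (S.card * δ) := by ring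
    _ ≤ _ := by gcongr

theorem exists_block_of_top {X : ℕ → ℕ+ →₀ ℝ} (hX : BlockSupports X)
    (hX1 : ∀ i, P.c00Norm (X i) = 1)
    (hgen : GeneratesLpSpreadingModel (P.p P.ξ) fun j => P.toSpace (X j)) :
    ∃ y : ℕ → P.Space, IsBlockSequence y (fun j => P.toSpace (X j)) ∧ (∀ j, ‖y j‖ = 1) ∧
      GeneratesLpSpreadingModel (P.p 1) y := by
  have hpξ := P.one_le_p' P.one_le_ξ le_rfl
  have hθ := P.θ_pos
  obtain ⟨C, hC, hCx⟩ := hgen.exists_tuple hpξ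
  obtain ⟨F, hF, hFs⟩ := exists_successive_finsets
    (Q := fun F => F.Nonempty →
      P.c00Norm (∑ i ∈ F, X i) ≤ (C + 1) * (F.card : ℝ) ^ (1 / (P.p P.ξ).toReal)) (by
    intro N m
    rcases m.eq_zero_or_pos with rfl | hm
    · exact ⟨∅, rfl, by simp, by simp⟩
    · obtain ⟨τ, hτ, hτN, -, h⟩ := hCx id strictMono_id m N hm
      refine ⟨Finset.univ.map ⟨τ, hτ.injective⟩, by simp, fun i hi => ?_, fun _ => ?_⟩
      · obtain ⟨j, -, rfl⟩ := Finset.mem_map.1 hi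
        exact hτN j
      · rw [← norm_toSpace, map_sum, Finset.sum_map, Finset.card_map, Finset.card_univ,
          Fintype.card_fin]
        refine h.trans ?_
        -- The additive error is absorbed into the constant `C + 1`.
        have : 1 ≤ (m : ℝ) ^ (1 / (P.p P.ξ).toReal) :=
          Real.one_le_rpow (by exact_mod_cast hm) (by positivity)
        linarith)
  have hFn : ∀ j, (F j).Nonempty := fun j => Finset.card_pos.1 ((Nat.zero_le j).trans_lt (hF j).1)
  obtain ⟨h, h1, h2, h3⟩ := exists_functionals hX1
  have hlow : ∀ j, P.θ * (1 / 2) * ((F j).card : ℝ) ^ (1 / (P.p P.ξ).toReal) ≤ pairing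
      (P.θ • ∑ i ∈ F j, ((1 / ((F j).card : ℝ)) ^ (1 / (P.conj P.ξ).toReal)) • h i)
      (∑ i ∈ F j, X i) :=
    fun j => le_pairing_uniform hX h2 h3 (P.holderConjugate P.one_le_ξ le_rfl) (hFn j)
  have hN : ∀ j, P.Norming (some (0, (F j).card))
      (P.θ • ∑ i ∈ F j, ((1 / ((F j).card : ℝ)) ^ (1 / (P.conj P.ξ).toReal)) • h i) :=
    fun j => Norming.orderZeroSized_finset (hFn j) le_rfl (fun q _ => h1 q)
      (successiveOn_of_support_subset hX h2 one_half_pos h3 _)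
  have hcard : ∀ j, (0 : ℝ) < ((F j).card : ℝ) ^ (1 / (P.p P.ξ).toReal) := fun j =>
    Real.rpow_pos_of_pos (by exact_mod_cast (hFn j).card_pos) _
  have hpos : ∀ j, 0 < P.c00Norm (∑ i ∈ F j, X i) := fun j =>
    (mul_pos (by positivity) (hcard j)).trans_le ((hlow j).trans
      ((le_abs_self _).trans (P.abs_pairing_le ⟨_, hN j⟩ _)))
  refine exists_block_generates (K := 0) (by simpa using P.one_le_ξ) hX strictMono_id hFn hFs hpos
    (vanishing_zero _) fun _ hv => ?_
  -- Relative to norms at most `(C + 1) |F|^{1/p_ξ}`, this threshold is half of what the order `0`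
  -- functional of size `|F|` achieves.
  obtain ⟨N, hvN⟩ := hv (P.θ * (1 / 2) / (2 * (C + 1))) (by positivity)
  have := hvN _ _ _ N (hN N) (by omega) (hF N).1.le le_rfl
  rw [abs_pairing_normalizedSums, Function.comp_id, div_le_iff₀ (hpos N)] at this
  have h4 := (hF N).2 (hFn N)
  have h5 := (hlow N).trans (le_abs_self _)
  have h6 : P.θ * (1 / 2) / (2 * (C + 1)) * P.c00Norm (∑ i ∈ F N, X i) ≤
      P.θ * (1 / 2) / 2 * ((F N).card : ℝ) ^ (1 / (P.p P.ξ).toReal) := by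
    calc _ ≤ P.θ * (1 / 2) / (2 * (C + 1)) *
          ((C + 1) * ((F N).card : ℝ) ^ (1 / (P.p P.ξ).toReal)) := by gcongr
      _ = _ := by field_simp
  have h7 := mul_pos hθ (hcard N)
  linarith

/-- Otherwise tracking functionals of order below `K` give a lower `ℓ_{p_K}` estimate on a
subsequence, and `m^{1/p_K}` outgrows `m^{1/p_{K+1}}`. -/
theorem vanishing_of_generates {K : ℕ} (hK : ((K + 1 : ℕ) : ℕ∞) < P.ξ) {X : ℕ → ℕ+ →₀ ℝ}
    (hX : BlockSupports X) (hX1 : ∀ i, P.c00Norm (X i) = 1)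
    (hgen : GeneratesLpSpreadingModel (P.p (K + 1 : ℕ)) fun j => P.toSpace (X j)) :
    P.Vanishing K X := by
  rcases K.eq_zero_or_pos with rfl | hK0
  · exact vanishing_zero X
  have hKK : (K : ℕ∞) < ((K + 1 : ℕ) : ℕ∞) := by exact_mod_cast Nat.lt_succ_self K
  have h1K : (1 : ℕ∞) ≤ K := by exact_mod_cast hK0
  have hlt : P.p K < P.p (K + 1 : ℕ) :=
    P.p_strictMono ⟨h1K, (hKK.trans hK).le⟩ ⟨h1K.trans hKK.le, hK.le⟩ hKK
  have hp1 := P.one_le_p' h1K (hKK.trans hK).le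
  by_contra hv
  obtain ⟨δ, hδ, φ, hφ, h, o, s, H⟩ :=
    exists_tracks hX (fun i => ne_zero_of_c00Norm (hX1 i)) hv
  obtain ⟨C, hC, hCx⟩ := hgen.exists_tuple (hp1.trans hlt.le)
  obtain ⟨m, hm, hgt⟩ := exists_rpow_gt (β := 1 / (P.p (K + 1 : ℕ)).toReal) (B := C) (by positivity)
    (one_div_toReal_lt hp1 hlt) (mul_pos P.θ_pos hδ)
  obtain ⟨τ, hτ, hτN, -, hle⟩ := hCx φ hφ m m hm
  have hne : (Finset.univ.map ⟨τ, hτ.injective⟩).Nonempty :=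
    Finset.card_pos.1 (by simpa using hm)
  have h1 := H.le_c00Norm hδ hK0 (hKK.trans hK) (hX.comp hφ) (fun i => ne_zero_of_c00Norm (hX1 _))
    hne (fun i hi => by
      obtain ⟨j, -, rfl⟩ := Finset.mem_map.1 hi
      simpa using hτN j) fun _ => 1
  rw [lpNormOn_one hne, ← norm_toSpace, map_sum, Finset.sum_map, Finset.card_map, Finset.card_univ,
    Fintype.card_fin] at h1
  simp only [one_smul] at h1
  exact absurd (h1.trans hle) (not_le.2 hgt)

/-- Otherwise a subsequence has sparse tuples with an upper `ℓ_{p_{K+2}}` estimate, too small for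
sums of norm about `m^{1/p_{K+1}}`. -/
theorem not_vanishing_of_generates {K : ℕ} (hK : ((K + 1 : ℕ) : ℕ∞) < P.ξ) {X : ℕ → ℕ+ →₀ ℝ}
    (hX : BlockSupports X) (hX1 : ∀ i, P.c00Norm (X i) = 1)
    (hgen : GeneratesLpSpreadingModel (P.p (K + 1 : ℕ)) fun j => P.toSpace (X j)) :
    ¬ P.Vanishing (K + 1) X := by
  intro hv
  have hK2 : ((K + 1 + 1 : ℕ) : ℕ∞) ≤ P.ξ := by
    push_cast at hK ⊢
    exact Order.add_one_le_of_lt hK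
  have hKK : ((K + 1 : ℕ) : ℕ∞) < ((K + 1 + 1 : ℕ) : ℕ∞) := by exact_mod_cast Nat.lt_succ_self _
  have h1K : (1 : ℕ∞) ≤ ((K + 1 : ℕ) : ℕ∞) := by exact_mod_cast Nat.le_add_left 1 K
  have hlt : P.p (K + 1 : ℕ) < P.p (K + 1 + 1 : ℕ) :=
    P.p_strictMono ⟨h1K, hK.le⟩ ⟨h1K.trans hKK.le, hK2⟩ hKK
  have hp1 := P.one_le_p' h1K hK.le
  obtain ⟨φ, hφ, hsp⟩ := hv.exists_eventuallySparse hX fun i => ne_zero_of_c00Norm (hX1 i)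
  obtain ⟨C, hC, hCx⟩ := hgen.exists_tuple hp1
  obtain ⟨m, hm, hgt⟩ := exists_rpow_gt (β := 1 / (P.p (K + 1 + 1 : ℕ)).toReal) (B := 2)
    (by positivity) (one_div_toReal_lt hp1 hlt) (inv_pos.2 (zero_lt_one.trans_le hC))
  obtain ⟨M, hM⟩ := hsp m
  obtain ⟨τ, hτ, hτN, hle, -⟩ := hCx φ hφ m M hm
  have hne : (Finset.univ.map ⟨τ, hτ.injective⟩).Nonempty :=
    Finset.card_pos.1 (by simpa using hm)
  have h1 := c00Norm_sum_le hK2 (hX.comp hφ) (fun i _ => (hX1 _).le)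
    (hM (Finset.univ.map ⟨τ, hτ.injective⟩) (by simp) fun i hi => by
      obtain ⟨j, -, rfl⟩ := Finset.mem_map.1 hi
      exact hτN j) fun _ => 1
  rw [lpNormOn_one hne, ← norm_toSpace, map_sum, Finset.sum_map, Finset.card_map, Finset.card_univ,
    Fintype.card_fin] at h1
  simp only [one_smul] at h1
  have h2 : ‖∑ i, P.toSpace (X (φ (τ i)))‖ ≤ 2 * (m : ℝ) ^ (1 / (P.p (K + 1 + 1 : ℕ)).toReal) := h1
  linarith

theorem exists_block_succ {K : ℕ} (hK : ((K + 1 : ℕ) : ℕ∞) < P.ξ) {X : ℕ → ℕ+ →₀ ℝ}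
    (hX : BlockSupports X) (hX1 : ∀ i, P.c00Norm (X i) = 1)
    (hgen : GeneratesLpSpreadingModel (P.p (K + 1 : ℕ)) fun j => P.toSpace (X j)) :
    ∃ y : ℕ → P.Space, IsBlockSequence y (fun j => P.toSpace (X j)) ∧ (∀ j, ‖y j‖ = 1) ∧
      GeneratesLpSpreadingModel (P.p (K + 1 + 1 : ℕ)) y := by
  have hK2 : ((K + 1 + 1 : ℕ) : ℕ∞) ≤ P.ξ := by
    push_cast at hK ⊢
    exact Order.add_one_le_of_lt hK
  have h1K : (1 : ℕ∞) ≤ ((K + 1 : ℕ) : ℕ∞) := by exact_mod_cast Nat.le_add_left 1 K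
  have hp1 := P.one_le_p' h1K hK.le
  have hpξ : P.p (K + 1 : ℕ) < P.p P.ξ := P.p_strictMono ⟨h1K, hK.le⟩ ⟨P.one_le_ξ, le_rfl⟩ hK
  have hθ := P.θ_pos
  have hX0 : ∀ i, X i ≠ 0 := fun i => ne_zero_of_c00Norm (hX1 i)
  obtain ⟨δ, hδ, φ₁, hφ₁, h, o, s, H⟩ :=
    exists_tracks hX hX0 (not_vanishing_of_generates hK hX hX1 hgen)
  obtain ⟨φ₂, hφ₂, hsp⟩ := ((vanishing_of_generates hK hX hX1 hgen).comp
    hφ₁).exists_eventuallySparse (hX.comp hφ₁) fun i => hX0 _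
  replace H := H.comp hφ₂
  rw [Function.comp_assoc] at H hsp
  have hφ := hφ₁.comp hφ₂
  set φ := φ₁ ∘ φ₂ with hφdef
  have hZ : BlockSupports (X ∘ φ) := hX.comp hφ
  obtain ⟨F, hF, hFs⟩ := exists_successive_finsets
    (Q := fun F => (∀ i ∈ F, F.card ≤ i) ∧ P.Sparse K F (X ∘ φ)) (by
    intro N m
    obtain ⟨M, hM⟩ := hsp m
    -- Starting at `N + M + m` serves the three requirements: position beyond `N`, sparseness beyond
    -- `M`, admissibility beyond the length `m`.
    have hmem : ∀ i ∈ Finset.Ico (N + M + m) (N + M + m + m), N + M + m ≤ i := fun i hi =>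
      (Finset.mem_Ico.1 hi).1
    have hcard : (Finset.Ico (N + M + m) (N + M + m + m)).card = m := by simp
    refine ⟨_, hcard, fun i hi => ?_, fun i hi => ?_, hM _ hcard fun i hi => ?_⟩
    · have := hmem i hi
      omega
    · have := hmem i hi
      omega
    · have := hmem i hi
      omega)
  have hFn : ∀ j, (F j).Nonempty := fun j => Finset.card_pos.1 ((Nat.zero_le j).trans_lt (hF j).1)
  set α := 1 / (P.p (K + 1 : ℕ)).toReal with hα
  set β := 1 / (P.p P.ξ).toReal with hβ
  have hαβ : β < α := one_div_toReal_lt hp1 hpξ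
  have hβ0 : 0 ≤ β := by positivity
  have hlow : ∀ j, P.θ * δ * ((F j).card : ℝ) ^ α ≤ pairing
      (P.θ • ∑ i ∈ F j, ((1 / ((F j).card : ℝ)) ^ (1 / (P.conj (K + 1 : ℕ)).toReal)) • (h ∘ φ₂) i)
      (∑ i ∈ F j, (X ∘ φ) i) :=
    fun j => le_pairing_uniform hZ H.support_subset H.le_pairing
      (P.holderConjugate h1K hK.le) (hFn j)
  have hN : ∀ j, ∃ m, (F j).card ≤ m ∧ P.Norming (some (K + 1, m))
      (P.θ • ∑ i ∈ F j, ((1 / ((F j).card : ℝ)) ^ (1 / (P.conj (K + 1 : ℕ)).toReal)) •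
        (h ∘ φ₂) i) :=
    fun j => H.exists_norming hδ (by omega) hK hZ (fun i => hX0 _) (hFn j) (hF j).2.1
      (lpNormOn_uniform_le (P.one_le_conj _) (hFn j))
  have hcard0 : ∀ j, (0 : ℝ) < (F j).card := fun j => by exact_mod_cast (hFn j).card_pos
  have hcard : ∀ j, (0 : ℝ) < ((F j).card : ℝ) ^ α := fun j => Real.rpow_pos_of_pos (hcard0 j) _
  have hnlow : ∀ j, P.θ * δ * ((F j).card : ℝ) ^ α ≤ P.c00Norm (∑ i ∈ F j, (X ∘ φ) i) := by
    intro j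
    obtain ⟨m, -, hm⟩ := hN j
    exact (hlow j).trans ((le_abs_self _).trans (P.abs_pairing_le ⟨_, hm⟩ _))
  have hpos : ∀ j, 0 < P.c00Norm (∑ i ∈ F j, (X ∘ φ) i) := fun j =>
    (mul_pos (by positivity) (hcard j)).trans_le (hnlow j)
  refine exists_block_generates (K := K + 1) hK2 hX hφ hFn hFs hpos ?_ fun _ hv => ?_
  · intro ε hε
    -- After division by the lower bound `θδ|F|^α` for the norm, the estimate for functionals of
    -- size at least `N` is at most this quantity over `θδ`, since `|F| ≥ N`.
    have t1 : Tendsto (fun N : ℕ => 2 * (N : ℝ) ^ (-α) + 2 * (N : ℝ) ^ (β - α)) atTop (𝓝 0) := by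
      have e1 := (tendsto_rpow_neg_atTop (hβ0.trans_lt hαβ)).comp tendsto_natCast_atTop_atTop
      have e2 := (tendsto_rpow_neg_atTop (sub_pos.2 hαβ)).comp tendsto_natCast_atTop_atTop
      rw [neg_sub] at e2
      simpa using (e1.const_mul 2).add (e2.const_mul 2)
    obtain ⟨N, hNε, hN0⟩ := ((t1.eventually_le_const
      (show 0 < ε * (P.θ * δ) by positivity)).and (eventually_gt_atTop 0)).exists
    refine ⟨N, fun f o s j hf ho hs hj => ?_⟩
    have hN0' : (0 : ℝ) < N := by exact_mod_cast hN0
    have hNj : (N : ℝ) ≤ (F j).card := by exact_mod_cast hj.trans (hF j).1.le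
    have hb := hf.abs_pairing_sum_le_of_size hK hZ (fun i _ => (hX1 _).le) (hF j).2.2
      (a := fun _ => 1) (fun i _ => by simp) hN0 o s rfl (by omega) hs (F j) subset_rfl
    simp only [one_smul, ← hα, ← hβ] at hb
    rw [abs_pairing_normalizedSums, div_le_iff₀ (hpos j)]
    refine hb.trans (le_trans ?_ (mul_le_mul_of_nonneg_left (hnlow j) hε.le))
    have e1 : (1 : ℝ) ≤ (N : ℝ) ^ (-α) * ((F j).card : ℝ) ^ α := by
      rw [Real.rpow_neg hN0'.le, ← div_eq_inv_mul, one_le_div (Real.rpow_pos_of_pos hN0' _)]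
      exact Real.rpow_le_rpow hN0'.le hNj (hβ0.trans hαβ.le)
    have e2 : ((F j).card : ℝ) ^ β ≤ (N : ℝ) ^ (β - α) * ((F j).card : ℝ) ^ α := by
      calc ((F j).card : ℝ) ^ β = ((F j).card : ℝ) ^ (β - α) * ((F j).card : ℝ) ^ α := by
            rw [← Real.rpow_add (hcard0 j), sub_add_cancel]
        _ ≤ _ := by
            refine mul_le_mul_of_nonneg_right ?_ (hcard j).le
            exact Real.rpow_le_rpow_of_nonpos hN0' hNj (by linarith)
    have e3 := mul_le_mul_of_nonneg_right hNε (hcard j).le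
    linarith
  -- The norm of the sum is at most `2|F|^α`, so the threshold `θδ/4` would allow only `θδ|F|^α /
  -- 2`, half of the actual value.
  · obtain ⟨N, hvN⟩ := hv (P.θ * δ / 4) (by positivity)
    obtain ⟨m, hm, hNm⟩ := hN N
    have := hvN _ _ _ N hNm (by omega) ((hF N).1.le.trans hm) le_rfl
    rw [abs_pairing_normalizedSums, div_le_iff₀ (hpos N)] at this
    have h4 := c00Norm_sum_le hK.le hZ (fun i _ => (hX1 _).le) (hF N).2.2 fun _ => 1
    simp only [one_smul] at h4
    rw [lpNormOn_one (hFn N)] at h4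
    have h5 := (hlow N).trans (le_abs_self _)
    have h6 := mul_le_mul_of_nonneg_left h4 (show 0 ≤ P.θ * δ / 4 by positivity)
    have h7 := mul_pos (mul_pos hθ hδ) (hcard N)
    linarith

end SpaceParams

end

theorem mainTheorem6 (P : SpaceParams) (x : ℕ → P.Space)
    (hx : IsBlockSequence x P.basis) (hnorm : ∀ j, ‖x j‖ = 1) :
    (GeneratesLpSpreadingModel (P.p P.ξ) x →
      ∃ y : ℕ → P.Space, IsBlockSequence y x ∧ (∀ j, ‖y j‖ = 1) ∧
        GeneratesLpSpreadingModel (P.p 1) y) ∧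
    (∀ k : ℕ, 1 ≤ k → (k : ℕ∞) < P.ξ → GeneratesLpSpreadingModel (P.p k) x →
      ∃ y : ℕ → P.Space, IsBlockSequence y x ∧ (∀ j, ‖y j‖ = 1) ∧
        GeneratesLpSpreadingModel (P.p ((k + 1 : ℕ) : ℕ∞)) y) := by
  obtain ⟨X, hX0, hXs, hxX⟩ := hx
  have hX := SpaceParams.BlockSupports.of_succ hX0 hXs
  obtain rfl : x = fun j => P.toSpace (X j) :=
    funext fun j => (hxX j).trans (SpaceParams.linearCombination_basis _)
  have hX1 : ∀ i, P.c00Norm (X i) = 1 := fun i => (SpaceParams.norm_toSpace _).symm.trans (hnorm i)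
  refine ⟨fun hgen => SpaceParams.exists_block_of_top hX hX1 hgen, fun k hk hkξ hgen => ?_⟩
  obtain ⟨K, rfl⟩ : ∃ K, k = K + 1 := ⟨k - 1, by omega⟩
  exact SpaceParams.exists_block_succ hkξ hX hX1 hgen
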